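/- **Setting.** A monotone set system of a finite set $U$ is a family $\mathcal F\subseteq 2^U$ with $U\in\mathcal F$ that is closed under supersets. For real $\ell\ge 0$, a set $S\subseteq U$ is an $\ell$-extension of $X\subseteq U$ if $X\cup S\in\mathcal F$ and $|S|\le \ell$. For $\alpha\ge 1$, a random $\alpha$-extension oracle for $\mathcal F$ is a function $\mathcal O\colon 2^U\times\mathbb N\times\{0,1\}^m\to 2^U$ (for some $m\in\mathbb N$) such that $\mathcal O(X,\ell,r)\cup X\in\mathcal F$ for all $X,\ell,r$, and such that, whenever $X$ has an $\ell$-extension, $\mathcal O(X,\ell,r)$ is an $(\alpha\ell)$-extension of $X$ for at least half of all $r\in\{0,1\}^m$. Let $\alpha,c\ge 1$ and $\beta\ge1$. An algorithm here is a randomized program (for a fixed register machine with coin tosses that is polynomially equivalent to Turing machines). Its input is the universe $U=\{0,\dots,n-1\}$, and it may query a random $\alpha$-extension oracle for an unknown monotone set system $\mathcal F$ of $U$; each query $(X,\ell)$ is answered by $\mathcal O(X,\ell,r)$ with fresh uniformly random $r$. The cost of an execution is the number of its computational operations plus the sum of $c^{\ell}$ over all queries $(X,\ell)$ made; the algorithm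 has cost $f$ if, for all $n$, every execution on an instance with $|U|\le n$ costs at most $f(n)$. It is a $\beta$-approximation if, on every instance, it always returns some $S\in\mathcal F$, and $|S|\le\beta\cdot\min_{T\in\mathcal F}|T|$ with probability at least $\tfrac12$. Let $\mathrm{best}(\alpha,c,\beta)$ be the infimum of all $d\ge 1$ for which there is a $\beta$-approximation algorithm of cost $d^n\cdot n^{O(1)}$. For $0<a,b<1$ let $D(a\,\|\,b)=a\ln\frac ab+(1-a)\ln\frac{1-a}{1-b}$. **Lemma.** Let $\beta,c>1$ be real numbers. There is exactly one $d\in\left(1,\,1+\frac{c-1}{\beta}\right)$ with $$D\!\left(\tfrac1\beta\,\Big\|\,\tfrac{d-1}{c-1}\right)=\frac{\ln c}{\beta};$$ denote it by $\mathrm{amls}_{\mathrm{ESA}}(\beta,c)$. Then $$\mathrm{best}(\beta,c,\beta)=\mathrm{amls}_{\mathrm{ESA}}(\beta,c).$$ -/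

import Mathlib

namespace MonotoneSearch

/-! ### Monotone set systems and extension oracles

The universe with `n` elements is `Fin n`, that is, its elements are numbered `0, …, n - 1`; this is
the form in which a universe is handed to an algorithm. -/

/-- A monotone set system of `Fin n`: it contains the universe and is closed under supersets. -/
def IsMonotoneSystem {n : ℕ} (F : Set (Finset (Fin n))) : Prop :=
  Finset.univ ∈ F ∧ ∀ S T : Finset (Fin n), S ⊆ T → S ∈ F → T ∈ F

/-- `S` is an `ℓ`-extension of `X` with respect to `F` (`ℓ` real, since `α * ℓ` need not be an
integer). -/
def IsExtension {n : ℕ} (F : Set (Finset (Fin n))) (ℓ : ℝ) (X S : Finset (Fin n)) : Prop :=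
  X ∪ S ∈ F ∧ (S.card : ℝ) ≤ ℓ

/-- The data of an oracle `2^U × ℕ × {0,1}^m → 2^U`, where `m = bits`. -/
structure Oracle (n : ℕ) where
  bits : ℕ
  answer : Finset (Fin n) → ℕ → (Fin bits → Bool) → Finset (Fin n)

/-- `O` is a random `α`-extension oracle for the set system `F`: every answer completes the queried
set to a member of `F`, and if `X` has an `ℓ`-extension then for at least half of the bit strings
the answer is an `α * ℓ`-extension of `X`. -/
def IsExtensionOracle {n : ℕ} (α : ℝ) (F : Set (Finset (Fin n))) (O : Oracle n) : Prop :=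
  (∀ X ℓ r, O.answer X ℓ r ∪ X ∈ F) ∧
  ∀ (X : Finset (Fin n)) (ℓ : ℕ), (∃ S, IsExtension F (ℓ : ℝ) X S) →
    (1 / 2 : ℝ) * (2 : ℝ) ^ O.bits ≤
      (Set.ncard {r : Fin O.bits → Bool | IsExtension F (α * ℓ) X (O.answer X ℓ r)} : ℝ)

/-! ### Randomized algorithms with oracle access

A register machine with structured programs. Number registers hold natural numbers and can be
added, subtracted and halved; every operation lengthens a number by at most one bit, so counting
operations agrees, up to a polynomial factor, with counting bit operations. Set registers hold
subsets of the universe and are manipulated elementwise, or as a whole at a charge of `n + 1`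
operations. The machine can toss fair coins and query its oracles, which are labelled by `ι`. -/

/-- Elementary instructions. Registers are named by natural numbers; `r, a, b` name number
registers and `x, y, z` name set registers. -/
inductive Instr (ι : Type) : Type where
  /-- `r := v` -/
  | const (r v : ℕ)
  /-- `r := a + b` -/
  | add (r a b : ℕ)
  /-- `r := a - b`, truncated at `0` -/
  | sub (r a b : ℕ)
  /-- `r := ⌊a / 2⌋` -/
  | half (r a : ℕ)
  /-- put the element numbered by the content of `a` into `x` (no effect if there is none) -/
  | insert (x a : ℕ)
  /-- remove the element numbered by the content of `a` from `x` -/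
  | erase (x a : ℕ)
  /-- `r := 1` if the element numbered by the content of `a` lies in `x`, and `r := 0` otherwise -/
  | mem (r x a : ℕ)
  /-- `x := ∅` -/
  | clear (x : ℕ)
  /-- `x := y ∪ z` -/
  | union (x y z : ℕ)
  /-- `r := |x|` -/
  | card (r x : ℕ)
  /-- `r :=` a uniformly random bit -/
  | flip (r : ℕ)
  /-- `y :=` the answer of the oracle `j` to the query `(x, ℓ)`, where `ℓ` is the content of `a` and
  the bit string of the query is fresh and uniformly random -/
  | query (j : ι) (y x a : ℕ)

/-- Programs. -/
inductive Prog (ι : Type) : Type where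
  | instr (i : Instr ι)
  | seq (p q : Prog ι)
  /-- run `p` if the number register `r` is nonzero, and `q` otherwise -/
  | cond (r : ℕ) (p q : Prog ι)
  /-- run `p` as long as the number register `r` is nonzero -/
  | loop (r : ℕ) (p : Prog ι)

/-- The state of the machine: register contents, the number of computational operations so far, and
the oracle queries `(j, X, ℓ)` so far (latest first, with repetitions). -/
structure State (ι : Type) (n : ℕ) where
  reg : ℕ → ℕ
  sets : ℕ → Finset (Fin n)
  ops : ℕ
  queries : List (ι × Finset (Fin n) × ℕ)

namespace State

variable {ι : Type} {n : ℕ}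

/-- The initial state: number register `0` holds the size of the universe. -/
def start (ι : Type) (n : ℕ) : State ι n where
  reg := fun i => if i = 0 then n else 0
  sets := fun _ => ∅
  ops := 0
  queries := []

/-- The result of a computation is read off set register `0`. -/
def output (s : State ι n) : Finset (Fin n) := s.sets 0

/-- Count `k` computational operations. -/
def tick (s : State ι n) (k : ℕ) : State ι n := { s with ops := s.ops + k }

def setReg (s : State ι n) (r v : ℕ) : State ι n := { s with reg := Function.update s.reg r v }

def setSet (s : State ι n) (x : ℕ) (X : Finset (Fin n)) : State ι n :=
  { s with sets := Function.update s.sets x X }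

/-- Record an oracle query. -/
def record (s : State ι n) (j : ι) (X : Finset (Fin n)) (ℓ : ℕ) : State ι n :=
  { s with queries := (j, X, ℓ) :: s.queries }

/-- The universe elements numbered by `v`: one element if `v < n`, none otherwise. -/
def element (n v : ℕ) : Finset (Fin n) := Finset.univ.filter fun i => (i : ℕ) = v

/-- The cost of an execution that ends in `s`: the number of computational operations plus the sum
of `c_j ^ ℓ` over all oracle queries `(j, X, ℓ)`. -/
noncomputable def cost (c : ι → ℝ) (s : State ι n) : ℝ :=
  s.ops + (s.queries.map fun q => c q.1 ^ q.2.2).sum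

end State

/-- The distribution of the state after an elementary instruction. -/
noncomputable def Instr.step {ι : Type} {n : ℕ} (O : ι → Oracle n) (s : State ι n) :
    Instr ι → PMF (State ι n)
  | .const r v => PMF.pure ((s.setReg r v).tick 1)
  | .add r a b => PMF.pure ((s.setReg r (s.reg a + s.reg b)).tick 1)
  | .sub r a b => PMF.pure ((s.setReg r (s.reg a - s.reg b)).tick 1)
  | .half r a => PMF.pure ((s.setReg r (s.reg a / 2)).tick 1)
  | .insert x a => PMF.pure ((s.setSet x (s.sets x ∪ State.element n (s.reg a))).tick 1)
  | .erase x a => PMF.pure ((s.setSet x (s.sets x \ State.element n (s.reg a))).tick 1)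
  | .mem r x a =>
      PMF.pure ((s.setReg r (s.sets x ∩ State.element n (s.reg a)).card).tick 1)
  | .clear x => PMF.pure ((s.setSet x ∅).tick (n + 1))
  | .union x y z => PMF.pure ((s.setSet x (s.sets y ∪ s.sets z)).tick (n + 1))
  | .card r x => PMF.pure ((s.setReg r (s.sets x).card).tick (n + 1))
  | .flip r => (PMF.uniformOfFintype Bool).map fun b => (s.setReg r b.toNat).tick 1
  | .query j y x a => (PMF.uniformOfFintype (Fin (O j).bits → Bool)).map fun w =>
      (s.setSet y ((O j).answer (s.sets x) (s.reg a) w)).record j (s.sets x) (s.reg a)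

/-- `Exec O p s μ`: started in the state `s` with the oracles `O`, every execution of the program
`p` halts, and the final state has distribution `μ`. Every test of a condition counts as one
operation. -/
inductive Exec {ι : Type} {n : ℕ} (O : ι → Oracle n) :
    Prog ι → State ι n → PMF (State ι n) → Prop where
  | instr (i : Instr ι) (s : State ι n) : Exec O (.instr i) s (i.step O s)
  | seq (p q : Prog ι) (s : State ι n) (μ : PMF (State ι n)) (ν : State ι n → PMF (State ι n)) :
      Exec O p s μ → (∀ t ∈ μ.support, Exec O q t (ν t)) → Exec O (.seq p q) s (μ.bind ν)
  | cond_true (r : ℕ) (p q : Prog ι) (s : State ι n) (μ : PMF (State ι n)) :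
      s.reg r ≠ 0 → Exec O p (s.tick 1) μ → Exec O (.cond r p q) s μ
  | cond_false (r : ℕ) (p q : Prog ι) (s : State ι n) (μ : PMF (State ι n)) :
      s.reg r = 0 → Exec O q (s.tick 1) μ → Exec O (.cond r p q) s μ
  | loop_true (r : ℕ) (p : Prog ι) (s : State ι n) (μ : PMF (State ι n)) :
      s.reg r ≠ 0 → Exec O (.seq p (.loop r p)) (s.tick 1) μ → Exec O (.loop r p) s μ
  | loop_false (r : ℕ) (p : Prog ι) (s : State ι n) :
      s.reg r = 0 → Exec O (.loop r p) s (PMF.pure (s.tick 1))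

/-! ### The subset minimization problem of a specification list

A specification list is a non-empty finite set `L` of pairs `(α, c)` of real numbers `≥ 1`. An
algorithm for it has one oracle for each pair `(α, c) ∈ L`. -/

/-- `(F, O)` is an instance over `Fin n`: `F` is a monotone set system, and for each `(α, c) ∈ L`
there is a random `α`-extension oracle for `F`. -/
def IsInstance (L : Finset (ℝ × ℝ)) {n : ℕ} (F : Set (Finset (Fin n))) (O : L → Oracle n) : Prop :=
  IsMonotoneSystem F ∧ ∀ j : L, IsExtensionOracle j.1.1 F (O j)

/-- `A` is a randomized `β`-approximation algorithm: on every instance it halts, always returns a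
member of `F`, and with probability at least `1/2` this member has size at most `β` times the
minimum size of a member of `F`. -/
def IsApproximation (L : Finset (ℝ × ℝ)) (β : ℝ) (A : Prog L) : Prop :=
  ∀ (n : ℕ) (F : Set (Finset (Fin n))) (O : L → Oracle n), IsInstance L F O →
    ∃ μ : PMF (State L n), Exec O A (State.start L n) μ ∧
      (∀ s ∈ μ.support, s.output ∈ F) ∧
      1 / 2 ≤ μ.toOuterMeasure {s | ∀ T ∈ F, (s.output.card : ℝ) ≤ β * (T.card : ℝ)}

/-- `A` has cost `f`: every execution of `A` on an instance whose universe has at most `n` elements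
costs at most `f n`. -/
def HasCost (L : Finset (ℝ × ℝ)) (A : Prog L) (f : ℕ → ℝ) : Prop :=
  ∀ n m : ℕ, m ≤ n → ∀ (F : Set (Finset (Fin m))) (O : L → Oracle m), IsInstance L F O →
    ∃ μ : PMF (State L m), Exec O A (State.start L m) μ ∧
      ∀ s ∈ μ.support, s.cost (fun j : L => j.1.2) ≤ f n

/-- `best(L, β)`: the infimum of all `d ≥ 1` such that some `β`-approximation algorithm has cost
`d ^ n * n ^ O(1)`. -/
noncomputable def best (L : Finset (ℝ × ℝ)) (β : ℝ) : ℝ :=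
  sInf {d : ℝ | 1 ≤ d ∧ ∃ A : Prog L, IsApproximation L β A ∧
    ∃ (C : ℝ) (a : ℕ), HasCost L A fun n => C * ((n : ℝ) + 1) ^ a * d ^ n}

/-- `best(α, c, β)`, the case of a single oracle. -/
noncomputable def bestSingle (α c β : ℝ) : ℝ := best {(α, c)} β

/-! ### The bound of Esmer et al. -/

/-- The Kullback-Leibler divergence between Bernoulli distributions with parameters `a` and `b`. -/
noncomputable def klBernoulli (a b : ℝ) : ℝ :=
  a * Real.log (a / b) + (1 - a) * Real.log ((1 - a) / (1 - b))

/-- The property that singles out `amls_ESA(β, c)`. -/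
def IsAmlsESA (β c d : ℝ) : Prop :=
  d ∈ Set.Ioo 1 (1 + (c - 1) / β) ∧ klBernoulli (1 / β) ((d - 1) / (c - 1)) = Real.log c / β

/-- `amls_ESA(β, c)`: the number with the property `IsAmlsESA β c` (meaningful when there is exactly
one). -/
noncomputable def amlsESA (β c : ℝ) : ℝ := Classical.epsilon (IsAmlsESA β c)

end MonotoneSearch

namespace MonotoneSearch

/-! ### The equation for `amlsESA` -/

/-! The divergence `D(1/β ‖ ·)` decreases strictly on `(0, 1/β]` from arbitrarily large values to
`0`, so the equation has exactly one solution. With `b = (d - 1) / (c - 1)` and `w = (1 - b) / (1 -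
1/β)` it says `c b β = w ^ (1 - β)`, and `d = 1 - b + c b`. Hence `d ^ n` is the total weight of all
subsets `P` when `P` has weight `(c b) ^ |P| * (1 - b) ^ (n - |P|)`.

Lower bound. Fix `k` with `β k < n`. Compare the system of all sets with more than `β k` elements
with the system that also contains all supersets of a hidden `k`-set `P`. Oracles for the two can
agree except on queries `(X, ℓ)` with `|P \ X| ≤ ℓ` and `|X| ≤ β k - β ℓ + 1`. A `β`-approximation
must, when run on the first system, ask such a query with probability at least `1/2`, for every `P`
(`half_le_revealed`). An exponential moment bound for `|P ∩ X|` shows that one query reveals hidden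
sets of total weight at most `w * c ^ ℓ`, a constant times its cost (`sum_weight_le`). Averaging
over `P` and summing over `k` gives `d ^ n ≤ poly(n) * cost` (`pow_le_of_approximation`).

Upper bound. Let `P` be an optimum and `k = |P|`. If a sample `X` has `t` elements, `x` of them in
`P`, and `t ≤ β x`, then the query `(X, k - x)` yields, with probability at least `1/2`, a solution
of size at most `t + β (k - x) ≤ β k`. Unless `k ≤ b n`, where the empty sample serves, take `x ≈ t
/ β` and `k - x ≈ b (n - t)`. A uniform `t`-set then qualifies with probability at least `c ^ ℓ /
(poly(n) * d ^ n)`, where `ℓ = k - x` (`pow_mul_choose_le`). So about `d ^ n / c ^ ℓ` trials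
suffice, and they cost about `d ^ n`. Since `ℓ` and `t` are unknown, the algorithm tries every `ℓ`
and draws the inclusion probability of the sample at random (`le_sampleMean`). Computable trial
numbers `K * D ^ n * G ^ ℓ`, with `D` near `x` and `G` near `1 / c`, achieve every base `x > d`
(`Parameters.exists_localSearch`). -/

theorem klBernoulli_eq {a b : ℝ} (ha : 0 < a) (ha1 : a < 1) (hb : 0 < b) (hb1 : b < 1) :
    klBernoulli a b = a * (Real.log a - Real.log b) +
      (1 - a) * (Real.log (1 - a) - Real.log (1 - b)) := by
  rw [klBernoulli, Real.log_div ha.ne' hb.ne', Real.log_div (by linarith) (by linarith)]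

theorem klBernoulli_self {a : ℝ} (ha : 0 < a) (ha1 : a < 1) : klBernoulli a a = 0 := by
  simp [klBernoulli_eq ha ha1 ha ha1]

/-- The derivative in the second argument `b` is `(b - a) / (b (1 - b))`. The proof is a
finite-difference version: both differences of logarithms are bounded by `log u ≤ u - 1`, and the
linear terms compare because `(1 - a) / (1 - y) ≤ a / y` for `y ≤ a`. -/
theorem klBernoulli_strictAntiOn {a : ℝ} (ha : 0 < a) (ha1 : a < 1) :
    StrictAntiOn (klBernoulli a) (Set.Ioc 0 a) := by
  intro x hx y hy hxy
  obtain ⟨hx0, hxa⟩ := hx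
  obtain ⟨hy0, hya⟩ := hy
  rw [klBernoulli_eq ha ha1 hx0 (by linarith), klBernoulli_eq ha ha1 hy0 (by linarith)]
  have h1 : Real.log (x / y) < x / y - 1 :=
    Real.log_lt_sub_one_of_pos (by positivity) (by rw [Ne, div_eq_one_iff_eq hy0.ne']; exact hxy.ne)
  have h2 : Real.log ((1 - x) / (1 - y)) ≤ (1 - x) / (1 - y) - 1 :=
    Real.log_le_sub_one_of_pos (div_pos (by linarith) (by linarith))
  rw [Real.log_div hx0.ne' hy0.ne'] at h1
  rw [Real.log_div (by linarith) (by linarith)] at h2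
  have h3 : x / y - 1 = -((y - x) / y) := by field_simp; ring
  have h4 : (1 - x) / (1 - y) - 1 = (y - x) / (1 - y) := by
    have : (1 - y) ≠ 0 := by linarith
    field_simp; ring
  have h5 : (1 - a) * ((y - x) / (1 - y)) ≤ a * ((y - x) / y) := by
    rw [← mul_div_assoc, ← mul_div_assoc, div_le_div_iff₀ (by linarith) hy0]
    nlinarith [mul_nonneg (sub_nonneg.2 hxy.le) (sub_nonneg.2 hya)]
  rw [h3] at h1
  rw [h4] at h2
  nlinarith [mul_lt_mul_of_pos_left h1 ha, mul_le_mul_of_nonneg_left h2 (by linarith : 0 ≤ 1 - a)]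

theorem exists_klBernoulli_eq {a c : ℝ} (ha : 0 < a) (ha1 : a < 1) (hc : 1 < c) :
    ∃ b ∈ Set.Ioo 0 a, klBernoulli a b = Real.log c * a := by
  have hlc := Real.log_pos hc
  have hl : Real.log (1 - a) < 0 := Real.log_neg (by linarith) (by linarith)
  -- `e` solves `a * (log a - e) + (1 - a) * log (1 - a) = a * log c`. At `exp e` the divergence is
  -- at least this, since the remaining term `-(1 - a) * log (1 - exp e)` is nonnegative.
  set e := Real.log a + (1 - a) / a * Real.log (1 - a) - Real.log c with he
  have hea : Real.exp e < a := by
    rw [← Real.lt_log_iff_exp_lt ha, he]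
    have : (1 - a) / a * Real.log (1 - a) < 0 :=
      mul_neg_of_pos_of_neg (div_pos (by linarith) ha) hl
    linarith
  have hcont : ContinuousOn (klBernoulli a) (Set.Icc (Real.exp e) a) := by
    have : ContinuousOn (fun b => a * (Real.log a - Real.log b) +
        (1 - a) * (Real.log (1 - a) - Real.log (1 - b))) (Set.Icc (Real.exp e) a) := by
      refine ContinuousOn.add (ContinuousOn.mul continuousOn_const (ContinuousOn.sub
        continuousOn_const (ContinuousOn.log continuousOn_id fun x hx => ?_)))
        (ContinuousOn.mul continuousOn_const (ContinuousOn.sub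
        continuousOn_const (ContinuousOn.log (by fun_prop) fun x hx => ?_)))
      · exact ((Real.exp_pos e).trans_le hx.1).ne'
      · have := hx.2
        linarith
    refine this.congr fun x hx => ?_
    exact klBernoulli_eq ha ha1 ((Real.exp_pos e).trans_le hx.1) (hx.2.trans_lt ha1)
  have hlow : Real.log c * a ≤ klBernoulli a (Real.exp e) := by
    rw [klBernoulli_eq ha ha1 (Real.exp_pos e) (by linarith), Real.log_exp]
    have h1 : Real.log (1 - Real.exp e) ≤ 0 :=
      Real.log_nonpos (by linarith) (by linarith [Real.exp_pos e])
    have h2 : a * (Real.log a - e) = Real.log c * a - (1 - a) * Real.log (1 - a) := by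
      rw [he]; field_simp; ring
    rw [h2]
    nlinarith [mul_nonneg (by linarith : 0 ≤ 1 - a) (neg_nonneg.2 h1)]
  obtain ⟨b, hb, hbe⟩ := intermediate_value_Icc' hea.le hcont
    (show Real.log c * a ∈ Set.Icc _ _ from
      ⟨by rw [klBernoulli_self ha ha1]; positivity, hlow⟩)
  refine ⟨b, ⟨(Real.exp_pos e).trans_le hb.1, lt_of_le_of_ne hb.2 ?_⟩, hbe⟩
  rintro rfl
  rw [klBernoulli_self ha ha1] at hbe
  have : 0 < Real.log c * b := by positivity
  linarith

theorem existsUnique_isAmlsESA {β c : ℝ} (hβ : 1 < β) (hc : 1 < c) :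
    ∃! d : ℝ, IsAmlsESA β c d := by
  have hβ0 : 0 < β := by linarith
  have hc0 : 0 < c - 1 := by linarith
  have ha : 0 < 1 / β := by positivity
  have ha1 : 1 / β < 1 := by rw [div_lt_one hβ0]; exact hβ
  obtain ⟨b, ⟨hb0, hba⟩, hb⟩ := exists_klBernoulli_eq ha ha1 hc
  refine ⟨1 + (c - 1) * b, ⟨⟨by nlinarith, ?_⟩, ?_⟩, ?_⟩
  · rw [div_eq_mul_one_div]
    nlinarith
  · rw [add_sub_cancel_left, mul_div_cancel_left₀ _ hc0.ne', hb]
    ring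
  · rintro d ⟨⟨hd1, hd2⟩, hd⟩
    have : (d - 1) / (c - 1) = b := by
      refine (klBernoulli_strictAntiOn ha ha1).injOn ⟨div_pos (by linarith) hc0, ?_⟩
        ⟨hb0, hba.le⟩ ?_
      · rw [div_le_iff₀ hc0]
        have : 1 / β * (c - 1) = (c - 1) / β := by ring
        linarith
      · rw [hd, hb]; ring
    rw [← this, mul_div_cancel₀ _ hc0.ne']
    ring

theorem isAmlsESA_amlsESA {β c : ℝ} (hβ : 1 < β) (hc : 1 < c) : IsAmlsESA β c (amlsESA β c) :=
  Classical.epsilon_spec (existsUnique_isAmlsESA hβ hc).exists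

/-- A parametrization of the pair `(β, c)` and of `d = amlsESA β c` in which the defining equation
takes the form `(1 - b) / (1 - 1 / β) = w` and `c * b * β = w ^ (1 - β)`. -/
structure Parameters (β c d b w : ℝ) : Prop where
  one_lt_β : 1 < β
  one_lt_c : 1 < c
  b_pos : 0 < b
  b_lt : b * β < 1
  d_eq : d = 1 - b + c * b
  one_lt_w : 1 < w
  w_eq : w * (1 - 1 / β) = 1 - b
  log_eq : Real.log (c * b * β) = (1 - β) * Real.log w

/-- In terms of `b` and `w` the divergence is `-(1/β) * log (b β) - (1 - 1/β) * log w`; multiplying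
the equation by `β` gives `log_eq`. -/
theorem IsAmlsESA.parameters {β c d : ℝ} (hβ : 1 < β) (hc : 1 < c) (h : IsAmlsESA β c d) :
    ∃ b w, Parameters β c d b w := by
  obtain ⟨⟨hd1, hd2⟩, hd⟩ := h
  have hβ0 : 0 < β := by linarith
  have hc0 : 0 < c - 1 := by linarith
  have ha : 0 < 1 / β := by positivity
  have ha1 : 1 / β < 1 := by rw [div_lt_one hβ0]; exact hβ
  obtain ⟨b, hb⟩ : ∃ b, b = (d - 1) / (c - 1) := ⟨_, rfl⟩
  rw [← hb] at hd
  have hb0 : 0 < b := hb ▸ div_pos (by linarith) hc0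
  have hba : b < 1 / β := by
    rw [hb, div_lt_iff₀ hc0]
    have : 1 / β * (c - 1) = (c - 1) / β := by ring
    linarith
  have hdb : d = 1 - b + c * b := by
    have : b * (c - 1) = d - 1 := hb ▸ div_mul_cancel₀ _ hc0.ne'
    linarith
  refine ⟨b, (1 - b) / (1 - 1 / β), hβ, hc, hb0, ?_, hdb, ?_, ?_, ?_⟩
  · rwa [lt_div_iff₀ hβ0] at hba
  · rw [one_lt_div (by linarith)]; linarith
  · rw [div_mul_cancel₀ _ (by linarith)]
  · rw [klBernoulli_eq ha ha1 hb0 (by linarith)] at hd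
    rw [Real.log_mul (by positivity) hβ0.ne', Real.log_mul (by linarith) hb0.ne',
      Real.log_div (by linarith) (by linarith)]
    have h1 : Real.log (1 / β) = - Real.log β := by rw [one_div, Real.log_inv]
    rw [h1] at hd
    have h2 := congrArg (β * ·) hd
    field_simp at h2
    have h3 : Real.log (1 - 1 / β) = Real.log ((β - 1) / β) := by
      congr 1; field_simp
    rw [h3]
    linarith

namespace Parameters

variable {β c d b w : ℝ}

theorem b_lt_one (h : Parameters β c d b w) : b < 1 := by
  nlinarith [h.b_lt, h.b_pos, h.one_lt_β]

theorem one_lt_d (h : Parameters β c d b w) : 1 < d := by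
  have := h.d_eq
  nlinarith [h.b_pos, h.one_lt_c]

end Parameters

/-! ### Executions with two oracles that differ on few queries -/

section Coupling

variable {ι : Type} {n : ℕ}

/-- An oracle that uses no random bits. -/
def Oracle.deterministic (f : Finset (Fin n) → ℕ → Finset (Fin n)) : Oracle n where
  bits := 0
  answer := fun X ℓ _ => f X ℓ

theorem Instr.queries_suffix {O : ι → Oracle n} {i : Instr ι} {s t : State ι n}
    (ht : t ∈ (i.step O s).support) : s.queries <:+ t.queries := by
  cases i <;> simp only [Instr.step, PMF.support_pure, Set.mem_singleton_iff,
    PMF.support_map, Set.mem_image] at ht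
  case flip => obtain ⟨_, _, rfl⟩ := ht; exact List.suffix_rfl
  case query => obtain ⟨_, _, rfl⟩ := ht; exact List.suffix_cons _ _
  all_goals subst ht; exact List.suffix_rfl

/-- The record of queries only grows. Hence a final state without bad queries is reached only
through states without bad queries, which is what the coupling below needs. -/
theorem Exec.queries_suffix {O : ι → Oracle n} {p : Prog ι} {s : State ι n}
    {μ : PMF (State ι n)} (h : Exec O p s μ) :
    ∀ t ∈ μ.support, s.queries <:+ t.queries := by
  induction h with
  | instr i s => exact fun t ht => Instr.queries_suffix ht
  | seq p q s μ ν _ _ ih₁ ih₂ =>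
    intro t ht
    obtain ⟨u, hu, hut⟩ := (PMF.mem_support_bind_iff _ _ _).1 ht
    exact (ih₁ u hu).trans (ih₂ u hu t hut)
  | cond_true _ _ _ _ _ _ _ ih => exact ih
  | cond_false _ _ _ _ _ _ _ ih => exact ih
  | loop_true _ _ _ _ _ _ ih => exact ih
  | loop_false _ _ s _ =>
    intro t ht
    rw [PMF.support_pure, Set.mem_singleton_iff] at ht
    subst ht
    exact List.suffix_rfl

/-- A bad query enters the record in the step that asks it, so under either oracle it cannot lead to
the clean state `t`; any other query has the same answer in both. -/
theorem Instr.step_apply_eq {f g : ι → Finset (Fin n) → ℕ → Finset (Fin n)}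
    {bad : ι × Finset (Fin n) × ℕ → Prop}
    (hfg : ∀ j X ℓ, ¬ bad (j, X, ℓ) → f j X ℓ = g j X ℓ) (i : Instr ι) (s t : State ι n)
    (ht : ∀ q ∈ t.queries, ¬ bad q) :
    i.step (fun j => Oracle.deterministic (f j)) s t =
      i.step (fun j => Oracle.deterministic (g j)) s t := by
  cases i
  case query j y x a =>
    by_cases hb : bad (j, s.sets x, s.reg a)
    · have key : ∀ h : ι → Finset (Fin n) → ℕ → Finset (Fin n),
          (Instr.query j y x a).step (fun j => Oracle.deterministic (h j)) s t = 0 := by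
        intro h
        rw [PMF.apply_eq_zero_iff]
        intro hs
        simp only [Instr.step, PMF.support_map, Set.mem_image] at hs
        obtain ⟨_, _, rfl⟩ := hs
        exact ht _ List.mem_cons_self hb
      rw [key, key]
    · simp only [Instr.step, Oracle.deterministic, hfg _ _ _ hb]
      rfl
  all_goals rfl

/-- Two executions give the same probability to every final state whose recorded queries are all
answered in the same way. -/
theorem Exec.apply_eq {f g : ι → Finset (Fin n) → ℕ → Finset (Fin n)}
    {bad : ι × Finset (Fin n) × ℕ → Prop}
    (hfg : ∀ j X ℓ, ¬ bad (j, X, ℓ) → f j X ℓ = g j X ℓ) {p : Prog ι} {s : State ι n}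
    {μ : PMF (State ι n)} (h : Exec (fun j => Oracle.deterministic (f j)) p s μ) :
    ∀ ν, Exec (fun j => Oracle.deterministic (g j)) p s ν →
      ∀ t, (∀ q ∈ t.queries, ¬ bad q) → μ t = ν t := by
  induction h with
  | instr i s =>
    intro ν hν t ht
    cases hν
    exact Instr.step_apply_eq hfg i s t ht
  | seq p q s μ κ h₁ h₂ ih₁ ih₂ =>
    intro ν hν t ht
    cases hν with
    | seq _ _ _ μ' κ' h₁' h₂' =>
      rw [PMF.bind_apply, PMF.bind_apply]
      refine tsum_congr fun u => ?_
      by_cases hu : ∀ q ∈ u.queries, ¬ bad q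
      · have := ih₁ μ' h₁' u hu
        rw [this]
        by_cases hz : μ' u = 0
        · simp [hz]
        · rw [ih₂ u ((PMF.mem_support_iff _ _).2 (this ▸ hz)) (κ' u)
            (h₂' u ((PMF.mem_support_iff _ _).2 hz)) t ht]
      -- An intermediate state with a bad query on record contributes zero to both sums.
      · have key : ∀ (μ : PMF (State ι n)) (κ : State ι n → PMF (State ι n))
            (O : ι → Oracle n), (∀ u ∈ μ.support, Exec O q u (κ u)) → μ u * κ u t = 0 := by
          intro μ κ O hκ
          by_contra hne
          obtain ⟨hμ, hκt⟩ := mul_ne_zero_iff.1 hne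
          have hs := (hκ u ((PMF.mem_support_iff _ _).2 hμ)).queries_suffix t
            ((PMF.mem_support_iff _ _).2 hκt)
          exact hu fun q hq => ht q (hs.subset hq)
        rw [key μ κ _ h₂, key μ' κ' _ h₂']
  | cond_true r p q s μ hr _ ih =>
    intro ν hν
    cases hν with
    | cond_true _ _ _ _ _ _ h' => exact ih ν h'
    | cond_false _ _ _ _ _ hr' _ => exact absurd hr' hr
  | cond_false r p q s μ hr _ ih =>
    intro ν hν
    cases hν with
    | cond_true _ _ _ _ _ hr' _ => exact absurd hr hr'
    | cond_false _ _ _ _ _ _ h' => exact ih ν h'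
  | loop_true r p s μ hr _ ih =>
    intro ν hν
    cases hν with
    | loop_true _ _ _ _ _ h' => exact ih ν h'
    | loop_false _ _ _ hr' => exact absurd hr' hr
  | loop_false r p s hr =>
    intro ν hν
    cases hν with
    | loop_true _ _ _ _ hr' _ => exact absurd hr hr'
    | loop_false _ _ _ _ => exact fun t _ => rfl

end Coupling

/-! ### A family of instances that are hard to tell apart -/

section Hard

variable {n : ℕ}

/-- The sets of more than `ρ` elements. -/
def largeSets (n : ℕ) (ρ : ℝ) : Set (Finset (Fin n)) := {T | ρ < T.card}

/-- The sets of more than `ρ` elements and the supersets of `P`. -/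
def plantedSets (ρ : ℝ) (P : Finset (Fin n)) : Set (Finset (Fin n)) := {T | ρ < T.card ∨ P ⊆ T}

/-- `X` can be completed to a set of more than `ρ` elements by at most `κ` elements. -/
def Completable (ρ κ : ℝ) (X : Finset (Fin n)) : Prop :=
  ∃ S : Finset (Fin n), (S.card : ℝ) ≤ κ ∧ ρ < (X ∪ S).card

open Classical in
/-- The answers of an oracle for `largeSets n ρ`. -/
noncomputable def largeAnswer (ρ β : ℝ) (X : Finset (Fin n)) (ℓ : ℕ) : Finset (Fin n) :=
  if h : Completable ρ (β * ℓ) X then h.choose else Finset.univ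

open Classical in
/-- The answers of an oracle for `plantedSets ρ P`. -/
noncomputable def plantedAnswer (ρ β : ℝ) (P X : Finset (Fin n)) (ℓ : ℕ) : Finset (Fin n) :=
  if h : Completable ρ (β * ℓ) X then h.choose else
    if (P \ X).card ≤ ℓ then P \ X else Finset.univ

theorem isMonotoneSystem_largeSets {ρ : ℝ} (h : ρ < n) : IsMonotoneSystem (largeSets n ρ) :=
  ⟨by simpa [largeSets] using h, fun _ _ hST hS =>
    lt_of_lt_of_le (show ρ < _ from hS) (Nat.cast_le.2 (Finset.card_le_card hST))⟩

theorem isMonotoneSystem_plantedSets {ρ : ℝ} (P : Finset (Fin n)) :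
    IsMonotoneSystem (plantedSets ρ P) :=
  ⟨Or.inr (Finset.subset_univ _), fun _ _ hST hS => hS.imp
    (fun h => lt_of_lt_of_le h (Nat.cast_le.2 (Finset.card_le_card hST))) fun h => h.trans hST⟩

theorem isExtensionOracle_deterministic {α : ℝ} {F : Set (Finset (Fin n))}
    {f : Finset (Fin n) → ℕ → Finset (Fin n)} (h₁ : ∀ X ℓ, f X ℓ ∪ X ∈ F)
    (h₂ : ∀ X (ℓ : ℕ), (∃ S, IsExtension F ℓ X S) → ((f X ℓ).card : ℝ) ≤ α * ℓ) :
    IsExtensionOracle α F (Oracle.deterministic f) := by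
  refine ⟨fun X ℓ _ => h₁ X ℓ, fun X ℓ h => ?_⟩
  have : {r : Fin (Oracle.deterministic f).bits → Bool | IsExtension F (α * ℓ) X
      ((Oracle.deterministic f).answer X ℓ r)} = Set.univ := by
    refine Set.eq_univ_of_forall fun r => ⟨?_, h₂ X ℓ h⟩
    rw [Finset.union_comm]
    exact h₁ X ℓ
  rw [this, Set.ncard_univ]
  simp [Oracle.deterministic]
  norm_num

theorem IsExtension.completable {ρ β : ℝ} (hβ : 1 ≤ β) {X S : Finset (Fin n)} {ℓ : ℕ}
    (hX : ρ < (X ∪ S).card) (hS : (S.card : ℝ) ≤ ℓ) : Completable ρ (β * ℓ) X :=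
  ⟨S, hS.trans (le_mul_of_one_le_left (Nat.cast_nonneg _) hβ), hX⟩

theorem isExtensionOracle_largeAnswer {ρ β : ℝ} (hβ : 1 ≤ β) (h : ρ < n) :
    IsExtensionOracle β (largeSets n ρ) (Oracle.deterministic (largeAnswer ρ β)) := by
  refine isExtensionOracle_deterministic (fun X ℓ => ?_) fun X ℓ ⟨S, hX, hS⟩ => ?_
  · unfold largeAnswer
    split_ifs with hc
    · rw [Finset.union_comm]; exact hc.choose_spec.2
    · rw [Finset.union_eq_left.2 (Finset.subset_univ X)]
      simpa [largeSets] using h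
  · have hc : Completable ρ (β * ℓ) X := IsExtension.completable hβ hX hS
    rw [largeAnswer, dif_pos hc]
    exact hc.choose_spec.1

/-- If `X` has an `ℓ`-extension but cannot be completed to a large set, the extension must cover `P
\ X`, so the short answer `P \ X` is available. -/
theorem isExtensionOracle_plantedAnswer {ρ β : ℝ} (hβ : 1 ≤ β) (P : Finset (Fin n)) :
    IsExtensionOracle β (plantedSets ρ P) (Oracle.deterministic (plantedAnswer ρ β P)) := by
  refine isExtensionOracle_deterministic (fun X ℓ => ?_) fun X ℓ ⟨S, hX, hS⟩ => ?_
  · unfold plantedAnswer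
    split_ifs with hc
    · rw [Finset.union_comm]; exact Or.inl hc.choose_spec.2
    · right
      intro i hi
      by_cases hX : i ∈ X <;> simp [hi, hX]
    · right
      exact (Finset.subset_univ _).trans Finset.subset_union_left
  · by_cases hc : Completable ρ (β * ℓ) X
    · rw [plantedAnswer, dif_pos hc]
      exact hc.choose_spec.1
    · have hP : (P \ X).card ≤ ℓ := by
        rcases hX with hX | hX
        · exact absurd (IsExtension.completable hβ hX hS) hc
        · refine (Finset.card_le_card fun i hi => ?_).trans (Nat.cast_le.1 hS)
          rw [Finset.mem_sdiff] at hi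
          exact (Finset.mem_union.1 (hX hi.1)).resolve_left hi.2
      rw [plantedAnswer, dif_neg hc, if_pos hP]
      exact (Nat.cast_le.2 hP).trans (le_mul_of_one_le_left (Nat.cast_nonneg _) hβ)

/-- The query `(X, ℓ)` distinguishes `plantedSets ρ P` from `largeSets n ρ`. -/
def Reveals (ρ β : ℝ) (P X : Finset (Fin n)) (ℓ : ℕ) : Prop :=
  ¬ Completable ρ (β * ℓ) X ∧ (P \ X).card ≤ ℓ

theorem largeAnswer_eq_plantedAnswer {ρ β : ℝ} {P X : Finset (Fin n)} {ℓ : ℕ}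
    (h : ¬ Reveals ρ β P X ℓ) : largeAnswer ρ β X ℓ = plantedAnswer ρ β P X ℓ := by
  unfold largeAnswer plantedAnswer
  split_ifs with h₁ h₂
  · rfl
  · exact absurd ⟨h₁, h₂⟩ h
  · rfl

/-- One completes with `⌊β * ℓ⌋` new elements, or with all of `Xᶜ` if fewer remain. Rounding down
costs the `+ 1`, which becomes the factor `w` in `pow_card_le`. -/
theorem card_le_of_not_completable {ρ β : ℝ} (hβ : 0 ≤ β) (hρ : ρ < n) {X : Finset (Fin n)}
    {ℓ : ℕ} (h : ¬ Completable ρ (β * ℓ) X) : (X.card : ℝ) ≤ ρ - β * ℓ + 1 := by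
  have hnn : 0 ≤ β * ℓ := by positivity
  by_contra! hX
  have hXc : Xᶜ.card = n - X.card := by rw [Finset.card_compl, Fintype.card_fin]
  have hXn : X.card ≤ n := by simpa using Finset.card_le_univ X
  obtain ⟨S, hS, hSc⟩ := Finset.exists_subset_card_eq
    (show min ⌊β * ℓ⌋₊ (n - X.card) ≤ Xᶜ.card by rw [hXc]; exact min_le_right _ _)
  refine h ⟨S, ?_, ?_⟩
  · rw [hSc]
    exact (Nat.cast_le.2 (min_le_left _ _)).trans (Nat.floor_le hnn)
  · rw [Finset.card_union_of_disjoint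
      (Finset.disjoint_left.2 fun i hi hi' => (Finset.mem_compl.1 (hS hi')) hi), hSc]
    rcases min_cases ⌊β * ℓ⌋₊ (n - X.card) with ⟨he, _⟩ | ⟨he, _⟩
    · rw [he]
      push_cast
      linarith [Nat.lt_floor_add_one (β * ℓ)]
    · rw [he, Nat.add_sub_cancel' hXn]
      exact hρ

end Hard

/-! ### The weight of the instances distinguished by one query -/

section Weight

variable {n : ℕ}

/-- The generating function of `|T ∩ X|` under a product weight: an element contributes `u * y + v`
inside `X` and `u + v` outside. -/
theorem sum_pow_card_inter (X : Finset (Fin n)) (u v y : ℝ) :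
    ∑ T : Finset (Fin n), y ^ (T ∩ X).card * (u ^ T.card * v ^ (n - T.card)) =
      (u * y + v) ^ X.card * (u + v) ^ (n - X.card) := by
  have h := Finset.prod_add (fun i => u * if i ∈ X then y else 1) (fun _ => v)
    (Finset.univ : Finset (Fin n))
  rw [Finset.powerset_univ] at h
  have hl : ∏ i : Fin n, ((u * if i ∈ X then y else 1) + v) =
      (u * y + v) ^ X.card * (u + v) ^ (n - X.card) := by
    rw [← Finset.prod_mul_prod_compl X]
    congr 1
    · rw [Finset.prod_congr rfl (g := fun _ => u * y + v) fun i hi => by rw [if_pos hi],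
        Finset.prod_const]
    · rw [Finset.prod_congr rfl (g := fun _ => u + v) fun i hi => by
        rw [if_neg (Finset.mem_compl.1 hi), mul_one], Finset.prod_const, Finset.card_compl,
        Fintype.card_fin]
  rw [← hl, h]
  refine Finset.sum_congr rfl fun T _ => ?_
  rw [Finset.prod_mul_distrib, Finset.prod_const, Finset.prod_const,
    ← Finset.compl_eq_univ_sdiff, Finset.card_compl, Fintype.card_fin, Finset.prod_ite,
    Finset.prod_const, Finset.prod_const_one, mul_one, Finset.filter_mem_eq_inter]
  ring

/-- The weight of `P` as a planted set, normalized to total weight `d ^ n`. -/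
noncomputable def weight (b c : ℝ) (P : Finset (Fin n)) : ℝ :=
  (c * b) ^ P.card * (1 - b) ^ (n - P.card)

namespace Parameters

variable {β c d b w : ℝ}

theorem weight_nonneg (h : Parameters β c d b w) (P : Finset (Fin n)) : 0 ≤ weight b c P := by
  have := h.b_pos
  have := h.b_lt_one
  have := h.one_lt_c
  exact mul_nonneg (pow_nonneg (by positivity) _) (pow_nonneg (by linarith) _)

theorem sum_weight (h : Parameters β c d b w) :
    ∑ P : Finset (Fin n), weight b c P = d ^ n := by
  have := sum_pow_card_inter (∅ : Finset (Fin n)) (c * b) (1 - b) 1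
  simp only [one_pow, one_mul, Finset.card_empty, pow_zero, Nat.sub_zero] at this
  rw [h.d_eq, add_comm (1 - b), ← this]
  rfl

theorem log_tilt (h : Parameters β c d b w) :
    Real.log (w / (b * β)) = Real.log c + β * Real.log w := by
  have h1 := h.log_eq
  have hb := h.b_pos
  have hβ : 0 < β := by linarith [h.one_lt_β]
  have hw : 0 < w := by linarith [h.one_lt_w]
  have hc : 0 < c := by linarith [h.one_lt_c]
  rw [mul_assoc, Real.log_mul hc.ne' (by positivity)] at h1
  rw [Real.log_div hw.ne' (by positivity)]
  linarith

/-- In logarithms: `|X|` is at most `β (|P| - ℓ) + 1`, and `|P| - ℓ ≤ |P ∩ X|`. Each element of `P ∩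
X` thus pays for `log c + β * log w`, which by `log_tilt` is the logarithm of `w / (b β)`. -/
theorem pow_card_le (h : Parameters β c d b w) {P X : Finset (Fin n)} {ℓ : ℕ}
    (hX : (X.card : ℝ) ≤ β * P.card - β * ℓ + 1) (hP : (P \ X).card ≤ ℓ) :
    c ^ P.card * w ^ X.card ≤ c ^ ℓ * w * (w / (b * β)) ^ (P ∩ X).card := by
  have hb := h.b_pos
  have hβ : 0 < β := by linarith [h.one_lt_β]
  have hw : 0 < w := by linarith [h.one_lt_w]
  have hc : 0 < c := by linarith [h.one_lt_c]
  have hlw := Real.log_pos h.one_lt_w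
  have hlc := Real.log_pos h.one_lt_c
  have hcard : (P.card : ℝ) - ℓ ≤ (P ∩ X).card := by
    have h1 := Finset.card_sdiff_add_card_inter P X
    have : P.card ≤ ℓ + (P ∩ X).card := by omega
    have : (P.card : ℝ) ≤ ℓ + (P ∩ X).card := by exact_mod_cast this
    linarith
  rw [← Real.log_le_log_iff (by positivity) (by positivity),
    Real.log_mul (by positivity) (by positivity), Real.log_mul (by positivity) (by positivity),
    Real.log_mul (by positivity) (by positivity), Real.log_pow, Real.log_pow, Real.log_pow,
    Real.log_pow, h.log_tilt]
  have h1 := mul_le_mul_of_nonneg_right hcard (by positivity : 0 ≤ Real.log c + β * Real.log w)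
  have h2 := mul_le_mul_of_nonneg_right hX hlw.le
  nlinarith

/-- A single query distinguishes only planted sets of small total weight. -/
theorem sum_weight_le (h : Parameters β c d b w) (X : Finset (Fin n)) (ℓ : ℕ)
    (A : Finset (Finset (Fin n)))
    (hA : ∀ P ∈ A, (X.card : ℝ) ≤ β * P.card - β * ℓ + 1 ∧ (P \ X).card ≤ ℓ) :
    ∑ P ∈ A, weight b c P ≤ w * c ^ ℓ := by
  have hb := h.b_pos
  have hb1 := h.b_lt_one
  have hβ : 0 < β := by linarith [h.one_lt_β]
  have hw : 0 < w := by linarith [h.one_lt_w]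
  have hc : 0 < c := by linarith [h.one_lt_c]
  -- For this tilt `b * y + (1 - b) = w`, so the moment of `y ^ |P ∩ X|` under inclusion probability
  -- `b` is exactly `w ^ |X|`.
  set y := w / (b * β) with hy
  have hy0 : 0 < y := by positivity
  have hb2 : 0 < 1 - b := by linarith
  have hsum := sum_pow_card_inter X b (1 - b) y
  have hby : b * y + (1 - b) = w := by
    rw [← h.w_eq, hy]
    field_simp
    ring
  rw [hby, add_sub_cancel, one_pow, mul_one] at hsum
  -- A Chernoff bound, scaled by `w ^ |X|`: each term over `A` is dominated by a tilted one, and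
  -- then the sum is extended to all sets.
  have hle : (∑ P ∈ A, weight b c P) * w ^ X.card ≤ (w * c ^ ℓ) * w ^ X.card := by
    rw [← hsum, Finset.sum_mul, Finset.mul_sum]
    refine (Finset.sum_le_sum fun P hP => ?_).trans
      (Finset.sum_le_sum_of_subset_of_nonneg (Finset.subset_univ A) fun P _ _ => by positivity)
    have h1 := h.pow_card_le (hA P hP).1 (hA P hP).2
    have h2 : 0 ≤ b ^ P.card * (1 - b) ^ (n - P.card) := by positivity
    rw [← hy] at h1
    rw [hsum]
    have h3 := mul_le_mul_of_nonneg_right h1 h2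
    calc weight b c P * w ^ X.card
        = c ^ P.card * w ^ X.card * (b ^ P.card * (1 - b) ^ (n - P.card)) := by
          rw [weight, mul_pow]; ring
      _ ≤ _ := h3
      _ = _ := by ring
  exact le_of_mul_le_mul_right hle (by positivity)

end Parameters

end Weight

open scoped ENNReal

/-! ### The lower bound -/

/-- The coupling with no bad queries at all. It identifies the distributions that `IsApproximation`
and `HasCost` supply separately. -/
theorem Exec.unique {ι : Type} {n : ℕ} {f : ι → Finset (Fin n) → ℕ → Finset (Fin n)} {p : Prog ι}
    {s : State ι n} {μ ν : PMF (State ι n)}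
    (hμ : Exec (fun j => Oracle.deterministic (f j)) p s μ)
    (hν : Exec (fun j => Oracle.deterministic (f j)) p s ν) : μ = ν :=
  PMF.ext fun t => hμ.apply_eq (bad := fun _ => False) (fun _ _ _ _ => rfl) ν hν t
    fun _ _ => not_false

/-- If two distributions agree outside of `B`, then they give the same probability to `B`. -/
theorem toOuterMeasure_eq_of_eq_compl {α : Type*} {μ ν : PMF α} {B : Set α}
    (h : ∀ x ∉ B, μ x = ν x) : μ.toOuterMeasure B = ν.toOuterMeasure B := by
  have key : ∀ ξ : PMF α, ξ.toOuterMeasure B + ξ.toOuterMeasure Bᶜ = 1 := by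
    intro ξ
    rw [PMF.toOuterMeasure_apply, PMF.toOuterMeasure_apply, ← ENNReal.tsum_add, ← ξ.tsum_coe]
    exact tsum_congr fun x => Set.indicator_self_add_compl_apply B (⇑ξ) x
  have hc : μ.toOuterMeasure Bᶜ = ν.toOuterMeasure Bᶜ := by
    rw [PMF.toOuterMeasure_apply, PMF.toOuterMeasure_apply]
    refine tsum_congr fun x => ?_
    by_cases hx : x ∈ B
    · simp [hx]
    · simp [hx, h x hx]
  have h1 := key μ
  rw [← key ν, ← hc] at h1
  refine (ENNReal.add_left_inj ?_).1 h1
  intro ht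
  have := key μ
  rw [ht] at this
  simp at this

section

variable {β c d b w : ℝ} {n : ℕ}

/-- Whether some recorded query distinguishes the planted set `P`. -/
def revealed (ι : Type) (β : ℝ) (P : Finset (Fin n)) : Set (State ι n) :=
  {s | ∃ q ∈ s.queries, Reveals (β * P.card) β P q.2.1 q.2.2}

theorem isInstance_singleton {α c : ℝ} {F : Set (Finset (Fin n))} {O : Oracle n}
    (hF : IsMonotoneSystem F) (hO : IsExtensionOracle α F O) :
    IsInstance {(α, c)} F (fun _ => O) := by
  refine ⟨hF, fun ⟨j, hj⟩ => ?_⟩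
  rw [Finset.mem_singleton] at hj
  subst hj
  exact hO

/-- Without a revealing query the run has the same probability on the planted system, where its
output then has more than `β |P|` elements although `P` is feasible. So success there forces a
revealing query. -/
theorem half_le_revealed {A : Prog ({(β, c)} : Finset (ℝ × ℝ))} (hβ : 1 ≤ β)
    (hA : IsApproximation {(β, c)} β A) {P : Finset (Fin n)}
    {μ : PMF (State ({(β, c)} : Finset (ℝ × ℝ)) n)}
    (hμ : Exec (fun _ => Oracle.deterministic (largeAnswer (β * P.card) β)) A (State.start _ n) μ)
    (hout : ∀ s ∈ μ.support, s.output ∈ largeSets n (β * P.card)) :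
    1 / 2 ≤ μ.toOuterMeasure (revealed _ β P) := by
  obtain ⟨ν, hν, -, hν2⟩ := hA n _ _ (isInstance_singleton
    (isMonotoneSystem_plantedSets (ρ := β * P.card) P) (isExtensionOracle_plantedAnswer hβ P))
  have hagree : ∀ t ∉ revealed _ β P, μ t = ν t := by
    intro t ht
    refine hμ.apply_eq (bad := fun q => Reveals (β * P.card) β P q.2.1 q.2.2)
      (fun j X ℓ h => largeAnswer_eq_plantedAnswer h) ν hν t fun q hq hb => ht ⟨q, hq, hb⟩
  rw [toOuterMeasure_eq_of_eq_compl hagree]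
  refine hν2.trans (PMF.toOuterMeasure_mono ν ?_)
  rintro s ⟨hs, hsν⟩
  by_contra hr
  have h1 := hs P (Or.inr subset_rfl)
  have h2 : s ∈ μ.support := by
    rw [PMF.mem_support_iff, hagree s hr]
    exact (PMF.mem_support_iff _ _).1 hsν
  exact absurd (hout s h2) (not_lt.2 h1)

namespace Parameters

-- A union bound over the recorded queries, each handled by `sum_weight_le`.
open Classical in
theorem sum_weight_revealed_le {ι : Type} (h : Parameters β c d b w) {k : ℕ} (hk : β * k < n)
    (qs : List (ι × Finset (Fin n) × ℕ)) :
    ∑ P ∈ Finset.univ.filter (fun P : Finset (Fin n) => P.card = k),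
      (if ∃ q ∈ qs, Reveals (β * P.card) β P q.2.1 q.2.2 then weight b c P else 0) ≤
      w * (qs.map fun q => c ^ q.2.2).sum := by
  induction qs with
  | nil => simp
  | cons q qs ih =>
    rw [List.map_cons, List.sum_cons, mul_add]
    have hq := h.sum_weight_le q.2.1 q.2.2
      (Finset.univ.filter fun P => P.card = k ∧ Reveals (β * P.card) β P q.2.1 q.2.2) (by
        intro P hP
        obtain ⟨hPk, hc, hl⟩ := (Finset.mem_filter.1 hP).2
        rw [hPk] at hc
        rw [hPk]
        exact ⟨card_le_of_not_completable (by linarith [h.one_lt_β]) hk hc, hl⟩)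
    rw [← Finset.filter_filter, Finset.sum_filter] at hq
    refine le_trans ?_ (add_le_add hq ih)
    rw [← Finset.sum_add_distrib]
    refine Finset.sum_le_sum fun P _ => ?_
    have := h.weight_nonneg P
    simp only [List.mem_cons, exists_eq_or_imp]
    split_ifs <;> first | linarith | (rcases ‹_ ∨ _› with h' | h' <;> contradiction)

-- Double counting of the expected revealed weight: at least half the weight of all `k`-sets, and at
-- most `w` times the cost bound. This needs one distribution `μ` for all `P`, which is available
-- because the unplanted system depends only on `k`.
open Classical in
theorem sum_weight_card_le {ι : Type} (h : Parameters β c d b w) {k : ℕ} (hk : β * k < n) {f : ℝ}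
    (μ : PMF (State ι n)) (hcost : ∀ s ∈ μ.support, s.cost (fun _ => c) ≤ f)
    (hμ : ∀ P : Finset (Fin n), P.card = k → 1 / 2 ≤ μ.toOuterMeasure (revealed ι β P)) :
    ∑ P ∈ Finset.univ.filter (fun P : Finset (Fin n) => P.card = k), weight b c P ≤
      2 * (w * f) := by
  have hw : 0 < w := by linarith [h.one_lt_w]
  set A := Finset.univ.filter (fun P : Finset (Fin n) => P.card = k) with hAdef
  have hstate : ∀ s : State ι n, μ s * ∑ P ∈ A, (if s ∈ revealed ι β P then
      ENNReal.ofReal (weight b c P) else 0) ≤ μ s * ENNReal.ofReal (w * f) := by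
    intro s
    by_cases hs : μ s = 0
    · simp [hs]
    gcongr
    have h1 := h.sum_weight_revealed_le hk s.queries
    have h2 := hcost s ((PMF.mem_support_iff _ _).2 hs)
    have h3 : (s.queries.map fun q => c ^ q.2.2).sum ≤ f :=
      le_trans (le_add_of_nonneg_left (Nat.cast_nonneg _)) h2
    have h4 := h1.trans (mul_le_mul_of_nonneg_left h3 hw.le)
    refine le_trans (le_of_eq ?_) (ENNReal.ofReal_le_ofReal h4)
    rw [ENNReal.ofReal_sum_of_nonneg fun P _ => by
      split_ifs
      · exact h.weight_nonneg P
      · exact le_rfl]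
    refine Finset.sum_congr rfl fun P _ => ?_
    simp only [revealed, Set.mem_ofPred_eq]
    rw [apply_ite ENNReal.ofReal, ENNReal.ofReal_zero]
    congr
  have htotal : ∑ P ∈ A, ENNReal.ofReal (weight b c P) * μ.toOuterMeasure (revealed ι β P) ≤
      ENNReal.ofReal (w * f) := by
    calc ∑ P ∈ A, ENNReal.ofReal (weight b c P) * μ.toOuterMeasure (revealed ι β P)
        = ∑' s, μ s * ∑ P ∈ A, (if s ∈ revealed ι β P then
            ENNReal.ofReal (weight b c P) else 0) := by
          simp_rw [Finset.mul_sum]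
          rw [Summable.tsum_finsetSum fun _ _ => ENNReal.summable]
          refine Finset.sum_congr rfl fun P _ => ?_
          rw [PMF.toOuterMeasure_apply, ← ENNReal.tsum_mul_left]
          refine tsum_congr fun s => ?_
          by_cases hs : s ∈ revealed ι β P <;> simp [hs, mul_comm]
      _ ≤ ∑' s, μ s * ENNReal.ofReal (w * f) := ENNReal.tsum_le_tsum hstate
      _ = ENNReal.ofReal (w * f) := by rw [ENNReal.tsum_mul_right, μ.tsum_coe, one_mul]
  have hhalf : ENNReal.ofReal (∑ P ∈ A, weight b c P) * (1 / 2) ≤ ENNReal.ofReal (w * f) := by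
    refine le_trans ?_ htotal
    rw [ENNReal.ofReal_sum_of_nonneg fun P _ => h.weight_nonneg P, Finset.sum_mul]
    refine Finset.sum_le_sum fun P hP => ?_
    gcongr
    exact hμ P (Finset.mem_filter.1 hP).2
  have hnn : 0 ≤ w * f := by
    obtain ⟨s, hs⟩ := μ.support_nonempty
    have h1 := hcost s hs
    have h2 : 0 ≤ s.cost (fun _ => c) := by
      refine add_nonneg (Nat.cast_nonneg _) (List.sum_nonneg ?_)
      intro x hx
      obtain ⟨q, -, rfl⟩ := List.mem_map.1 hx
      have := h.one_lt_c
      positivity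
    have := h2.trans h1
    positivity
  have h12 : (1 / 2 : ℝ≥0∞) = ENNReal.ofReal (1 / 2) := by
    rw [ENNReal.ofReal_div_of_pos (by norm_num)]; simp
  rw [h12, ← ENNReal.ofReal_mul (Finset.sum_nonneg fun P _ => h.weight_nonneg P),
    ENNReal.ofReal_le_ofReal_iff hnn] at hhalf
  linarith

theorem pow_le_of_approximation (h : Parameters β c d b w)
    {A : Prog ({(β, c)} : Finset (ℝ × ℝ))} (hA : IsApproximation {(β, c)} β A) {f : ℕ → ℝ}
    (hf : HasCost {(β, c)} A f) (hfn : 0 ≤ f n) :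
    d ^ n ≤ w + (n + 1) * (2 * (w * f n)) := by
  classical
  have hβ := h.one_lt_β
  have hw : 0 < w := by linarith [h.one_lt_w]
  rw [← h.sum_weight, ← Finset.sum_filter_add_sum_filter_not Finset.univ
    (fun P : Finset (Fin n) => (n : ℝ) ≤ β * P.card)]
  refine add_le_add ?_ ?_
  -- Sets with `n ≤ β |P|` meet the conditions of the single-query bound for the query `(univ, 0)`,
  -- so together they weigh at most `w`.
  · refine (h.sum_weight_le Finset.univ 0 _ fun P hP => ?_).trans (by simp)
    have := (Finset.mem_filter.1 hP).2
    simp only [Finset.card_univ, Fintype.card_fin, Nat.cast_zero, mul_zero, sub_zero]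
    exact ⟨by linarith, by simp⟩
  · rw [← Finset.sum_fiberwise_of_maps_to (g := Finset.card) (t := Finset.range (n + 1))
      fun P _ => Finset.mem_range.2 (Nat.lt_succ_of_le (by simpa using Finset.card_le_univ P))]
    refine (Finset.sum_le_card_nsmul _ _ (2 * (w * f n)) fun k _ => ?_).trans (by simp)
    by_cases hk : β * k < n
    · obtain ⟨μ, hμ, hout, -⟩ := hA n _ _ (isInstance_singleton
        (isMonotoneSystem_largeSets hk) (isExtensionOracle_largeAnswer hβ.le hk))
      obtain ⟨ν, hν, hcost⟩ := hf n n le_rfl _ _ (isInstance_singleton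
        (isMonotoneSystem_largeSets hk) (isExtensionOracle_largeAnswer hβ.le hk))
      obtain rfl := hμ.unique hν
      refine le_trans (Finset.sum_le_sum_of_subset_of_nonneg ?_ fun P _ _ => h.weight_nonneg P)
        (h.sum_weight_card_le hk μ (fun s hs => ?_) fun P hP => ?_)
      · exact Finset.filter_subset_filter _ (Finset.subset_univ _)
      · refine le_trans (le_of_eq ?_) (hcost s hs)
        have hj : ∀ j : ({(β, c)} : Finset (ℝ × ℝ)), j.1.2 = c := fun ⟨j, hj⟩ => by
          exact congrArg Prod.snd (Finset.mem_singleton.1 hj)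
        simp only [State.cost, hj]
      · subst hP
        exact half_le_revealed hβ.le hA hμ hout
    · rw [Finset.sum_eq_zero]
      · positivity
      · intro P hP
        rw [Finset.filter_filter, Finset.mem_filter] at hP
        obtain ⟨-, h1, h2⟩ := hP
        rw [h2] at h1
        exact absurd (not_le.1 h1) hk

end Parameters

/-- No exponential with the larger base is dominated by a polynomial times one with the smaller
base. -/
theorem exists_pow_gt {x y : ℝ} (hx : 0 < x) (hxy : x < y) (K : ℝ) (a : ℕ) :
    ∃ n : ℕ, K * (n + 1) ^ a * x ^ n < y ^ n := by
  have hr : 1 < y / x := by rwa [one_lt_div hx]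
  -- Evaluating the limit at `n + 1` produces `(n + 1) ^ a`; the factor `y / x` compensates for the
  -- extra power of the base.
  have ht := ((tendsto_pow_const_div_const_pow_of_one_lt a hr).const_mul (K * (y / x))).comp
    (Filter.tendsto_add_atTop_nat 1)
  rw [mul_zero] at ht
  obtain ⟨n, hn⟩ := (ht.eventually (gt_mem_nhds one_pos)).exists
  refine ⟨n, ?_⟩
  simp only [Function.comp_apply] at hn
  have hy : 0 < y := hx.trans hxy
  have hpos : 0 < (y / x) ^ n := by positivity
  rw [pow_succ, ← mul_div_assoc, div_lt_one (by positivity), Nat.cast_add, Nat.cast_one] at hn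
  have h2 : K * (n + 1) ^ a < (y / x) ^ n := by
    have : K * (n + 1) ^ a * (y / x) < (y / x) ^ n * (y / x) := by linarith
    exact lt_of_mul_lt_mul_right this (by positivity)
  rw [div_pow, lt_div_iff₀ (by positivity)] at h2
  exact h2

theorem Parameters.le_of_approximation (h : Parameters β c d b w)
    {A : Prog ({(β, c)} : Finset (ℝ × ℝ))} (hA : IsApproximation {(β, c)} β A) {x : ℝ} (hx : 1 ≤ x)
    {C : ℝ} {a : ℕ} (hf : HasCost {(β, c)} A fun n => C * ((n : ℝ) + 1) ^ a * x ^ n) : d ≤ x := by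
  by_contra! hxd
  have hw : 0 < w := by linarith [h.one_lt_w]
  -- The constant and the exponent absorb `w + (n + 1) * (2 * w * f n)`. The absolute value is there
  -- because `C` may be negative.
  obtain ⟨n, hn⟩ := exists_pow_gt (by linarith) hxd (w + 2 * w * |C|) (a + 1)
  have hf' : HasCost {(β, c)} A fun n => |C| * ((n : ℝ) + 1) ^ a * x ^ n := by
    intro n m hmn F O hI
    obtain ⟨μ, hμ, hc⟩ := hf n m hmn F O hI
    refine ⟨μ, hμ, fun s hs => (hc s hs).trans ?_⟩
    exact mul_le_mul_of_nonneg_right (mul_le_mul_of_nonneg_right (le_abs_self C) (by positivity))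
      (by positivity)
  have h1 := h.pow_le_of_approximation (n := n) hA hf' (by positivity)
  have h2 : (1 : ℝ) ≤ (n + 1) ^ (a + 1) * x ^ n :=
    one_le_mul_of_one_le_of_one_le (one_le_pow₀ (by simp)) (one_le_pow₀ hx)
  have h3 : w * 1 ≤ w * ((n + 1) ^ (a + 1) * x ^ n) := mul_le_mul_of_nonneg_left h2 hw.le
  have h4 : (n + 1) * (2 * (w * (|C| * ((n : ℝ) + 1) ^ a * x ^ n))) =
      2 * w * |C| * ((n + 1) ^ (a + 1) * x ^ n) := by ring
  rw [h4] at h1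
  nlinarith

end

/-! ### Estimates for binomial coefficients -/

/-- The ratio of consecutive binomial terms is at least one up to `j`, because `(m - j) * (i + 1) ≤
(m - i) * j` when `i + 1 ≤ j`. -/
theorem choose_mul_pow_le_succ {m i j : ℕ} (hij : i + 1 ≤ j) (hj : j ≤ m) :
    m.choose i * j ^ i * (m - j) ^ (m - i) ≤
      m.choose (i + 1) * j ^ (i + 1) * (m - j) ^ (m - (i + 1)) := by
  obtain ⟨r, hr⟩ : ∃ r, m = i + 1 + r := ⟨m - (i + 1), by omega⟩
  have h1 : m - i = r + 1 := by omega
  have h2 : m - (i + 1) = r := by omega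
  have h3 := Nat.choose_succ_right_eq m i
  have h4 : m.choose i * (m - j) ≤ m.choose (i + 1) * j := by
    refine Nat.le_of_mul_le_mul_right (c := i + 1) ?_ (by omega)
    have h5 : (m - j) * (i + 1) ≤ (m - i) * j := by
      obtain ⟨e, rfl⟩ := Nat.exists_eq_add_of_le hij
      obtain ⟨g, hg⟩ := Nat.exists_eq_add_of_le hj
      have h6 : m - (i + 1 + e) = g := by omega
      have h7 : m - i = e + 1 + g := by omega
      rw [h6, h7]
      nlinarith [Nat.zero_le (e * (i + 1 + e)), Nat.zero_le (g * e), Nat.zero_le e]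
    calc m.choose i * (m - j) * (i + 1) = m.choose i * ((m - j) * (i + 1)) := by ring
      _ ≤ m.choose i * ((m - i) * j) := by gcongr
      _ = m.choose (i + 1) * (i + 1) * j := by rw [h3]; ring
      _ = _ := by ring
  rw [h1, h2, pow_succ, pow_succ]
  calc m.choose i * j ^ i * ((m - j) ^ r * (m - j))
      = (m.choose i * (m - j)) * (j ^ i * (m - j) ^ r) := by ring
    _ ≤ (m.choose (i + 1) * j) * (j ^ i * (m - j) ^ r) := by gcongr
    _ = _ := by ring

theorem choose_mul_pow_le_of_le {m i j : ℕ} (hij : i ≤ j) (hj : j ≤ m) :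
    m.choose i * j ^ i * (m - j) ^ (m - i) ≤ m.choose j * j ^ j * (m - j) ^ (m - j) := by
  induction hij using Nat.decreasingInduction with
  | self => exact le_rfl
  | of_succ i hi ih => exact (choose_mul_pow_le_succ hi hj).trans ih

/-- The number `j` is a mode of the binomial distribution with parameters `m` and `j / m`. -/
theorem choose_mul_pow_le {m i j : ℕ} (hi : i ≤ m) (hj : j ≤ m) :
    m.choose i * j ^ i * (m - j) ^ (m - i) ≤ m.choose j * j ^ j * (m - j) ^ (m - j) := by
  rcases le_total i j with h | h
  · exact choose_mul_pow_le_of_le h hj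
  · have := choose_mul_pow_le_of_le (m := m) (i := m - i) (j := m - j) (by omega) (by omega)
    rw [Nat.choose_symm hi, Nat.choose_symm hj, Nat.sub_sub_self hi, Nat.sub_sub_self hj] at this
    linarith

/-- Expand `(j + (m - j)) ^ m`: there are `m + 1` terms and the mode is the largest. -/
theorem pow_self_le_choose {m j : ℕ} (hj : j ≤ m) :
    m ^ m ≤ (m + 1) * (m.choose j * j ^ j * (m - j) ^ (m - j)) := by
  calc m ^ m = (j + (m - j)) ^ m := by rw [Nat.add_sub_cancel' hj]
    _ = ∑ i ∈ Finset.range (m + 1), m.choose i * j ^ i * (m - j) ^ (m - i) := by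
      rw [add_pow]
      exact Finset.sum_congr rfl fun i _ => by rw [Nat.cast_id]; ring
    _ ≤ (Finset.range (m + 1)).card • (m.choose j * j ^ j * (m - j) ^ (m - j)) :=
      Finset.sum_le_card_nsmul _ _ _ fun i hi =>
        choose_mul_pow_le (Nat.lt_succ_iff.1 (Finset.mem_range.1 hi)) hj
    _ = _ := by rw [Finset.card_range, smul_eq_mul]

theorem cast_pow_self_le_choose {m j : ℕ} (hj : j ≤ m) :
    (m : ℝ) ^ m ≤ (m + 1) * (m.choose j * (j : ℝ) ^ j * ((m : ℝ) - j) ^ (m - j)) := by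
  rw [← Nat.cast_sub hj]
  exact_mod_cast pow_self_le_choose hj

theorem pow_le_exp_mul_pow {x y : ℝ} (hx : 0 ≤ x) (hy : 0 < y) (j : ℕ) :
    x ^ j ≤ Real.exp (j * (x / y - 1)) * y ^ j := by
  rw [Real.exp_nat_mul, ← mul_pow]
  refine pow_le_pow_left₀ hx ?_ j
  have := Real.add_one_le_exp (x / y - 1)
  rw [sub_add_cancel, div_le_iff₀ hy] at this
  exact this

/-- Close to its mean, a binomial distribution has no small probabilities. -/
theorem one_le_choose_mul_pow {a : ℝ} (ha : 0 < a) (ha1 : a < 1) {m j : ℕ} (hj : j ≤ m)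
    (h : |(j : ℝ) - a * m| ≤ 1) :
    1 ≤ Real.exp (1 / (a * (1 - a))) * (m + 1) *
      (m.choose j * (a ^ j * (1 - a) ^ (m - j))) := by
  have ha2 : 0 < 1 - a := by linarith
  have hE : 1 ≤ Real.exp (1 / (a * (1 - a))) := Real.one_le_exp (by positivity)
  rcases Nat.eq_zero_or_pos m with rfl | hm
  · obtain rfl : j = 0 := by omega
    simpa using hE
  have hm' : (0 : ℝ) < m := by exact_mod_cast hm
  have hm1 : (1 : ℝ) ≤ m := by exact_mod_cast hm
  have hjm : (j : ℝ) ≤ m := by exact_mod_cast hj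
  have h1 := pow_le_exp_mul_pow (Nat.cast_nonneg j) (show 0 < m * a by positivity) j
  have h2 := pow_le_exp_mul_pow (sub_nonneg.2 hjm) (show 0 < m * (1 - a) by positivity) (m - j)
  have h3 := cast_pow_self_le_choose hj
  -- Passing from density `j / m` to density `a` costs the exponential of the chi-square quantity
  -- `(j - a m) ^ 2 / (m a (1 - a))`, which is bounded because `j` is within `1` of the mean.
  have hexp : (j : ℝ) * (j / (m * a) - 1) +
      ((m - j : ℕ) : ℝ) * ((m - j) / (m * (1 - a)) - 1) ≤ 1 / (a * (1 - a)) := by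
    rw [Nat.cast_sub hj]
    have : (j : ℝ) * (j / (m * a) - 1) + (m - j) * ((m - j) / (m * (1 - a)) - 1) =
        (j - a * m) ^ 2 / m * (1 / (a * (1 - a))) := by
      field_simp
      ring
    rw [this]
    refine mul_le_of_le_one_left (by positivity) ?_
    rw [div_le_one hm']
    exact (sq_le_one_iff_abs_le_one _ |>.2 h).trans hm1
  have h4 : (j : ℝ) ^ j * ((m : ℝ) - j) ^ (m - j) ≤
      Real.exp (1 / (a * (1 - a))) * (m ^ m * (a ^ j * (1 - a) ^ (m - j))) := by
    calc (j : ℝ) ^ j * ((m : ℝ) - j) ^ (m - j)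
        ≤ (Real.exp (j * (j / (m * a) - 1)) * (m * a) ^ j) *
          (Real.exp ((m - j : ℕ) * ((m - j) / (m * (1 - a)) - 1)) * (m * (1 - a)) ^ (m - j)) :=
          mul_le_mul h1 h2 (pow_nonneg (sub_nonneg.2 hjm) _) (by positivity)
      _ = Real.exp (j * (j / (m * a) - 1) + (m - j : ℕ) * ((m - j) / (m * (1 - a)) - 1)) *
          (m ^ j * m ^ (m - j) * (a ^ j * (1 - a) ^ (m - j))) := by
          rw [Real.exp_add, mul_pow, mul_pow]; ring
      _ = Real.exp (j * (j / (m * a) - 1) + (m - j : ℕ) * ((m - j) / (m * (1 - a)) - 1)) *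
          (m ^ m * (a ^ j * (1 - a) ^ (m - j))) := by rw [← pow_add, Nat.add_sub_cancel' hj]
      _ ≤ _ := by gcongr
  have h5 : (m : ℝ) ^ m * 1 ≤ m ^ m * (Real.exp (1 / (a * (1 - a))) * (m + 1) *
      (m.choose j * (a ^ j * (1 - a) ^ (m - j)))) := by
    calc (m : ℝ) ^ m * 1 ≤ (m + 1) * (m.choose j * (j : ℝ) ^ j * ((m : ℝ) - j) ^ (m - j)) := by
          rwa [mul_one]
      _ = (m + 1) * m.choose j * ((j : ℝ) ^ j * ((m : ℝ) - j) ^ (m - j)) := by ring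
      _ ≤ (m + 1) * m.choose j *
          (Real.exp (1 / (a * (1 - a))) * (m ^ m * (a ^ j * (1 - a) ^ (m - j)))) := by gcongr
      _ = _ := by ring
  exact le_of_mul_le_mul_left h5 (by positivity)

/-- Both sides count the pairs of a `t`-set and a `k`-set that meet in `x` elements. -/
theorem choose_mul_choose_mul_choose {n k t x : ℕ} (hxk : x ≤ k) (hxt : x ≤ t) (hkn : k ≤ n)
    (htn : t ≤ n) (h : t + k ≤ n + x) :
    n.choose t * t.choose x * (n - t).choose (k - x) =
      n.choose k * k.choose x * (n - k).choose (t - x) := by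
  rw [Nat.choose_mul hxt, Nat.choose_mul hxk]
  have h1 := Nat.choose_mul (n := n - x) (k := n - x - (t - x)) (s := k - x)
    (by omega)
  have h2 : n - x - (t - x) = n - t := by omega
  have h3 : n - x - (k - x) = n - k := by omega
  have h4 : n - t - (k - x) = n - k - (t - x) := by omega
  have h5 : (n - x).choose (n - t) = (n - x).choose (t - x) := by
    rw [← h2]; exact Nat.choose_symm (by omega)
  rw [h2, h3, h4, h5, Nat.choose_symm (by omega)] at h1
  rw [mul_assoc, mul_assoc, h1]

/-! ### Choice of the sample size and of its overlap with the optimum -/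

namespace Parameters

variable {β c d b w : ℝ}

/-- Bernoulli's inequality gives `c ^ b ≤ 1 + b (c - 1) = d`. -/
theorem pow_le_pow_of_le (h : Parameters β c d b w) {n k : ℕ} (hk : (k : ℝ) ≤ b * n) :
    c ^ k ≤ d ^ n := by
  have hc : 1 < c := h.one_lt_c
  have h1 : c ^ b ≤ d := by
    have := rpow_one_add_le_one_add_mul_self (s := c - 1) (by linarith) h.b_pos.le
      h.b_lt_one.le
    rw [add_sub_cancel] at this
    rw [h.d_eq]
    linarith
  calc c ^ k = c ^ (k : ℝ) := (Real.rpow_natCast _ _).symm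
    _ ≤ c ^ (b * n) := Real.rpow_le_rpow_of_exponent_le hc.le hk
    _ = (c ^ b) ^ n := by rw [Real.rpow_mul (by linarith), Real.rpow_natCast]
    _ ≤ d ^ n := pow_le_pow_left₀ (by positivity) h1 n

theorem choose_mul_le (h : Parameters β c d b w) {n k : ℕ} (hk : k ≤ n) :
    n.choose k * ((c * b) ^ k * (1 - b) ^ (n - k)) ≤ d ^ n := by
  have hc : 1 < c := h.one_lt_c
  have hb := h.b_pos
  have hb1 : 0 < 1 - b := by linarith [h.b_lt_one]
  rw [h.d_eq, add_comm, add_pow]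
  refine le_trans (le_of_eq (by ring)) (Finset.single_le_sum (f := fun i =>
    (c * b) ^ i * (1 - b) ^ (n - i) * (n.choose i : ℝ)) (fun i _ => by positivity)
    (Finset.mem_range.2 (Nat.lt_succ_of_le hk)))

/-- The ideal overlap `y` solves `k - y = b (n - β y)`: the fixed set has density `1/β` inside the
sample and `b` outside. Rounding to `x = ⌊y⌋` and `t = ⌊β x⌋` moves `k - x - b (n - t)` to somewhere
between `-b` and `1 - b β`. Rounding `t` down preserves `t ≤ β x`, on which the approximation ratio
depends. -/
theorem exists_rounded_sample_size (h : Parameters β c d b w) {n k : ℕ} (hk : β * k < n)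
    (hkb : b * n < k) : ∃ x t : ℕ, x ≤ k ∧ x ≤ t ∧ (t : ℝ) ≤ β * x ∧ β * x ≤ t + 1 ∧ t < n ∧
      t + k ≤ n + x ∧ |((k - x : ℕ) : ℝ) - b * ((n - t : ℕ) : ℝ)| ≤ 1 := by
  have hb := h.b_pos
  have hb1 : 0 < 1 - b := by linarith [h.b_lt_one]
  have hβ : 1 < β := h.one_lt_β
  have hbβ : 0 < 1 - b * β := by linarith [h.b_lt]
  obtain ⟨y, hy⟩ : ∃ y, y = ((k : ℝ) - b * n) / (1 - b * β) := ⟨_, rfl⟩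
  have hyk : y * (1 - b * β) = k - b * n := hy ▸ div_mul_cancel₀ _ hbβ.ne'
  have hy0 : 0 ≤ y := hy ▸ div_nonneg (by linarith) hbβ.le
  have hyn : β * y < n := by
    rw [hy, ← mul_div_assoc, div_lt_iff₀ hbβ]
    nlinarith
  obtain ⟨x, hx1, hx2⟩ : ∃ x : ℕ, (x : ℝ) ≤ y ∧ y < x + 1 :=
    ⟨⌊y⌋₊, Nat.floor_le hy0, Nat.lt_floor_add_one y⟩
  have hβx : 0 ≤ β * x := by positivity
  obtain ⟨t, ht1, ht2, hxt⟩ : ∃ t : ℕ, (t : ℝ) ≤ β * x ∧ β * x < t + 1 ∧ x ≤ t :=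
    ⟨⌊β * x⌋₊, Nat.floor_le hβx, Nat.lt_floor_add_one _,
      Nat.le_floor (le_mul_of_one_le_left (Nat.cast_nonneg _) hβ.le)⟩
  have htn : t < n := by
    have : (t : ℝ) < n := by nlinarith
    exact_mod_cast this
  have hyk' : y ≤ k := by
    rw [hy, div_le_iff₀ hbβ]
    nlinarith
  have hxk : x ≤ k := by exact_mod_cast hx1.trans hyk'
  have htk : t + k ≤ n + x := by
    have h1 : (β - 1) * y ≤ n - k := by
      rw [hy, ← mul_div_assoc, div_le_iff₀ hbβ]
      nlinarith [mul_nonneg (sub_nonneg.2 hk.le) hb1.le]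
    have : (t : ℝ) + k ≤ n + x := by nlinarith
    exact_mod_cast this
  refine ⟨x, t, hxk, hxt, ht1, ht2.le, htn, htk, ?_⟩
  rw [Nat.cast_sub hxk, Nat.cast_sub htn.le, abs_le]
  have e1 : 0 ≤ (y - x) * (1 - b * β) := mul_nonneg (by linarith) hbβ.le
  have e2 : (y - x) * (1 - b * β) ≤ 1 * (1 - b * β) :=
    mul_le_mul_of_nonneg_right (by linarith) hbβ.le
  have e3 : b * (t - β * x) ≤ 0 := mul_nonpos_of_nonneg_of_nonpos hb.le (by linarith)
  have e4 : b * (-1) ≤ b * (t - β * x) := mul_le_mul_of_nonneg_left (by linarith) hb.le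
  have e5 : (k : ℝ) - x - b * (n - t) = (y - x) * (1 - b * β) + b * (t - β * x) := by
    rw [sub_mul, hyk]; ring
  have e6 : 0 < b * β := mul_pos hb (by linarith)
  rw [e5]
  constructor <;> linarith

/-- By `log_eq` the product would be exactly `1` for a real size `t = β x`, without the leading `w`;
rounding `t` costs at most one factor `w`. -/
theorem one_le_tilt (h : Parameters β c d b w) {x t : ℕ} (hxt : x ≤ t)
    (ht : β * x ≤ t + 1) : 1 ≤ w * ((c * b * β) ^ x * w ^ (t - x)) := by
  have hb := h.b_pos
  have hβ : 0 < β := by linarith [h.one_lt_β]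
  have hw : 0 < w := by linarith [h.one_lt_w]
  have hc : 0 < c := by linarith [h.one_lt_c]
  have hpos : 0 < c * b * β := by positivity
  have hlw := Real.log_pos h.one_lt_w
  have h1 : 0 ≤ Real.log (w * ((c * b * β) ^ x * w ^ (t - x))) := by
    rw [Real.log_mul hw.ne' (mul_pos (pow_pos hpos _) (pow_pos hw _)).ne',
      Real.log_mul (pow_pos hpos _).ne' (pow_pos hw _).ne', Real.log_pow, Real.log_pow, h.log_eq,
      Nat.cast_sub hxt]
    have : Real.log w + (x * ((1 - β) * Real.log w) + (t - x) * Real.log w) =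
        (t + 1 - β * x) * Real.log w := by ring
    rw [this]
    exact mul_nonneg (by linarith) hlw.le
  exact (Real.log_nonneg_iff (mul_pos hw (mul_pos (pow_pos hpos _) (pow_pos hw _)))).1 h1

/-- The change of measure inside the sample, from density `1/β` to the weights `c b` and `1 - b`. -/
theorem pow_mul_pow_eq (h : Parameters β c d b w) (x r : ℕ) :
    (1 / β) ^ x * (1 - 1 / β) ^ r * ((c * b * β) ^ x * w ^ r) = (c * b) ^ x * (1 - b) ^ r := by
  have hβ : β ≠ 0 := by linarith [h.one_lt_β]
  have h1 : 1 / β * (c * b * β) = c * b := by field_simp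
  calc _ = (1 / β * (c * b * β)) ^ x * (w * (1 - 1 / β)) ^ r := by
        rw [mul_pow (1 / β), mul_pow w]; ring
    _ = _ := by rw [h1, h.w_eq]

/-- Multiply the left side by quantities that are at least one: the tilt and, with polynomial
compensation, the two binomial probabilities near their means. Double counting turns the product of
binomials into one containing `n.choose k`, and the change of measure reassembles `(c b) ^ k * (1 -
b) ^ (n - k)`; together these are at most `d ^ n`. -/
theorem pow_mul_choose_le (h : Parameters β c d b w) {n k x t : ℕ} (hkn : k ≤ n)
    (hxk : x ≤ k) (hxt : x ≤ t) (ht1 : (t : ℝ) ≤ β * x) (ht2 : β * x ≤ t + 1) (htn : t < n)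
    (htk : t + k ≤ n + x) (hab : |((k - x : ℕ) : ℝ) - b * ((n - t : ℕ) : ℝ)| ≤ 1) :
    c ^ (k - x) * n.choose t ≤ w * Real.exp (1 / (1 / β * (1 - 1 / β))) *
      Real.exp (1 / (b * (1 - b))) * (n + 1) ^ 2 * d ^ n *
        (k.choose x * (n - k).choose (t - x)) := by
  have hb := h.b_pos
  have hb1 : 0 < 1 - b := by linarith [h.b_lt_one]
  have hβ : 1 < β := h.one_lt_β
  have hβ0 : 0 < β := by linarith
  have hw : 0 < w := by linarith [h.one_lt_w]
  have hc : 0 < c := by linarith [h.one_lt_c]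
  have ha : 0 < 1 / β := by positivity
  have ha1 : 1 / β < 1 := by rw [div_lt_one hβ0]; exact hβ
  have ha2 : 0 < 1 - 1 / β := by linarith
  have h1 := one_le_choose_mul_pow ha ha1 hxt (by
    rw [abs_le]
    have : 1 / β * (t : ℝ) ≤ x := by rw [one_div, inv_mul_le_iff₀ hβ0]; exact ht1
    have : x - 1 ≤ 1 / β * (t : ℝ) := by
      rw [one_div, inv_mul_eq_div, le_div_iff₀ hβ0]
      nlinarith
    constructor <;> linarith)
  have h2 := one_le_choose_mul_pow (m := n - t) (j := k - x) hb h.b_lt_one (by omega) hab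
  have h3 := h.one_le_tilt hxt ht2
  have h4 := h.choose_mul_le hkn
  have h5 : (n.choose t : ℝ) * t.choose x * (n - t).choose (k - x) =
      n.choose k * k.choose x * (n - k).choose (t - x) := by
    exact_mod_cast choose_mul_choose_mul_choose hxk hxt hkn htn.le htk
  have h6 : (t : ℝ) + 1 ≤ n + 1 := by
    have : (t : ℝ) ≤ n := by exact_mod_cast htn.le
    linarith
  have h7 : ((n - t : ℕ) : ℝ) + 1 ≤ n + 1 := by
    have : ((n - t : ℕ) : ℝ) ≤ n := by exact_mod_cast Nat.sub_le _ _
    linarith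
  have h8 := h.pow_mul_pow_eq x (t - x)
  have h9 : (c * b) ^ k * (1 - b) ^ (n - k) = c ^ (k - x) * ((c * b) ^ x * (1 - b) ^ (t - x) *
      (b ^ (k - x) * (1 - b) ^ (n - t - (k - x)))) := by
    have e1 : k = x + (k - x) := by omega
    have e2 : n - k = (t - x) + (n - t - (k - x)) := by omega
    calc (c * b) ^ k * (1 - b) ^ (n - k)
        = (c * b) ^ (x + (k - x)) * (1 - b) ^ ((t - x) + (n - t - (k - x))) := by
          rw [← e1, ← e2]
      _ = _ := by rw [pow_add, pow_add, mul_pow c b (k - x)]; ring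
  rw [h9] at h4
  generalize hE₁ : Real.exp (1 / (1 / β * (1 - 1 / β))) = E₁ at h1 ⊢
  generalize hE₂ : Real.exp (1 / (b * (1 - b))) = E₂ at h2 ⊢
  have hE₁0 : 0 < E₁ := hE₁ ▸ Real.exp_pos _
  have hE₂0 : 0 < E₂ := hE₂ ▸ Real.exp_pos _
  have hP : 0 < (1 / β) ^ x * (1 - 1 / β) ^ (t - x) := mul_pos (pow_pos ha _) (pow_pos ha2 _)
  have hQ : 0 < b ^ (k - x) * (1 - b) ^ (n - t - (k - x)) := mul_pos (pow_pos hb _) (pow_pos hb1 _)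
  generalize (1 / β) ^ x * (1 - 1 / β) ^ (t - x) = P at *
  generalize b ^ (k - x) * (1 - b) ^ (n - t - (k - x)) = Q at *
  generalize (c * b * β) ^ x * w ^ (t - x) = R at *
  rw [← h8] at h4
  have h1' : 1 ≤ E₁ * (n + 1) * (t.choose x * P) := h1.trans (by gcongr)
  have h2' : 1 ≤ E₂ * (n + 1) * ((n - t).choose (k - x) * Q) := h2.trans (by gcongr)
  calc c ^ (k - x) * n.choose t
      ≤ c ^ (k - x) * n.choose t * ((w * R) * ((E₁ * (n + 1) * (t.choose x * P)) *
          (E₂ * (n + 1) * ((n - t).choose (k - x) * Q)))) :=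
        le_mul_of_one_le_right (by positivity) (one_le_mul_of_one_le_of_one_le h3
          (one_le_mul_of_one_le_of_one_le h1' h2'))
    _ = w * E₁ * E₂ * (n + 1) ^ 2 * (n.choose t * t.choose x * (n - t).choose (k - x)) *
        (c ^ (k - x) * (P * R * Q)) := by ring
    _ = w * E₁ * E₂ * (n + 1) ^ 2 * (n.choose k * (c ^ (k - x) * (P * R * Q))) *
        (k.choose x * (n - k).choose (t - x)) := by rw [h5]; ring
    _ ≤ w * E₁ * E₂ * (n + 1) ^ 2 * d ^ n * (k.choose x * (n - k).choose (t - x)) := by gcongr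

/-- The size `t` of the sampled set and the number `x` of its elements in a fixed set of size `k`
for which a subsequent query with parameter `k - x` is worth its cost. -/
theorem exists_sample_size (h : Parameters β c d b w) : ∃ E : ℝ, 0 < E ∧ ∀ n k : ℕ, β * k < n →
    ∃ x t : ℕ, x ≤ k ∧ x ≤ t ∧ (t : ℝ) ≤ β * x ∧ t < n ∧
      c ^ (k - x) * n.choose t ≤
        E * (n + 1) ^ 2 * d ^ n * (k.choose x * (n - k).choose (t - x)) := by
  have hb := h.b_pos
  have hb1 : 0 < 1 - b := by linarith [h.b_lt_one]
  have hβ : 1 < β := h.one_lt_β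
  have hw : 1 < w := h.one_lt_w
  have hd : 1 < d := h.one_lt_d
  have ha2 : 0 < 1 - 1 / β := by
    rw [sub_pos, div_lt_one (by linarith)]; exact hβ
  have hE1 : 1 ≤ w * Real.exp (1 / (1 / β * (1 - 1 / β))) * Real.exp (1 / (b * (1 - b))) :=
    one_le_mul_of_one_le_of_one_le (one_le_mul_of_one_le_of_one_le hw.le
      (Real.one_le_exp (by positivity))) (Real.one_le_exp (by positivity))
  refine ⟨_, one_pos.trans_le hE1, fun n k hk => ?_⟩
  have hn : (0 : ℝ) < n := lt_of_le_of_lt (by positivity) hk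
  have hkn : k < n := by
    have : (k : ℝ) < n := lt_of_le_of_lt (le_mul_of_one_le_left (Nat.cast_nonneg _) hβ.le) hk
    exact_mod_cast this
  rcases le_or_gt (k : ℝ) (b * n) with hkb | hkb
  -- A set of density at most `b` is found by querying the empty set with parameter `k`.
  · refine ⟨0, 0, Nat.zero_le _, le_rfl, by simp, by exact_mod_cast hn, ?_⟩
    have h1 := h.pow_le_pow_of_le hkb
    have h2 := one_le_mul_of_one_le_of_one_le hE1
      (one_le_pow₀ (by linarith) : 1 ≤ ((n : ℝ) + 1) ^ 2)
    simp only [Nat.sub_zero, Nat.choose_zero_right, Nat.cast_one, mul_one, Nat.sub_self]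
    exact h1.trans (le_mul_of_one_le_left (by positivity) h2)
  · obtain ⟨x, t, hxk, hxt, ht1, ht2, htn, htk, hab⟩ := h.exists_rounded_sample_size hk hkb
    exact ⟨x, t, hxk, hxt, ht1, htn, h.pow_mul_choose_le hkn.le hxk hxt ht1 ht2 htn htk hab⟩

end Parameters

/-- A threshold `T` below `M` for which a set of independent elements with inclusion probability
`T / M` equals any given set of size `t` with about the largest possible probability. -/
theorem exists_threshold {n t M : ℕ} (ht : t < n) (hM : 2 * n ^ 2 ≤ M) :
    ∃ T < M, (1 : ℝ) ≤ 2 * (n + 1) * n.choose t *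
      ((T / M : ℝ) ^ t * ((M - T) / M : ℝ) ^ (n - t)) := by
  have hn : (0 : ℝ) < n := by exact_mod_cast (Nat.zero_le t).trans_lt ht
  have hn1 : (1 : ℝ) ≤ n := by exact_mod_cast Nat.one_le_of_lt ht
  have htn : (t : ℝ) + 1 ≤ n := by exact_mod_cast ht
  have hM' : 2 * (n : ℝ) ^ 2 ≤ M := by exact_mod_cast hM
  have hM0 : (0 : ℝ) < M := lt_of_lt_of_le (by positivity) hM'
  have hMn : (n : ℝ) ≤ M := by nlinarith
  have hT1 := Nat.le_ceil ((M : ℝ) * t / n)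
  have hT2 := Nat.ceil_lt_add_one (show 0 ≤ (M : ℝ) * t / n by positivity)
  -- Rounding up keeps `T / M ≥ t / n`. The complementary probability loses at most a factor `1 - n
  -- / M`, whose `n`-th power is at least `1/2` since `2 * n ^ 2 ≤ M`.
  set T := ⌈(M : ℝ) * t / n⌉₊ with hT
  rw [div_le_iff₀ hn] at hT1
  rw [← sub_lt_iff_lt_add, lt_div_iff₀ hn] at hT2
  refine ⟨T, ?_, ?_⟩
  · have : (T : ℝ) < M := by
      refine lt_of_mul_lt_mul_right (a := (n : ℝ)) ?_ hn.le
      nlinarith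
    exact_mod_cast this
  have h1 : (t / n : ℝ) ≤ T / M := by
    rw [div_le_div_iff₀ hn hM0]; linarith
  have h2 : ((n - t) / n : ℝ) * (1 - n / M) ≤ (M - T) / M := by
    rw [one_sub_div hM0.ne', div_mul_div_comm, div_le_div_iff₀ (by positivity) hM0]
    have : ((n : ℝ) - t) * (M - n) ≤ (M - T) * n := by nlinarith
    nlinarith
  have h3 : (1 / 2 : ℝ) ≤ (1 - n / M) ^ (n - t) := by
    have e1 : (n : ℝ) / M ≤ 1 := by rw [div_le_one hM0]; exact hMn
    have e2 : (0 : ℝ) ≤ n / M := by positivity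
    have e3 := one_add_mul_le_pow (a := -((n : ℝ) / M)) (by linarith) n
    have e4 : (n : ℝ) * (n / M) ≤ 1 / 2 := by
      rw [← mul_div_assoc, div_le_iff₀ hM0]
      nlinarith
    calc (1 / 2 : ℝ) ≤ 1 + n * -((n : ℝ) / M) := by linarith
      _ ≤ (1 + -((n : ℝ) / M)) ^ n := e3
      _ = (1 - (n : ℝ) / M) ^ n := by ring
      _ ≤ _ := pow_le_pow_of_le_one (by linarith) (by linarith) (Nat.sub_le _ _)
  have h4 := cast_pow_self_le_choose ht.le
  have hnt : (0 : ℝ) ≤ (n - t) / n := div_nonneg (by linarith) hn.le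
  have h5 : (t / n : ℝ) ^ t * (((n - t) / n) ^ (n - t) * (1 / 2)) ≤
      (T / M : ℝ) ^ t * ((M - T) / M : ℝ) ^ (n - t) := by
    have e1 : (0 : ℝ) ≤ 1 - n / M := by
      rw [sub_nonneg, div_le_one hM0]; exact hMn
    refine mul_le_mul (pow_le_pow_left₀ (by positivity) h1 t) ?_ (by positivity) (by positivity)
    calc ((n - t) / n : ℝ) ^ (n - t) * (1 / 2)
        ≤ ((n - t) / n : ℝ) ^ (n - t) * (1 - n / M) ^ (n - t) := by gcongr
      _ = (((n - t) / n : ℝ) * (1 - n / M)) ^ (n - t) := (mul_pow _ _ _).symm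
      _ ≤ _ := pow_le_pow_left₀ (mul_nonneg hnt e1) h2 _
  refine le_trans ?_ (mul_le_mul_of_nonneg_left h5 (by positivity))
  have h6 : (n : ℝ) ^ n = n ^ t * n ^ (n - t) := by rw [← pow_add, Nat.add_sub_cancel' ht.le]
  rw [h6] at h4
  rw [div_pow, div_pow]
  calc (1 : ℝ) = (n ^ t * n ^ (n - t)) / (n ^ t * n ^ (n - t)) := (div_self (by positivity)).symm
    _ ≤ ((n + 1) * (n.choose t * (t : ℝ) ^ t * ((n : ℝ) - t) ^ (n - t))) /
        (n ^ t * n ^ (n - t)) := by gcongr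
    _ = _ := by field_simp

/-- The number of sets of size `t` that meet `P` in `x` elements. -/
theorem choose_mul_choose_le_card {n t x : ℕ} (P : Finset (Fin n)) (hx : x ≤ t) :
    P.card.choose x * (n - P.card).choose (t - x) ≤
      (Finset.univ.filter fun X : Finset (Fin n) => X.card = t ∧ (P ∩ X).card = x).card := by
  classical
  have h1 : (Finset.powersetCard x P ×ˢ Finset.powersetCard (t - x) Pᶜ).card =
      P.card.choose x * (n - P.card).choose (t - x) := by
    rw [Finset.card_product, Finset.card_powersetCard, Finset.card_powersetCard,
      Finset.card_compl, Fintype.card_fin]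
  rw [← h1]
  have key : ∀ Y ⊆ P, ∀ Z ⊆ Pᶜ, P ∩ (Y ∪ Z) = Y ∧ Pᶜ ∩ (Y ∪ Z) = Z := by
    intro Y hY Z hZ
    constructor
    · ext i
      have := @hY i
      have := @hZ i
      simp only [Finset.mem_inter, Finset.mem_union, Finset.mem_compl] at *
      tauto
    · ext i
      have := @hY i
      have := @hZ i
      simp only [Finset.mem_inter, Finset.mem_union, Finset.mem_compl] at *
      tauto
  refine Finset.card_le_card_of_injOn (fun q => q.1 ∪ q.2) ?_ ?_
  · rintro ⟨Y, Z⟩ hq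
    simp only [Finset.coe_product, Set.mem_prod, Finset.mem_coe, Finset.mem_powersetCard] at hq
    obtain ⟨⟨hY, hYc⟩, hZ, hZc⟩ := hq
    simp only [Finset.coe_filter, Finset.mem_univ, true_and, Set.mem_ofPred_eq]
    refine ⟨?_, by rw [(key Y hY Z hZ).1, hYc]⟩
    rw [Finset.card_union_of_disjoint, hYc, hZc, Nat.add_sub_cancel' hx]
    exact Finset.disjoint_left.2 fun i hi hi' => (Finset.mem_compl.1 (hZ hi')) (hY hi)
  · rintro ⟨Y, Z⟩ hq ⟨Y', Z'⟩ hq' he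
    simp only [Finset.coe_product, Set.mem_prod, Finset.mem_coe, Finset.mem_powersetCard]
      at hq hq'
    have he' : Y ∪ Z = Y' ∪ Z' := he
    have h2 := key Y hq.1.1 Z hq.2.1
    have h3 := key Y' hq'.1.1 Z' hq'.2.1
    rw [he'] at h2
    exact Prod.ext (h2.1.symm.trans h3.1) (h2.2.symm.trans h3.2)

/-! ### A calculus of sure postconditions and expectations -/

section Calculus

variable {ι : Type} {n : ℕ} {O : ι → Oracle n}

/-- Started in `s`, the program `p` halts, its final states satisfy `Q`, and the expectation of `g`
in the final state is at least `v`. -/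
def Guarantee (O : ι → Oracle n) (p : Prog ι) (s : State ι n) (Q : State ι n → Prop)
    (g : State ι n → ℝ≥0∞) (v : ℝ≥0∞) : Prop :=
  ∃ μ, Exec O p s μ ∧ (∀ t ∈ μ.support, Q t) ∧ v ≤ ∑' t, μ t * g t

/-- Started in `s`, the program `p` halts, and its final states satisfy `Q`. -/
def Surely (O : ι → Oracle n) (p : Prog ι) (s : State ι n) (Q : State ι n → Prop) : Prop :=
  Guarantee O p s Q 0 0

variable {p q : Prog ι} {s t : State ι n} {Q Q' : State ι n → Prop} {g g' : State ι n → ℝ≥0∞}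
  {v v' : ℝ≥0∞}

theorem Guarantee.mono (h : Guarantee O p s Q g v) (hQ : ∀ t, Q t → Q' t)
    (hg : ∀ t, Q t → g t ≤ g' t) (hv : v' ≤ v) : Guarantee O p s Q' g' v' := by
  obtain ⟨μ, hμ, h1, h2⟩ := h
  refine ⟨μ, hμ, fun t ht => hQ t (h1 t ht), hv.trans (h2.trans (ENNReal.tsum_le_tsum fun t => ?_))⟩
  by_cases ht : μ t = 0
  · simp [ht]
  · have := hg t (h1 t ((PMF.mem_support_iff _ _).2 ht))
    gcongr

theorem Guarantee.surely (h : Guarantee O p s Q g v) : Surely O p s Q := by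
  obtain ⟨μ, hμ, h1, -⟩ := h
  exact ⟨μ, hμ, h1, zero_le⟩

theorem Surely.mono (h : Surely O p s Q) (hQ : ∀ t, Q t → Q' t) : Surely O p s Q' :=
  Guarantee.mono h hQ (fun _ _ => le_rfl) le_rfl

/-- Carries success probability that is already secured, together with a failure factor, through a
later program. -/
theorem Guarantee.affine (h : Guarantee O p s Q g v) (a b : ℝ≥0∞) :
    Guarantee O p s Q (fun t => a + b * g t) (a + b * v) := by
  obtain ⟨μ, hμ, h1, h2⟩ := h
  refine ⟨μ, hμ, h1, ?_⟩
  simp_rw [mul_add, mul_left_comm _ b]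
  rw [ENNReal.tsum_add, ENNReal.tsum_mul_right, ENNReal.tsum_mul_left, μ.tsum_coe, one_mul]
  gcongr

theorem Surely.guarantee (h : Surely O p s Q) (hv : ∀ t, Q t → v ≤ g t) :
    Guarantee O p s Q g v :=
  (Guarantee.affine h v 0).mono (fun _ h => h) (fun t ht => by simpa using hv t ht) (by simp)

/-- `g` serves as a pre-expectation: the value that `q` guarantees from an intermediate state is the
payoff for `p`. -/
theorem Guarantee.seq (hp : Guarantee O p s Q g v)
    (hq : ∀ t, Q t → Guarantee O q t Q' g' (g t)) : Guarantee O (.seq p q) s Q' g' v := by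
  classical
  obtain ⟨μ, hμ, h1, h2⟩ := hp
  have key : ∀ t, ∃ ν, t ∈ μ.support →
      Exec O q t ν ∧ (∀ u ∈ ν.support, Q' u) ∧ g t ≤ ∑' u, ν u * g' u := by
    intro t
    by_cases ht : t ∈ μ.support
    · obtain ⟨ν, hν⟩ := hq t (h1 t ht)
      exact ⟨ν, fun _ => hν⟩
    · exact ⟨PMF.pure t, fun h => absurd h ht⟩
  choose ν hν using key
  refine ⟨μ.bind ν, Exec.seq p q s μ ν hμ fun t ht => (hν t ht).1, ?_, h2.trans ?_⟩
  · intro u hu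
    obtain ⟨t, ht, htu⟩ := (PMF.mem_support_bind_iff _ _ _).1 hu
    exact (hν t ht).2.1 u htu
  · simp_rw [PMF.bind_apply, ← ENNReal.tsum_mul_right]
    rw [ENNReal.tsum_comm]
    refine ENNReal.tsum_le_tsum fun t => ?_
    simp_rw [mul_assoc]
    rw [ENNReal.tsum_mul_left]
    by_cases ht : μ t = 0
    · simp [ht]
    · have := (hν t ((PMF.mem_support_iff _ _).2 ht)).2.2
      gcongr

theorem Surely.seq_guarantee (hp : Surely O p s Q) (hq : ∀ t, Q t → Guarantee O q t Q' g v) :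
    Guarantee O (.seq p q) s Q' g v :=
  Guarantee.seq (hp.guarantee (g := fun _ => v) fun _ _ => le_rfl) hq

theorem Guarantee.instr {i : Instr ι} (hi : i.step O s = PMF.pure t) (hQ : Q t) (hv : v ≤ g t) :
    Guarantee O (.instr i) s Q g v := by
  refine ⟨_, Exec.instr i s, ?_, ?_⟩
  · rw [hi, PMF.support_pure]
    rintro _ rfl
    exact hQ
  · rw [hi, tsum_eq_single t]
    · simpa using hv
    · intro u hu
      simp [hu]

theorem Guarantee.instr_seq {i : Instr ι} (hi : i.step O s = PMF.pure t)
    (h : Guarantee O q t Q g v) : Guarantee O (.seq (.instr i) q) s Q g v :=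
  Guarantee.seq (Guarantee.instr (Q := fun u => u = t) (g := fun _ => v) hi rfl le_rfl)
    fun _ hu => hu ▸ h

theorem Guarantee.cond_true {r : ℕ} (hr : s.reg r ≠ 0) (h : Guarantee O p (s.tick 1) Q g v) :
    Guarantee O (.cond r p q) s Q g v := by
  obtain ⟨μ, hμ, h'⟩ := h
  exact ⟨μ, Exec.cond_true r p q s μ hr hμ, h'⟩

theorem Guarantee.cond_false {r : ℕ} (hr : s.reg r = 0) (h : Guarantee O q (s.tick 1) Q g v) :
    Guarantee O (.cond r p q) s Q g v := by
  obtain ⟨μ, hμ, h'⟩ := h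
  exact ⟨μ, Exec.cond_false r p q s μ hr hμ, h'⟩

theorem guarantee_map_uniform {α : Type} [Fintype α] [Nonempty α] {i : Instr ι}
    {f : α → State ι n} (hi : i.step O s = (PMF.uniformOfFintype α).map f) (hQ : ∀ a, Q (f a))
    (hv : v ≤ (∑ a, g (f a)) / Fintype.card α) : Guarantee O (.instr i) s Q g v := by
  refine ⟨_, Exec.instr i s, ?_, ?_⟩
  · rw [hi, PMF.support_map]
    rintro _ ⟨a, -, rfl⟩
    exact hQ a
  · rw [hi]
    refine hv.trans (le_of_eq ?_)
    have h1 : ∀ t, (PMF.map f (PMF.uniformOfFintype α)) t * g t =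
        ∑' a, (PMF.uniformOfFintype α) a * (PMF.pure (f a) t * g t) := by
      intro t
      rw [← PMF.bind_pure_comp, PMF.bind_apply, ← ENNReal.tsum_mul_right]
      exact tsum_congr fun a => by rw [mul_assoc]; rfl
    simp_rw [h1]
    rw [ENNReal.tsum_comm]
    simp_rw [ENNReal.tsum_mul_left]
    have h2 : ∀ a, ∑' t, PMF.pure (f a) t * g t = g (f a) := by
      intro a
      rw [tsum_eq_single (f a)]
      · simp
      · intro u hu
        simp [hu]
    simp_rw [h2, PMF.uniformOfFintype_apply]
    rw [ENNReal.tsum_mul_left, tsum_fintype, ENNReal.div_eq_inv_mul]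

theorem Guarantee.flip {r : ℕ} (h0 : Q ((s.setReg r 0).tick 1)) (h1 : Q ((s.setReg r 1).tick 1))
    (hv : v ≤ (g ((s.setReg r 0).tick 1) + g ((s.setReg r 1).tick 1)) / 2) :
    Guarantee O (.instr (.flip r)) s Q g v := by
  refine guarantee_map_uniform (f := fun b : Bool => (s.setReg r b.toNat).tick 1) rfl ?_ ?_
  · rintro (_ | _)
    · exact h0
    · exact h1
  · refine hv.trans (le_of_eq ?_)
    rw [Fintype.sum_bool, Fintype.card_bool, add_comm]
    rfl

theorem Guarantee.query {j : ι} {y x a : ℕ}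
    (hQ : ∀ r, Q ((s.setSet y ((O j).answer (s.sets x) (s.reg a) r)).record j (s.sets x) (s.reg a)))
    (hv : v ≤ (∑ r, g ((s.setSet y ((O j).answer (s.sets x) (s.reg a) r)).record j (s.sets x)
      (s.reg a))) / 2 ^ (O j).bits) :
    Guarantee O (.instr (.query j y x a)) s Q g v := by
  refine guarantee_map_uniform rfl hQ (hv.trans (le_of_eq ?_))
  simp

/-! ### Bounds on the effect of a program -/

@[simp] theorem State.tick_reg (k : ℕ) : (s.tick k).reg = s.reg := rfl
@[simp] theorem State.tick_sets (k : ℕ) : (s.tick k).sets = s.sets := rfl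
@[simp] theorem State.setReg_sets (r v : ℕ) : (s.setReg r v).sets = s.sets := rfl
@[simp] theorem State.setSet_reg (x : ℕ) (X : Finset (Fin n)) : (s.setSet x X).reg = s.reg := rfl
@[simp] theorem State.record_reg (j : ι) (X : Finset (Fin n)) (ℓ : ℕ) :
    (s.record j X ℓ).reg = s.reg := rfl
@[simp] theorem State.record_sets (j : ι) (X : Finset (Fin n)) (ℓ : ℕ) :
    (s.record j X ℓ).sets = s.sets := rfl
theorem State.setReg_reg (r v i : ℕ) :
    (s.setReg r v).reg i = if i = r then v else s.reg i := Function.update_apply _ _ _ _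
theorem State.setSet_sets (x : ℕ) (X : Finset (Fin n)) (i : ℕ) :
    (s.setSet x X).sets i = if i = x then X else s.sets i := Function.update_apply _ _ _ _

variable {γ : ι → ℝ}

@[simp] theorem State.cost_tick (k : ℕ) : (s.tick k).cost γ = s.cost γ + k := by
  simp only [State.cost, State.tick, Nat.cast_add]
  ring
@[simp] theorem State.cost_setReg (r v : ℕ) : (s.setReg r v).cost γ = s.cost γ := rfl
@[simp] theorem State.cost_setSet (x : ℕ) (X : Finset (Fin n)) :
    (s.setSet x X).cost γ = s.cost γ := rfl
@[simp] theorem State.cost_record (j : ι) (X : Finset (Fin n)) (ℓ : ℕ) :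
    (s.record j X ℓ).cost γ = s.cost γ + γ j ^ ℓ := by
  simp only [State.cost, State.record, List.map_cons, List.sum_cons]
  ring

/-- From `s` to `t`, only number registers from `a` on and set registers from `e` on have changed,
at a cost of at most `κ`. -/
structure Within (γ : ι → ℝ) (a e : ℕ) (κ : ℝ) (s t : State ι n) : Prop where
  reg : ∀ i < a, t.reg i = s.reg i
  sets : ∀ i < e, t.sets i = s.sets i
  cost : t.cost γ ≤ s.cost γ + κ

theorem Within.trans {a e : ℕ} {κ κ' : ℝ} {u : State ι n} (h : Within γ a e κ s t)
    (h' : Within γ a e κ' t u) : Within γ a e (κ + κ') s u where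
  reg i hi := (h'.reg i hi).trans (h.reg i hi)
  sets i hi := (h'.sets i hi).trans (h.sets i hi)
  cost := by linarith [h.cost, h'.cost]

theorem Within.mono {a e a' e' : ℕ} {κ κ' : ℝ} (h : Within γ a e κ s t) (ha : a' ≤ a) (he : e' ≤ e)
    (hκ : κ ≤ κ') : Within γ a' e' κ' s t where
  reg i hi := h.reg i (by omega)
  sets i hi := h.sets i (by omega)
  cost := by linarith [h.cost]

theorem Within.tick {a e k : ℕ} : Within γ a e k s (s.tick k) where
  reg _ _ := rfl
  sets _ _ := rfl
  cost := by simp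

/-- The rule for loops, where `k` is the number of remaining iterations. -/
theorem Guarantee.loop {r a e : ℕ} {κ : ℝ} {inv : ℕ → State ι n → Prop}
    {G : ℕ → State ι n → ℝ≥0∞} (h0 : ∀ s, inv 0 s → s.reg r = 0)
    (h1 : ∀ k s, inv (k + 1) s → s.reg r ≠ 0 ∧ Guarantee O p (s.tick 1)
      (fun t => inv k t ∧ Within γ a e κ (s.tick 1) t) (G k) (G (k + 1) s))
    (hinv : ∀ u, inv 0 u → inv 0 (u.tick 1))
    (hg : ∀ u, inv 0 u → G 0 u ≤ g (u.tick 1)) (k : ℕ) (s : State ι n) (hs : inv k s) :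
    Guarantee O (.loop r p) s (fun t => inv 0 t ∧ Within γ a e (k * (κ + 1) + 1) s t) g (G k s) := by
  induction k generalizing s with
  | zero =>
    refine ⟨_, Exec.loop_false r p s (h0 s hs), ?_, ?_⟩
    · rw [PMF.support_pure]
      rintro _ rfl
      exact ⟨hinv s hs, Within.tick.mono le_rfl le_rfl (by simp)⟩
    · rw [tsum_eq_single (s.tick 1)]
      · simpa using hg s hs
      · intro u hu
        simp [hu]
  | succ k ih =>
    obtain ⟨hr, hb⟩ := h1 k s hs
    have := Guarantee.seq (Q' := fun t => inv 0 t ∧ Within γ a e ((k + 1 : ℕ) * (κ + 1) + 1) s t)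
      (g' := g) (q := .loop r p) hb fun t ht => (ih t ht.1).mono
        (fun u hu => ⟨hu.1, ((Within.tick.trans ht.2).trans hu.2).mono le_rfl le_rfl (by
          push_cast; linarith)⟩) (fun _ _ => le_rfl) le_rfl
    obtain ⟨μ, hμ, h'⟩ := this
    exact ⟨μ, Exec.loop_true r p s μ hr hμ, h'⟩

theorem Surely.loop {r a e : ℕ} {κ : ℝ} {inv : ℕ → State ι n → Prop}
    (h0 : ∀ s, inv 0 s → s.reg r = 0)
    (h1 : ∀ k s, inv (k + 1) s → s.reg r ≠ 0 ∧ Surely O p (s.tick 1)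
      (fun t => inv k t ∧ Within γ a e κ (s.tick 1) t))
    (hinv : ∀ u, inv 0 u → inv 0 (u.tick 1)) (k : ℕ) (s : State ι n) (hs : inv k s) :
    Surely O (.loop r p) s (fun t => inv 0 t ∧ Within γ a e (k * (κ + 1) + 1) s t) :=
  Guarantee.loop (G := fun _ _ => 0) h0 h1 hinv (fun _ _ => le_rfl) k s hs

end Calculus

section Sampling

variable {ι : Type} {n : ℕ} {O : ι → Oracle n} {γ : ι → ℝ} {s : State ι n}

/-! ### Random numbers -/

/-- The mean of `φ` over the numbers obtained from `r` by appending `k` random bits. -/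
noncomputable def dyadicMean (φ : ℕ → ℝ≥0∞) : ℕ → ℕ → ℝ≥0∞
  | 0, r => φ r
  | k + 1, r => (dyadicMean φ k (r + r) + dyadicMean φ k (r + r + 1)) / 2

theorem dyadicMean_add (φ : ℕ → ℝ≥0∞) (k m r : ℕ) :
    dyadicMean φ (k + m) r = dyadicMean (dyadicMean φ k) m r := by
  induction m generalizing r with
  | zero => rfl
  | succ m ih =>
    rw [← Nat.add_assoc, dyadicMean, dyadicMean, ih, ih]

theorem dyadicMean_eq (φ : ℕ → ℝ≥0∞) (k r : ℕ) :
    dyadicMean φ k r = (∑ u ∈ Finset.range (2 ^ k), φ (r * 2 ^ k + u)) / 2 ^ k := by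
  induction k generalizing r with
  | zero => simp [dyadicMean]
  | succ k ih =>
    have h1 : ∀ u, (r + r) * 2 ^ k + u = r * 2 ^ (k + 1) + u := fun u => by ring
    have h2 : ∀ u, (r + r + 1) * 2 ^ k + u = r * 2 ^ (k + 1) + (2 ^ k + u) := fun u => by ring
    rw [dyadicMean, ih, ih, pow_succ 2 k, mul_two, Finset.sum_range_add, ← ENNReal.add_div,
      pow_succ, ENNReal.div_eq_inv_mul, ENNReal.div_eq_inv_mul, ENNReal.div_eq_inv_mul,
      ← mul_assoc, ENNReal.mul_inv (by simp) (by simp), mul_comm (2⁻¹ : ℝ≥0∞)]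
    simp only [h1, h2, pow_succ, mul_two]

/-- Append a random bit to number register `10`. -/
def appendBit (ι : Type) : Prog ι :=
  .seq (.instr (.flip 11)) (.seq (.instr (.add 10 10 10)) (.instr (.add 10 10 11)))

/-- Registers follow the nesting of the routines, so that the bound `a` in `Within γ a e` drops from
inner to outer ones. Number registers `0, 1, 2` keep `n, 1, 0`; `3` to `6` hold the scaled trial
count, the query parameter, the remaining rounds and the remaining trials; from `7` on there is the
sampler and scratch space. Set registers `0, 1, 2` hold the best solution so far, the sample and the
oracle's answer. -/
theorem guarantee_appendBit (φ : ℕ → ℝ≥0∞) (s : State ι n) (e : ℕ) :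
    Guarantee O (appendBit ι) s (Within γ 10 e 3 s) (fun t => φ (t.reg 10))
      (dyadicMean φ 1 (s.reg 10)) := by
  refine Guarantee.seq (Q := fun t => ∃ b : Bool, t = (s.setReg 11 b.toNat).tick 1)
    (g := fun t => φ (s.reg 10 + s.reg 10 + t.reg 11))
    (Guarantee.flip ⟨false, rfl⟩ ⟨true, rfl⟩ ?_) ?_
  · simp [dyadicMean, State.setReg_reg]
  · rintro t ⟨b, rfl⟩
    refine Guarantee.instr_seq rfl (Guarantee.instr rfl ?_ ?_)
    · constructor
      · intro i hi
        have h1 : i ≠ 10 := by omega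
        have h2 : i ≠ 11 := by omega
        simp [State.setReg_reg, h1, h2]
      · simp
      · simp; linarith
    · simp [State.setReg_reg]

/-- Set number register `10` to a random number below `8 ^ Nat.size n`. -/
def draw (ι : Type) : Prog ι :=
  .seq (.instr (.const 10 0)) <| .seq (.instr (.add 9 0 2)) <| .loop 9 <|
    .seq (.instr (.half 9 9)) <| .seq (appendBit ι) <| .seq (appendBit ι) (appendBit ι)

theorem guarantee_draw (hn : s.reg 0 = n) (hz : s.reg 2 = 0) (φ : ℕ → ℝ≥0∞) (e : ℕ) :
    Guarantee O (draw ι) s (Within γ 9 e (11 * n + 3) s) (fun t => φ (t.reg 10))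
      ((∑ u ∈ Finset.range (8 ^ Nat.size n), φ u) / 8 ^ Nat.size n) := by
  have hmean : (∑ u ∈ Finset.range (8 ^ Nat.size n), φ u) / 8 ^ Nat.size n =
      dyadicMean φ (3 * Nat.size n) 0 := by
    rw [dyadicMean_eq, pow_mul, pow_mul]
    norm_num
  rw [hmean]
  refine Guarantee.instr_seq rfl (Guarantee.instr_seq rfl ?_)
  set s' := (((s.setReg 10 0).tick 1).setReg 9
    (((s.setReg 10 0).tick 1).reg 0 + ((s.setReg 10 0).tick 1).reg 2)).tick 1 with hs'
  have h9 : s'.reg 9 = n := by simp [hs', State.setReg_reg, hn, hz]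
  have h10 : s'.reg 10 = 0 := by simp [hs', State.setReg_reg]
  have hW : Within γ 9 e 2 s s' := by
    constructor
    · intro i hi
      have h1 : i ≠ 9 := by omega
      have h2 : i ≠ 10 := by omega
      simp [hs', State.setReg_reg, h1, h2]
    · simp [hs']
    · simp [hs']; linarith
  have := Guarantee.loop (O := O) (γ := γ) (r := 9) (a := 9) (e := e) (κ := 10)
    (p := .seq (.instr (.half 9 9)) <| .seq (appendBit ι) <| .seq (appendBit ι) (appendBit ι))
    (inv := fun k t => Nat.size (t.reg 9) = k)
    (G := fun k t => dyadicMean φ (3 * k) (t.reg 10)) (g := fun t => φ (t.reg 10))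
    (fun t ht => Nat.size_eq_zero.1 ht) ?_ (fun _ h => h) (fun _ _ => le_rfl) (Nat.size n) s'
    (by rw [h9])
  · refine this.mono (fun t ht => ?_) (fun _ _ => le_rfl) (by rw [h10])
    refine (hW.trans ht.2).mono le_rfl le_rfl ?_
    have : (Nat.size n : ℝ) ≤ n := by exact_mod_cast Nat.size_le.2 Nat.lt_two_pow_self
    linarith
  · intro k t ht
    have hne : t.reg 9 ≠ 0 := by
      intro h
      rw [h] at ht
      simp at ht
    refine ⟨hne, Guarantee.instr_seq rfl ?_⟩
    set t' := ((t.tick 1).setReg 9 ((t.tick 1).reg 9 / 2)).tick 1 with ht'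
    have hsize : Nat.size (t'.reg 9) = k := by
      have h1 : t'.reg 9 = t.reg 9 / 2 := by simp [ht', State.setReg_reg]
      have h2 := Nat.size_bit (b := (t.reg 9).bodd) (n := (t.reg 9).div2)
        (by rw [Nat.bit_bodd_div2]; exact hne)
      rw [Nat.bit_bodd_div2, ht, Nat.div2_val] at h2
      rw [h1]
      omega
    have hW' : Within γ 9 e 1 (t.tick 1) t' := by
      constructor
      · intro i hi
        have h1 : i ≠ 9 := by omega
        simp [ht', State.setReg_reg, h1]
      · simp [ht']
      · simp [ht']
    have h10' : t'.reg 10 = t.reg 10 := by simp [ht', State.setReg_reg]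
    have hbits : Guarantee O (.seq (appendBit ι) <| .seq (appendBit ι) (appendBit ι)) t'
        (Within γ 10 e 9 t') (fun u => dyadicMean φ (3 * k) (u.reg 10))
        (dyadicMean φ (3 * k + 1 + 1 + 1) (t'.reg 10)) := by
      rw [dyadicMean_add _ (3 * k + 1 + 1) 1]
      refine (guarantee_appendBit (γ := γ) _ t' e).seq fun u hu => ?_
      rw [dyadicMean_add _ (3 * k + 1) 1]
      refine (guarantee_appendBit (γ := γ) _ u e).seq fun x hx => ?_
      rw [dyadicMean_add _ (3 * k) 1]
      exact (guarantee_appendBit _ x e).mono (fun y hy => ((hu.trans hx).trans hy).mono le_rfl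
        le_rfl (by norm_num)) (fun _ _ => le_rfl) le_rfl
    refine hbits.mono (fun u hu => ⟨by rw [hu.reg 9 (by norm_num), hsize],
      (hW'.trans (hu.mono (by norm_num) le_rfl le_rfl)).mono le_rfl le_rfl (by norm_num)⟩)
      (fun _ _ => le_rfl) (le_of_eq ?_)
    rw [h10', show 3 * (k + 1) = 3 * k + 1 + 1 + 1 by ring]

/-! ### Random sets -/

/-- The mean of `ψ` over the sets obtained from `X` by adding each of the first `k` elements
independently with probability `T / M`. -/
noncomputable def thin (T M : ℕ) (ψ : Finset (Fin n) → ℝ≥0∞) : ℕ → Finset (Fin n) → ℝ≥0∞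
  | 0, X => ψ X
  | k + 1, X => (T * thin T M ψ k (X ∪ State.element n k) + (M - T : ℕ) * thin T M ψ k X) / M

theorem sum_range_ite (T M : ℕ) (x y : ℝ≥0∞) :
    ∑ u ∈ Finset.range M, (if u < T then x else y) =
      (min T M : ℕ) * x + (M - min T M : ℕ) * y := by
  rcases le_total T M with h | h
  · obtain ⟨D, rfl⟩ := Nat.exists_eq_add_of_le h
    rw [min_eq_left h, Finset.sum_range_add, Nat.add_sub_cancel_left,
      Finset.sum_congr rfl fun u hu => if_pos (Finset.mem_range.1 hu),
      Finset.sum_congr rfl (g := fun _ => y) fun u _ => if_neg (by omega)]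
    simp
  · rw [min_eq_right h, Finset.sum_congr rfl fun u hu =>
      if_pos ((Finset.mem_range.1 hu).trans_le h)]
    simp

/-- Add the elements below the content of number register `8` to set register `1`, each with
probability `T / 8 ^ Nat.size n`, where `T` is the content of number register `7`. -/
def sampleLoop (ι : Type) : Prog ι :=
  .loop 8 <| .seq (.instr (.sub 8 8 1)) <| .seq (draw ι) <| .seq (.instr (.sub 12 7 10)) <|
    .cond 12 (.instr (.insert 1 8)) (.instr (.const 12 0))

/-- The `min` appears because a drawn number is always below `8 ^ Nat.size n`, whereas the content
of register `7` is arbitrary here. -/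
theorem guarantee_sampleLoop (hn : s.reg 0 = n) (ho : s.reg 1 = 1) (hz : s.reg 2 = 0)
    (ψ : Finset (Fin n) → ℝ≥0∞) :
    Guarantee O (sampleLoop ι) s (Within γ 8 1 (s.reg 8 * (11 * n + 8) + 1) s)
      (fun t => ψ (t.sets 1)) (thin (min (s.reg 7) (8 ^ Nat.size n)) (8 ^ Nat.size n) ψ (s.reg 8) (s.sets 1)) := by
  set T := s.reg 7 with hTdef
  set M := 8 ^ Nat.size n with hM
  have := Guarantee.loop (O := O) (γ := γ) (r := 8) (a := 8) (e := 1) (κ := 11 * n + 7)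
    (p := .seq (.instr (.sub 8 8 1)) <| .seq (draw ι) <| .seq (.instr (.sub 12 7 10)) <|
      .cond 12 (.instr (.insert 1 8)) (.instr (.const 12 0)))
    (inv := fun k t => t.reg 8 = k ∧ t.reg 0 = n ∧ t.reg 1 = 1 ∧ t.reg 2 = 0 ∧ t.reg 7 = T)
    (G := fun k t => thin (min T M) M ψ k (t.sets 1)) (g := fun t => ψ (t.sets 1))
    (fun t ht => ht.1) ?_ (fun _ h => h) (fun _ _ => le_rfl) (s.reg 8) s ⟨rfl, hn, ho, hz, rfl⟩
  · exact this.mono (fun t ht => ht.2.mono le_rfl le_rfl (by linarith)) (fun _ _ => le_rfl) le_rfl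
  · rintro k t ⟨h8, h0, h1, h2, h7⟩
    refine ⟨by omega, Guarantee.instr_seq rfl ?_⟩
    set t' := ((t.tick 1).setReg 8 ((t.tick 1).reg 8 - (t.tick 1).reg 1)).tick 1 with ht'
    have ht8 : t'.reg 8 = k := by simp [ht', State.setReg_reg, h8, h1]
    have ht0 : t'.reg 0 = n := by simp [ht', State.setReg_reg, h0]
    have ht1 : t'.reg 1 = 1 := by simp [ht', State.setReg_reg, h1]
    have ht2 : t'.reg 2 = 0 := by simp [ht', State.setReg_reg, h2]
    have ht7 : t'.reg 7 = T := by simp [ht', State.setReg_reg, h7]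
    have hts : t'.sets = t.sets := by simp [ht']
    have hW : Within γ 8 1 1 (t.tick 1) t' := by
      constructor
      · intro i hi
        have h1 : i ≠ 8 := by omega
        simp [ht', State.setReg_reg, h1]
      · simp [ht']
      · simp [ht']
    have hd := guarantee_draw (O := O) (γ := γ) ht0 ht2 (fun u => if u < T then
      thin (min T M) M ψ k (t.sets 1 ∪ State.element n k) else
        thin (min T M) M ψ k (t.sets 1)) 2
    rw [sum_range_ite] at hd
    refine (Guarantee.seq hd fun u hu => ?_).mono (Q := fun u => Within γ 8 1 (11 * n + 6) t' u ∧
      u.reg 8 = k) (fun u hu => ?_) (fun _ _ => le_rfl) (le_of_eq ?_)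
    · have hu8 : u.reg 8 = k := (hu.reg 8 (by norm_num)).trans ht8
      have hu7 : u.reg 7 = T := (hu.reg 7 (by norm_num)).trans ht7
      have hus : u.sets 1 = t.sets 1 := (hu.sets 1 (by norm_num)).trans (by rw [hts])
      refine Guarantee.instr_seq rfl ?_
      -- Truncated subtraction makes the branch register nonzero exactly when the drawn number is
      -- below `T`.
      have hreg : ((u.setReg 12 (u.reg 7 - u.reg 10)).tick 1).reg 12 = T - u.reg 10 := by
        simp [State.setReg_reg, hu7]
      by_cases hlt : u.reg 10 < T
      · refine Guarantee.cond_true (by rw [hreg]; omega) (Guarantee.instr rfl ⟨?_, ?_⟩ ?_)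
        · constructor
          · intro i hi
            have h1 : i ≠ 12 := by omega
            simp [State.setReg_reg, h1, hu.reg i (by omega)]
          · intro i hi
            have h1 : i ≠ 1 := by omega
            simp [State.setSet_sets, h1, hu.sets i (by omega)]
          · simp
            linarith [hu.cost]
        · simp [State.setReg_reg, hu8]
        · simp [State.setReg_reg, State.setSet_sets, hlt, hu8, hus]
      · refine Guarantee.cond_false (by rw [hreg]; omega) (Guarantee.instr rfl ⟨?_, ?_⟩ ?_)
        · constructor
          · intro i hi
            have h1 : i ≠ 12 := by omega
            simp [State.setReg_reg, h1, hu.reg i (by omega)]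
          · intro i hi
            simp [hu.sets i (by omega)]
          · simp
            linarith [hu.cost]
        · simp [State.setReg_reg, hu8]
        · simp [hlt, hus]
    · obtain ⟨hu, hu8⟩ := hu
      refine ⟨⟨hu8, ?_, ?_, ?_, ?_⟩, (hW.trans hu).mono le_rfl le_rfl (by linarith)⟩
      · rw [hu.reg 0 (by norm_num), ht0]
      · rw [hu.reg 1 (by norm_num), ht1]
      · rw [hu.reg 2 (by norm_num), ht2]
      · rw [hu.reg 7 (by norm_num), ht7]
    · simp only [thin, hM, Nat.cast_pow, Nat.cast_ofNat]

/-- The mean of `ψ` over a random set, where the inclusion probability is also random. -/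
noncomputable def sampleMean (ψ : Finset (Fin n) → ℝ≥0∞) : ℝ≥0∞ :=
  (∑ T ∈ Finset.range (8 ^ Nat.size n), thin T (8 ^ Nat.size n) ψ n ∅) / 8 ^ Nat.size n

/-- Let set register `1` be a random set. -/
def sample (ι : Type) : Prog ι :=
  .seq (draw ι) <| .seq (.instr (.add 7 10 2)) <| .seq (.instr (.clear 1)) <|
    .seq (.instr (.add 8 0 2)) (sampleLoop ι)

theorem guarantee_sample (hn : s.reg 0 = n) (ho : s.reg 1 = 1) (hz : s.reg 2 = 0)
    (ψ : Finset (Fin n) → ℝ≥0∞) :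
    Guarantee O (sample ι) s (Within γ 7 1 (20 * (n + 1) ^ 2) s)
      (fun t => ψ (t.sets 1)) (sampleMean ψ) := by
  have hd := guarantee_draw (O := O) (γ := γ) hn hz
    (fun T => thin (min T (8 ^ Nat.size n)) (8 ^ Nat.size n) ψ n ∅) 1
  -- The threshold is itself drawn below `8 ^ Nat.size n`, so the `min` disappears.
  rw [Finset.sum_congr rfl fun T hT => by rw [min_eq_left (Finset.mem_range.1 hT).le]] at hd
  refine Guarantee.seq hd fun t ht => ?_
  have h0 : t.reg 0 = n := (ht.reg 0 (by norm_num)).trans hn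
  have h1 : t.reg 1 = 1 := (ht.reg 1 (by norm_num)).trans ho
  have h2 : t.reg 2 = 0 := (ht.reg 2 (by norm_num)).trans hz
  refine Guarantee.instr_seq rfl (Guarantee.instr_seq rfl (Guarantee.instr_seq rfl ?_))
  refine (guarantee_sampleLoop (γ := γ) ?_ ?_ ?_ ψ).mono (fun u hu => ⟨fun i hi => ?_,
    fun i hi => ?_, ?_⟩) (fun _ _ => le_rfl) (le_of_eq ?_)
  · simp [State.setReg_reg, h0]
  · simp [State.setReg_reg, h1]
  · simp [State.setReg_reg, h2]
  · have h3 : i ≠ 7 := by omega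
    have h4 : i ≠ 8 := by omega
    simp [hu.reg i (by omega), State.setReg_reg, h3, h4, ht.reg i (by omega)]
  · obtain rfl : i = 0 := by omega
    simp [hu.sets 0 (by omega), State.setSet_sets, ht.sets 0 (by omega)]
  · have h3 := hu.cost
    have h4 := ht.cost
    simp [State.setReg_reg, h0, h2] at h3
    nlinarith
  · simp [State.setReg_reg, State.setSet_sets, h0, h2]

end Sampling

/-! ### The distribution of the random sets -/

section

variable {n : ℕ}

theorem thin_eq_sum (T M : ℕ) (ψ : Finset (Fin n) → ℝ≥0∞) {k : ℕ} (hk : k ≤ n)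
    (X : Finset (Fin n)) :
    thin T M ψ k X = ∑ Y ∈ (Finset.univ.filter fun i : Fin n => (i : ℕ) < k).powerset,
      (T / M : ℝ≥0∞) ^ Y.card * ((M - T : ℕ) / M : ℝ≥0∞) ^ (k - Y.card) * ψ (X ∪ Y) := by
  induction k generalizing X with
  | zero => simp [thin]
  | succ k ih =>
    have hkn : k < n := hk
    have hel : State.element n k = {⟨k, hkn⟩} := by
      ext i
      simp [State.element, Fin.ext_iff]
    have hins : (Finset.univ.filter fun i : Fin n => (i : ℕ) < k + 1) =
        insert ⟨k, hkn⟩ (Finset.univ.filter fun i : Fin n => (i : ℕ) < k) := by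
      ext i
      simp only [Finset.mem_filter, Finset.mem_univ, true_and, Finset.mem_insert, Fin.ext_iff]
      omega
    have hnot : (⟨k, hkn⟩ : Fin n) ∉ Finset.univ.filter fun i : Fin n => (i : ℕ) < k := by simp
    rw [thin, ih hkn.le, ih hkn.le, hins, Finset.sum_powerset_insert hnot, add_comm,
      ENNReal.add_div, Finset.mul_sum, Finset.mul_sum, hel]
    simp_rw [div_eq_mul_inv]
    rw [Finset.sum_mul, Finset.sum_mul]
    congr 1
    · refine Finset.sum_congr rfl fun Y hY => ?_
      have hYk : Y.card ≤ k := by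
        have := Finset.card_le_card (Finset.mem_powerset.1 hY)
        rw [Fin.card_filter_val_lt] at this
        exact this.trans (min_le_right _ _)
      rw [Nat.succ_sub hYk, pow_succ]
      ring
    · refine Finset.sum_congr rfl fun Y hY => ?_
      have hYk : (⟨k, hkn⟩ : Fin n) ∉ Y := fun h => hnot (Finset.mem_powerset.1 hY h)
      rw [Finset.card_insert_of_notMem hYk, Nat.add_sub_add_right, pow_succ,
        Finset.union_assoc, ← Finset.insert_eq]
      ring

theorem thin_empty (T M : ℕ) (ψ : Finset (Fin n) → ℝ≥0∞) :
    thin T M ψ n ∅ = ∑ Y, (T / M : ℝ≥0∞) ^ Y.card * ((M - T : ℕ) / M : ℝ≥0∞) ^ (n - Y.card) *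
      ψ Y := by
  rw [thin_eq_sum T M ψ le_rfl, Finset.filter_true_of_mem fun i _ => i.2, Finset.powerset_univ]
  simp only [Finset.empty_union]

/-- The indicator function of a family of sets. -/
noncomputable def indicator (Z : Finset (Finset (Fin n))) (X : Finset (Fin n)) : ℝ≥0∞ :=
  if X ∈ Z then 1 else 0

/-- A given threshold is drawn with probability `1 / 8 ^ Nat.size n`, so this keeps the loss
polynomial. -/
theorem eight_pow_size_le (n : ℕ) : (8 : ℝ) ^ Nat.size n ≤ 8 * (n + 1) ^ 3 := by
  have h1 : 2 ^ Nat.size n ≤ 2 * (n + 1) := by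
    rcases Nat.eq_zero_or_pos n with rfl | hn
    · simp
    · have h2 : Nat.size n - 1 < Nat.size n := by
        have := Nat.size_pos.2 hn
        omega
      have h3 := Nat.lt_size.1 h2
      calc 2 ^ Nat.size n = 2 ^ (Nat.size n - 1) * 2 := by
            rw [← pow_succ]; congr 1; omega
        _ ≤ _ := by omega
  have h2 : (2 : ℝ) ^ Nat.size n ≤ 2 * (n + 1) := by exact_mod_cast h1
  calc (8 : ℝ) ^ Nat.size n = (2 ^ Nat.size n) ^ 3 := by
        rw [← pow_mul, mul_comm, pow_mul]; norm_num
    _ ≤ (2 * (n + 1)) ^ 3 := by gcongr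
    _ = _ := by ring

/-- The precision that `exists_threshold` asks for. Two random bits per binary digit of `n` could
fall short: `16 < 18` at `n = 3`. -/
theorem two_mul_sq_le (n : ℕ) : 2 * n ^ 2 ≤ 8 ^ Nat.size n := by
  have h1 : n + 1 ≤ 2 ^ Nat.size n := Nat.lt_size_self n
  calc 2 * n ^ 2 ≤ (n + 1) ^ 3 := by nlinarith [Nat.zero_le (n ^ 3), Nat.zero_le (n ^ 2)]
    _ ≤ (2 ^ Nat.size n) ^ 3 := Nat.pow_le_pow_left h1 3
    _ = 8 ^ Nat.size n := by rw [← pow_mul, mul_comm, pow_mul]; norm_num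

/-- A family of sets of equal size has about the largest possible probability to be hit. -/
theorem le_sampleMean {t : ℕ} (ht : t < n) (Z : Finset (Finset (Fin n)))
    (hZ : ∀ X ∈ Z, X.card = t) :
    ENNReal.ofReal (Z.card / (16 * (n + 1) ^ 4 * n.choose t)) ≤ sampleMean (indicator Z) := by
  obtain ⟨T, hT, hp⟩ := exists_threshold ht (two_mul_sq_le n)
  have hM := eight_pow_size_le n
  have hM0 : 0 < 8 ^ Nat.size n := by positivity
  unfold sampleMean
  have h8 : (8 : ℝ≥0∞) ^ Nat.size n = ENNReal.ofReal (8 ^ Nat.size n) := by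
    rw [ENNReal.ofReal_pow (by norm_num)]; norm_num
  have h8' : ((8 ^ Nat.size n : ℕ) : ℝ) = 8 ^ Nat.size n := by push_cast; rfl
  rw [h8]
  -- Of all thresholds only the favourable one is retained.
  refine le_trans ?_ (ENNReal.div_le_div_right
    (Finset.single_le_sum (f := fun T => thin T (8 ^ Nat.size n) (indicator Z) n ∅)
      (fun _ _ => zero_le) (Finset.mem_range.2 hT)) _)
  generalize 8 ^ Nat.size n = M at *
  have hMr : (0 : ℝ) < M := by exact_mod_cast hM0
  rw [← h8', thin_empty]
  have hTM : (T : ℝ≥0∞) / M = ENNReal.ofReal (T / M) := by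
    rw [ENNReal.ofReal_div_of_pos hMr, ENNReal.ofReal_natCast, ENNReal.ofReal_natCast]
  have hTM' : ((M - T : ℕ) : ℝ≥0∞) / M = ENNReal.ofReal ((M - T) / M) := by
    rw [ENNReal.ofReal_div_of_pos hMr, ← Nat.cast_sub hT.le, ENNReal.ofReal_natCast,
      ENNReal.ofReal_natCast]
  have hTM0 : (0 : ℝ) ≤ (M - T) / M := by
    have : (T : ℝ) ≤ M := by exact_mod_cast hT.le
    exact div_nonneg (by linarith) hMr.le
  have hsum : ENNReal.ofReal (Z.card * ((T / M : ℝ) ^ t * ((M - T) / M : ℝ) ^ (n - t))) ≤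
      ∑ Y, (T / M : ℝ≥0∞) ^ Y.card * ((M - T : ℕ) / M : ℝ≥0∞) ^ (n - Y.card) * indicator Z Y := by
    simp only [indicator, mul_ite, mul_one, mul_zero]
    rw [← Finset.sum_filter, Finset.filter_mem_eq_inter, Finset.univ_inter,
      Finset.sum_congr rfl (g := fun _ =>
        ENNReal.ofReal ((T / M : ℝ) ^ t * ((M - T) / M : ℝ) ^ (n - t))) fun Y hY => ?_,
      Finset.sum_const, nsmul_eq_mul, ENNReal.ofReal_mul (Nat.cast_nonneg _),
      ENNReal.ofReal_natCast]
    rw [hZ Y hY, hTM, hTM', ENNReal.ofReal_mul (by positivity), ENNReal.ofReal_pow (by positivity),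
      ENNReal.ofReal_pow hTM0]
  refine le_trans ?_ (ENNReal.div_le_div_right hsum _)
  rw [← ENNReal.ofReal_div_of_pos hMr]
  refine ENNReal.ofReal_le_ofReal ?_
  have hpos : 0 ≤ (T / M : ℝ) ^ t * ((M - T) / M : ℝ) ^ (n - t) := by positivity
  generalize (T / M : ℝ) ^ t * ((M - T) / M : ℝ) ^ (n - t) = r at *
  have hch : (0 : ℝ) < n.choose t := by exact_mod_cast Nat.choose_pos ht.le
  rw [div_le_div_iff₀ (by positivity) hMr]
  have h1 : (M : ℝ) ≤ 8 * (n + 1) ^ 3 := by rw [h8']; exact hM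
  calc (Z.card : ℝ) * M ≤ Z.card * (8 * (n + 1) ^ 3) := by gcongr
    _ ≤ Z.card * (8 * (n + 1) ^ 3) * (2 * (n + 1) * n.choose t * r) :=
      le_mul_of_one_le_right (by positivity) hp
    _ = _ := by ring

/-- Take `ℓ = |P| - x` and the `t`-sets that meet `P` in `x` elements; `t ≤ β x` becomes the size
condition. The sixth power collects two factors from `exists_sample_size` and four from
`le_sampleMean`. The bound on `c ^ ℓ`, which makes the stated probability at most one, comes from
`|Z| ≤ n.choose t`. -/
theorem Parameters.exists_sample_family {β c d b w : ℝ} (h : Parameters β c d b w) :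
    ∃ E : ℝ, 0 < E ∧ ∀ (n : ℕ) (P : Finset (Fin n)), β * P.card < n →
      ∃ (ℓ : ℕ) (Z : Finset (Finset (Fin n))), ℓ ≤ n ∧ c ^ ℓ ≤ E * (n + 1) ^ 6 * d ^ n ∧
        (∀ X ∈ Z, (P \ X).card ≤ ℓ ∧ X.card + β * ℓ ≤ β * P.card) ∧
        ENNReal.ofReal (c ^ ℓ / (E * (n + 1) ^ 6 * d ^ n)) ≤ sampleMean (indicator Z) := by
  obtain ⟨E, hE, hs⟩ := h.exists_sample_size
  refine ⟨16 * E, by positivity, fun n P hP => ?_⟩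
  obtain ⟨x, t, hxk, hxt, htx, htn, hle⟩ := hs n P.card hP
  have hkn : P.card ≤ n := by simpa using Finset.card_le_univ P
  have hd : 0 < d := one_pos.trans h.one_lt_d
  have hch : (0 : ℝ) < n.choose t := by exact_mod_cast Nat.choose_pos htn.le
  have hcard := choose_mul_choose_le_card P hxt
  set Z := Finset.univ.filter fun X : Finset (Fin n) => X.card = t ∧ (P ∩ X).card = x with hZ
  have hZt : ∀ X ∈ Z, X.card = t := fun X hX => (Finset.mem_filter.1 hX).2.1
  have hcard' : (P.card.choose x * (n - P.card).choose (t - x) : ℝ) ≤ Z.card := by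
    exact_mod_cast hcard
  have hle' : c ^ (P.card - x) * n.choose t ≤ E * (n + 1) ^ 2 * d ^ n * Z.card :=
    hle.trans (by gcongr)
  refine ⟨P.card - x, Z, (Nat.sub_le _ _).trans hkn, ?_, fun X hX => ?_, ?_⟩
  · have h1 : Z.card ≤ n.choose t := by
      refine (Finset.card_le_card fun X hX => Finset.mem_powersetCard.2
        ⟨Finset.subset_univ X, hZt X hX⟩).trans (le_of_eq ?_)
      rw [Finset.card_powersetCard, Finset.card_univ, Fintype.card_fin]
    have h2 : (Z.card : ℝ) ≤ n.choose t := by exact_mod_cast h1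
    have h3 : c ^ (P.card - x) ≤ E * (n + 1) ^ 2 * d ^ n :=
      le_of_mul_le_mul_right (hle'.trans (by gcongr)) hch
    refine h3.trans ?_
    have h4 : ((n : ℝ) + 1) ^ 2 ≤ (n + 1) ^ 6 :=
      pow_le_pow_right₀ (by linarith [Nat.cast_nonneg (α := ℝ) n]) (by norm_num)
    have h5 : E ≤ 16 * E := by linarith
    gcongr
  · obtain ⟨h1, h2⟩ := (Finset.mem_filter.1 hX).2
    refine ⟨?_, ?_⟩
    · have := Finset.card_sdiff_add_card_inter P X
      omega
    · rw [h1, Nat.cast_sub hxk]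
      linarith
  · refine le_trans (ENNReal.ofReal_le_ofReal ?_) (le_sampleMean htn Z hZt)
    rw [div_le_div_iff₀ (by positivity) (by positivity)]
    calc c ^ (P.card - x) * (16 * (n + 1) ^ 4 * n.choose t)
        = 16 * (n + 1) ^ 4 * (c ^ (P.card - x) * n.choose t) := by ring
      _ ≤ 16 * (n + 1) ^ 4 * (E * (n + 1) ^ 2 * d ^ n * Z.card) := by gcongr
      _ = _ := by ring

end

/-! ### A single trial and its repetition -/

section Trial

variable {ι : Type} {n : ℕ} {O : ι → Oracle n} {γ : ι → ℝ} {s : State ι n}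

/-- Replace set register `0` by the union of set registers `1` and `2` if that is smaller. -/
def keepSmaller (ι : Type) : Prog ι :=
  .seq (.instr (.union 2 2 1)) <| .seq (.instr (.card 11 2)) <| .seq (.instr (.card 12 0)) <|
    .seq (.instr (.sub 12 12 11)) <| .cond 12 (.instr (.union 0 2 2)) (.instr (.const 12 0))

theorem surely_keepSmaller : Surely O (keepSmaller ι) s fun t =>
    Within γ 7 0 (4 * (n + 1) + 3) s t ∧ t.sets 0 =
      if (s.sets 2 ∪ s.sets 1).card < (s.sets 0).card then s.sets 2 ∪ s.sets 1 else s.sets 0 := by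
  refine Guarantee.instr_seq rfl (Guarantee.instr_seq rfl (Guarantee.instr_seq rfl
    (Guarantee.instr_seq rfl ?_)))
  split_ifs with hlt
  · refine Guarantee.cond_true ?_ (Guarantee.instr rfl ⟨⟨fun i hi => ?_, by simp, ?_⟩, ?_⟩ le_rfl)
    · simp [State.setReg_reg, State.setSet_sets]
      omega
    · have h1 : i ≠ 11 := by omega
      have h2 : i ≠ 12 := by omega
      simp [State.setReg_reg, h1, h2]
    · simp
      linarith
    · simp [State.setSet_sets]
  · refine Guarantee.cond_false ?_ (Guarantee.instr rfl ⟨⟨fun i hi => ?_, by simp, ?_⟩, ?_⟩ le_rfl)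
    · simp [State.setReg_reg, State.setSet_sets]
      omega
    · have h1 : i ≠ 11 := by omega
      have h2 : i ≠ 12 := by omega
      simp [State.setReg_reg, h1, h2]
    · simp
      linarith
    · simp [State.setSet_sets]

/-- Query the oracle on a random set. -/
def trial (j : ι) : Prog ι :=
  .seq (sample ι) <| .seq (.instr (.query j 2 1 4)) (keepSmaller ι)

/-- Whether a set has at most `ρ` elements. -/
noncomputable def small (ρ : ℝ) (S : Finset (Fin n)) : ℝ≥0∞ := if (S.card : ℝ) ≤ ρ then 1 else 0

theorem small_mono {ρ : ℝ} {S T : Finset (Fin n)} (h : S.card ≤ T.card) :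
    small ρ T ≤ small ρ S := by
  unfold small
  have h' : (S.card : ℝ) ≤ T.card := by exact_mod_cast h
  split_ifs with h1 h2
  · exact le_rfl
  · exact absurd (h'.trans h1) h2
  · exact zero_le
  · exact le_rfl

theorem half_le_sum_small {ρ : ℝ} {m : ℕ} {f : (Fin m → Bool) → Finset (Fin n)}
    (h : (1 / 2 : ℝ) * 2 ^ m ≤ Set.ncard {r | ((f r).card : ℝ) ≤ ρ}) :
    1 / 2 ≤ (∑ r, small ρ (f r)) / 2 ^ m := by
  classical
  have h1 : ∑ r, small ρ (f r) = (Set.ncard {r | ((f r).card : ℝ) ≤ ρ} : ℝ≥0∞) := by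
    simp only [small]
    rw [Finset.sum_boole, Set.ncard_eq_toFinset_card', Set.toFinset_ofPred]
  rw [h1, ENNReal.le_div_iff_mul_le (by simp) (by simp), ← ENNReal.ofReal_natCast]
  refine le_trans (le_of_eq ?_) (ENNReal.ofReal_le_ofReal h)
  rw [ENNReal.ofReal_mul (by norm_num), ENNReal.ofReal_pow (by norm_num),
    ENNReal.ofReal_div_of_pos (by norm_num)]
  simp

/-- The best solution never gets worse, which gives the first entry of the maximum. The second is
the chance that the sample lies in `Z` and the oracle then succeeds, which it does for at least half
of its strings. -/
theorem guarantee_trial {j : ι} {F : Set (Finset (Fin n))} {ρ : ℝ} {Z : Finset (Finset (Fin n))}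
    (hn : s.reg 0 = n) (ho : s.reg 1 = 1) (hz : s.reg 2 = 0) (hF : s.sets 0 ∈ F)
    (hO : ∀ X ℓ r, (O j).answer X ℓ r ∪ X ∈ F)
    (hZ : ∀ X ∈ Z, (1 / 2 : ℝ) * 2 ^ (O j).bits ≤
      Set.ncard {r | (((O j).answer X (s.reg 4) r ∪ X).card : ℝ) ≤ ρ}) :
    Guarantee O (trial j) s
      (fun t => t.sets 0 ∈ F ∧ Within γ 7 0 (27 * (n + 1) ^ 2 + γ j ^ s.reg 4) s t)
      (fun t => small ρ (t.sets 0)) (max (small ρ (s.sets 0)) (sampleMean (indicator Z) / 2)) := by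
  have key : Guarantee O (trial j) s
      (fun t => (t.sets 0 ∈ F ∧ Within γ 7 0 (27 * (n + 1) ^ 2 + γ j ^ s.reg 4) s t) ∧
        (t.sets 0).card ≤ (s.sets 0).card)
      (fun t => small ρ (t.sets 0)) (sampleMean (indicator Z) / 2) := by
    rw [ENNReal.div_eq_inv_mul, ← zero_add (2⁻¹ * _)]
    refine ((guarantee_sample (O := O) (γ := γ) hn ho hz (indicator Z)).affine 0 2⁻¹).seq
      fun t ht => ?_
    have ht4 : t.reg 4 = s.reg 4 := ht.reg 4 (by norm_num)
    have ht0 : t.sets 0 = s.sets 0 := ht.sets 0 (by norm_num)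
    refine Guarantee.seq (Q := fun u => (u.sets 0 = s.sets 0 ∧ u.sets 2 ∪ u.sets 1 ∈ F) ∧
      Within γ 7 0 (γ j ^ s.reg 4) t u) (g := fun u => small ρ (u.sets 2 ∪ u.sets 1))
      (Guarantee.query (fun r => ⟨⟨?_, ?_⟩, ⟨?_, by simp, ?_⟩⟩) ?_) fun u hu => ?_
    · simp [State.setSet_sets, ht0]
    · simpa [State.setSet_sets] using hO _ _ r
    · simp
    · simp [ht4]
    · simp only [State.record_sets, State.setSet_sets, if_true, OfNat.one_ne_ofNat, if_false,
        ht4]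
      by_cases hX : t.sets 1 ∈ Z
      · simpa [indicator, hX] using half_le_sum_small (hZ _ hX)
      · simp [indicator, hX]
    · obtain ⟨⟨hu0, huF⟩, huW⟩ := hu
      refine (surely_keepSmaller (γ := γ)).guarantee (v := small ρ (u.sets 2 ∪ u.sets 1))
        (fun v hv => small_mono ?_) |>.mono (fun v hv => ⟨⟨?_, ?_⟩, ?_⟩) (fun _ _ => le_rfl) le_rfl
      · rw [hv.2]
        split_ifs <;> omega
      · rw [hv.2]
        split_ifs
        · exact huF
        · rw [hu0]; exact hF
      · refine (((ht.mono le_rfl (Nat.zero_le _) le_rfl).trans huW).trans hv.1).mono le_rfl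
          le_rfl ?_
        have : (0 : ℝ) ≤ n := Nat.cast_nonneg _
        nlinarith
      · rw [hv.2, ← hu0]
        split_ifs <;> omega
  rcases le_total (small ρ (s.sets 0)) (sampleMean (indicator Z) / 2) with h | h
  · rw [max_eq_right h]
    exact key.mono (fun _ h => h.1) (fun _ _ => le_rfl) le_rfl
  · rw [max_eq_left h]
    exact (key.surely.guarantee (g := fun t => small ρ (t.sets 0)) fun t ht =>
      small_mono ht.2).mono (fun _ h => h.1) (fun _ _ => le_rfl) le_rfl

/-- Carry out as many trials as number register `6` says. -/
def repeatTrial (j : ι) : Prog ι := .loop 6 <| .seq (.instr (.sub 6 6 1)) (trial j)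

theorem sum_range_pow_mul_add {p q : ℝ≥0∞} (hpq : p + q = 1) (k : ℕ) :
    ∑ i ∈ Finset.range k, q ^ i * p + q ^ k = 1 := by
  induction k with
  | zero => simp
  | succ k ih =>
    rw [Finset.sum_range_succ, pow_succ, add_assoc, ← mul_add, hpq, mul_one, ih]

/-- With `q` the failure probability of one trial, the geometric sum is `1 - q ^ N`, written without
subtraction. -/
theorem guarantee_repeatTrial {j : ι} {F : Set (Finset (Fin n))} {ρ : ℝ}
    {Z : Finset (Finset (Fin n))} {p q : ℝ≥0∞} (hpq : p + q = 1)
    (hp : p ≤ sampleMean (indicator Z) / 2)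
    (hn : s.reg 0 = n) (ho : s.reg 1 = 1) (hz : s.reg 2 = 0) (hF : s.sets 0 ∈ F)
    (hO : ∀ X ℓ r, (O j).answer X ℓ r ∪ X ∈ F)
    (hZ : ∀ X ∈ Z, (1 / 2 : ℝ) * 2 ^ (O j).bits ≤
      Set.ncard {r | (((O j).answer X (s.reg 4) r ∪ X).card : ℝ) ≤ ρ}) :
    Guarantee O (repeatTrial j) s
      (fun t => t.sets 0 ∈ F ∧
        Within γ 6 0 (s.reg 6 * (27 * (n + 1) ^ 2 + γ j ^ s.reg 4 + 2) + 1) s t)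
      (fun t => small ρ (t.sets 0))
      (∑ i ∈ Finset.range (s.reg 6), q ^ i * p + q ^ s.reg 6 * small ρ (s.sets 0)) := by
  have := Guarantee.loop (O := O) (γ := γ) (r := 6) (a := 6) (e := 0)
    (κ := 27 * (n + 1) ^ 2 + γ j ^ s.reg 4 + 1) (p := .seq (.instr (.sub 6 6 1)) (trial j))
    (inv := fun k t => t.reg 6 = k ∧ t.reg 0 = n ∧ t.reg 1 = 1 ∧ t.reg 2 = 0 ∧
      t.reg 4 = s.reg 4 ∧ t.sets 0 ∈ F)
    (G := fun k t => ∑ i ∈ Finset.range k, q ^ i * p + q ^ k * small ρ (t.sets 0))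
    (g := fun t => small ρ (t.sets 0))
    (fun t ht => ht.1) ?_ (fun _ h => h) (fun _ _ => by simp) (s.reg 6) s
    ⟨rfl, hn, ho, hz, rfl, hF⟩
  · exact this.mono (fun t ht => ⟨ht.1.2.2.2.2.2, ht.2.mono le_rfl le_rfl (by linarith)⟩)
      (fun _ _ => le_rfl) le_rfl
  · rintro k t ⟨h6, h0, h1, h2, h4, htF⟩
    refine ⟨by omega, Guarantee.instr_seq rfl ?_⟩
    set t' := ((t.tick 1).setReg 6 ((t.tick 1).reg 6 - (t.tick 1).reg 1)).tick 1 with ht'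
    have hr : ∀ i, i ≠ 6 → t'.reg i = t.reg i := fun i hi => by simp [ht', State.setReg_reg, hi]
    have hr6 : t'.reg 6 = k := by simp [ht', State.setReg_reg, h6, h1]
    have hts : t'.sets = t.sets := by simp [ht']
    have hW : Within γ 6 0 1 (t.tick 1) t' :=
      ⟨fun i hi => hr i (by omega), by simp, by simp [ht']⟩
    have ht4 : t'.reg 4 = s.reg 4 := (hr 4 (by norm_num)).trans h4
    have htr := (guarantee_trial (s := t') (γ := γ) (O := O) (j := j) (F := F) (ρ := ρ) (Z := Z)
      (by rw [hr 0 (by norm_num), h0]) (by rw [hr 1 (by norm_num), h1])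
      (by rw [hr 2 (by norm_num), h2]) (by rw [hts]; exact htF) hO
      (by rw [ht4]; exact hZ)).affine (∑ i ∈ Finset.range k, q ^ i * p) (q ^ k)
    refine htr.mono (fun u hu => ⟨⟨?_, ?_, ?_, ?_, ?_, hu.1⟩, ?_⟩) (fun _ _ => le_rfl) ?_
    · rw [hu.2.reg 6 (by norm_num), hr6]
    · rw [hu.2.reg 0 (by norm_num), hr 0 (by norm_num), h0]
    · rw [hu.2.reg 1 (by norm_num), hr 1 (by norm_num), h1]
    · rw [hu.2.reg 2 (by norm_num), hr 2 (by norm_num), h2]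
    · rw [hu.2.reg 4 (by norm_num), ht4]
    · have := hW.trans (hu.2.mono (by norm_num) le_rfl le_rfl)
      rw [ht4] at this
      exact this.mono le_rfl le_rfl (by linarith)
    -- What remains is `p + q * small ≤ max small (sampleMean / 2)`: equality with `1` if the
    -- current set is already small, and the hypothesis on `p` otherwise.
    · rw [Finset.sum_range_succ, pow_succ, add_assoc, mul_assoc, ← mul_add, hts]
      gcongr
      unfold small
      split_ifs with hs
      · rw [mul_one, hpq]
        exact le_max_left _ _
      · rw [mul_zero, add_zero]
        exact hp.trans (le_max_right _ _)

end Trial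

/-! ### The algorithm -/

section Algorithm

variable {ι : Type} {n : ℕ} {O : ι → Oracle n} {γ : ι → ℝ} {s : State ι n}

/-- Carry out the instruction `i` as often as the number `m` says, and then `q`. -/
def Prog.iterate (i : Instr ι) : ℕ → Prog ι → Prog ι
  | 0, q => q
  | m + 1, q => .seq (.instr i) (Prog.iterate i m q)

/-- Multiply number register `3` by the constant `m`. -/
def multiply (ι : Type) (m : ℕ) : Prog ι :=
  .seq (.instr (.const 7 0)) (Prog.iterate (.add 7 7 3) m (.instr (.add 3 7 2)))

theorem surely_iterate_add (m : ℕ) (s : State ι n) (hz : s.reg 2 = 0) :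
    Surely O (Prog.iterate (.add 7 7 3) m (.instr (.add 3 7 2))) s fun t => t.sets = s.sets ∧
      (∀ i, i ≠ 3 → i ≠ 7 → t.reg i = s.reg i) ∧ t.reg 3 = s.reg 7 + m * s.reg 3 ∧
      t.cost γ ≤ s.cost γ + (m + 1) := by
  induction m generalizing s with
  | zero =>
    refine Guarantee.instr rfl ⟨by simp, fun i h3 h7 => ?_, ?_, ?_⟩ le_rfl
    · simp [State.setReg_reg, h3]
    · simp [State.setReg_reg, hz]
    · simp
  | succ m ih =>
    refine Guarantee.instr_seq rfl ((ih _ (by simp [State.setReg_reg, hz])).mono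
      fun t ht => ⟨?_, fun i h3 h7 => ?_, ?_, ?_⟩)
    · simp [ht.1]
    · simp [ht.2.1 i h3 h7, State.setReg_reg, h7]
    · rw [ht.2.2.1]
      simp [State.setReg_reg]
      ring
    · have := ht.2.2.2
      simp at this
      push_cast
      linarith

theorem surely_multiply (m : ℕ) (hz : s.reg 2 = 0) :
    Surely O (multiply ι m) s fun t => t.sets = s.sets ∧
      (∀ i, i ≠ 3 → i ≠ 7 → t.reg i = s.reg i) ∧ t.reg 3 = m * s.reg 3 ∧
      t.cost γ ≤ s.cost γ + (m + 2) := by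
  refine Guarantee.instr_seq rfl ((surely_iterate_add (γ := γ) m _
    (by simp [State.setReg_reg, hz])).mono fun t ht => ⟨?_, fun i h3 h7 => ?_, ?_, ?_⟩)
  · simp [ht.1]
  · simp [ht.2.1 i h3 h7, State.setReg_reg, h7]
  · rw [ht.2.2.1]
    simp [State.setReg_reg]
  · have := ht.2.2.2
    simp at this
    linarith

/-- Let set register `0` be the universe. -/
def fill (ι : Type) : Prog ι :=
  .seq (.instr (.add 6 0 2)) <| .loop 6 <| .seq (.instr (.sub 6 6 1)) (.instr (.insert 0 6))

theorem surely_fill (hn : s.reg 0 = n) (ho : s.reg 1 = 1) (hz : s.reg 2 = 0) :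
    Surely O (fill ι) s fun t => t.sets 0 = Finset.univ ∧ Within γ 6 0 (3 * n + 2) s t := by
  refine Guarantee.instr_seq rfl ?_
  set s' := (s.setReg 6 (s.reg 0 + s.reg 2)).tick 1 with hs'
  have h6 : s'.reg 6 = n := by simp [hs', State.setReg_reg, hn, hz]
  have hW : Within γ 6 0 1 s s' := by
    refine ⟨fun i hi => ?_, by simp, by simp [hs']⟩
    have : i ≠ 6 := by omega
    simp [hs', State.setReg_reg, this]
  refine (Surely.loop (O := O) (γ := γ) (r := 6) (a := 6) (e := 0) (κ := 2)
    (p := .seq (.instr (.sub 6 6 1)) (.instr (.insert 0 6)))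
    (inv := fun k t => t.reg 6 = k ∧ t.reg 1 = 1 ∧ ∀ i : Fin n, k ≤ i → i ∈ t.sets 0)
    (fun t ht => ht.1) ?_ (fun _ h => h) n s' ⟨h6, by rw [hW.reg 1 (by norm_num), ho],
      fun i hi => absurd i.2 (by omega)⟩).mono fun t ht => ⟨?_, ?_⟩
  · rintro k t ⟨ht6, ht1, hts⟩
    refine ⟨by omega, Guarantee.instr_seq rfl (Guarantee.instr rfl
      ⟨⟨?_, ?_, fun i hi => ?_⟩, ⟨fun i hi => ?_, by simp, ?_⟩⟩ le_rfl)⟩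
    · simp [State.setReg_reg, ht6, ht1]
    · simp [State.setReg_reg, ht1]
    · rcases Nat.eq_or_lt_of_le hi with h | h
      · simp [State.setReg_reg, State.setSet_sets, State.element, ht6, ht1, h]
      · simp [State.setSet_sets, hts i h]
    · have : i ≠ 6 := by omega
      simp [State.setReg_reg, this]
    · simp
      linarith
  · exact Finset.eq_univ_of_forall fun i => ht.1.2.2 i (Nat.zero_le _)
  · exact (hW.trans ht.2).mono le_rfl le_rfl (by linarith)

/-- Let number register `3` be `K * A ^ n`. -/
def power (ι : Type) (K A : ℕ) : Prog ι :=
  .seq (.instr (.const 3 K)) <| .seq (.instr (.add 6 0 2)) <| .loop 6 <|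
    .seq (.instr (.sub 6 6 1)) (multiply ι A)

theorem surely_power (K A : ℕ) (hn : s.reg 0 = n) (ho : s.reg 1 = 1) (hz : s.reg 2 = 0) :
    Surely O (power ι K A) s fun t => (t.reg 3 = K * A ^ n ∧ t.reg 4 = s.reg 4) ∧
      Within γ 3 1 (n * (A + 4) + 3) s t := by
  refine Guarantee.instr_seq rfl (Guarantee.instr_seq rfl ?_)
  set s' := (((s.setReg 3 K).tick 1).setReg 6
    (((s.setReg 3 K).tick 1).reg 0 + ((s.setReg 3 K).tick 1).reg 2)).tick 1 with hs'
  have h3 : s'.reg 3 = K := by simp [hs', State.setReg_reg]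
  have h4 : s'.reg 4 = s.reg 4 := by simp [hs', State.setReg_reg]
  have h6 : s'.reg 6 = n := by simp [hs', State.setReg_reg, hn, hz]
  have hW : Within γ 3 1 2 s s' := by
    refine ⟨fun i hi => ?_, by simp [hs'], by simp [hs']; linarith⟩
    have h1 : i ≠ 6 := by omega
    have h2 : i ≠ 3 := by omega
    simp [hs', State.setReg_reg, h1, h2]
  refine (Surely.loop (O := O) (γ := γ) (r := 6) (a := 3) (e := 1) (κ := A + 3)
    (p := .seq (.instr (.sub 6 6 1)) (multiply ι A))
    (inv := fun k t => t.reg 6 = k ∧ t.reg 1 = 1 ∧ t.reg 2 = 0 ∧ t.reg 4 = s.reg 4 ∧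
      t.reg 3 * A ^ k = K * A ^ n)
    (fun t ht => ht.1) ?_ (fun _ h => h) n s' ⟨h6, by rw [hW.reg 1 (by norm_num), ho],
      by rw [hW.reg 2 (by norm_num), hz], h4, by rw [h3]⟩).mono fun t ht => ⟨⟨?_, ht.1.2.2.2.1⟩, ?_⟩
  · rintro k t ⟨ht6, ht1, ht2, ht4, ht3⟩
    refine ⟨by omega, Guarantee.instr_seq rfl ((surely_multiply (γ := γ) A
      (by simp [State.setReg_reg, ht2])).mono fun u hu =>
        ⟨⟨?_, ?_, ?_, ?_, ?_⟩, ⟨fun i hi => ?_, fun i _ => ?_, ?_⟩⟩)⟩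
    · simp [hu.2.1, State.setReg_reg, ht6, ht1]
    · simp [hu.2.1, State.setReg_reg, ht1]
    · simp [hu.2.1, State.setReg_reg, ht2]
    · simp [hu.2.1, State.setReg_reg, ht4]
    · rw [hu.2.2.1, ← ht3]
      simp [State.setReg_reg]
      ring
    · rw [hu.2.1 i (by omega) (by omega)]
      have : i ≠ 6 := by omega
      simp [State.setReg_reg, this]
    · rw [hu.1]
      simp
    · have := hu.2.2.2
      simp at this ⊢
      linarith
  · simpa using ht.1.2.2.2.2
  · exact (hW.trans ht.2).mono le_rfl le_rfl (by linarith)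

/-- Divide number register `6` by a power of `2 ^ σ`, with the exponent in number register `7`. -/
def shift (ι : Type) (σ : ℕ) : Prog ι :=
  .loop 7 <| .seq (.instr (.sub 7 7 1)) <| Prog.iterate (.half 6 6) σ (.instr (.const 8 0))

theorem surely_iterate_half (σ : ℕ) (s : State ι n) :
    Surely O (Prog.iterate (.half 6 6) σ (.instr (.const 8 0))) s fun t => t.sets = s.sets ∧
      (∀ i, i ≠ 6 → i ≠ 8 → t.reg i = s.reg i) ∧ t.reg 6 = s.reg 6 / 2 ^ σ ∧
      t.cost γ ≤ s.cost γ + (σ + 1) := by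
  induction σ generalizing s with
  | zero =>
    refine Guarantee.instr rfl ⟨by simp, fun i h6 h8 => ?_, ?_, ?_⟩ le_rfl
    · simp [State.setReg_reg, h8]
    · simp [State.setReg_reg]
    · simp
  | succ m ih =>
    refine Guarantee.instr_seq rfl ((ih _).mono fun t ht => ⟨?_, fun i h6 h8 => ?_, ?_, ?_⟩)
    · simp [ht.1]
    · simp [ht.2.1 i h6 h8, State.setReg_reg, h6]
    · rw [ht.2.2.1]
      simp [State.setReg_reg, Nat.div_div_eq_div_mul, pow_succ']
    · have := ht.2.2.2
      simp at this
      push_cast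
      linarith

theorem surely_shift (σ : ℕ) (ho : s.reg 1 = 1) :
    Surely O (shift ι σ) s fun t => t.reg 6 = s.reg 6 / 2 ^ (σ * s.reg 7) ∧
      Within γ 6 1 (s.reg 7 * (σ + 3) + 1) s t := by
  refine (Surely.loop (O := O) (γ := γ) (r := 7) (a := 6) (e := 1) (κ := σ + 2)
    (p := .seq (.instr (.sub 7 7 1)) <| Prog.iterate (.half 6 6) σ (.instr (.const 8 0)))
    (inv := fun k t => t.reg 7 = k ∧ t.reg 1 = 1 ∧
      t.reg 6 / 2 ^ (σ * k) = s.reg 6 / 2 ^ (σ * s.reg 7))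
    (fun t ht => ht.1) ?_ (fun _ h => h) (s.reg 7) s ⟨rfl, ho, rfl⟩).mono
      fun t ht => ⟨?_, ht.2.mono le_rfl le_rfl (by linarith)⟩
  · rintro k t ⟨ht7, ht1, ht6⟩
    refine ⟨by omega, Guarantee.instr_seq rfl ((surely_iterate_half (γ := γ) σ _).mono fun u hu =>
        ⟨⟨?_, ?_, ?_⟩, ⟨fun i hi => ?_, fun i _ => ?_, ?_⟩⟩)⟩
    · simp [hu.2.1, State.setReg_reg, ht7, ht1]
    · simp [hu.2.1, State.setReg_reg, ht1]
    · rw [hu.2.2.1, ← ht6]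
      simp [State.setReg_reg, Nat.div_div_eq_div_mul, ← pow_add, Nat.mul_succ, Nat.add_comm]
    · rw [hu.2.1 i (by omega) (by omega)]
      have : i ≠ 7 := by omega
      simp [State.setReg_reg, this]
    · rw [hu.1]
      simp
    · have := hu.2.2.2
      simp at this ⊢
      linarith
  · simpa using ht.1.2.2

/-- All trials with the query parameter in number register `4`. -/
def searchRound (j : ι) (σ B : ℕ) : Prog ι :=
  .seq (.instr (.sub 5 5 1)) <| .seq (.instr (.add 6 3 2)) <| .seq (.instr (.add 7 0 4)) <|
    .seq (shift ι σ) <| .seq (repeatTrial j) <| .seq (multiply ι B) (.instr (.add 4 4 1))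

theorem guarantee_searchRound {j : ι} {σ B N : ℕ} {F : Set (Finset (Fin n))} {ρ : ℝ}
    {Z : Finset (Finset (Fin n))} {p q : ℝ≥0∞} (hpq : p + q = 1)
    (hp : p ≤ sampleMean (indicator Z) / 2)
    (hn : s.reg 0 = n) (ho : s.reg 1 = 1) (hz : s.reg 2 = 0) (hF : s.sets 0 ∈ F)
    (hO : ∀ X ℓ r, (O j).answer X ℓ r ∪ X ∈ F)
    (hZ : ∀ X ∈ Z, (1 / 2 : ℝ) * 2 ^ (O j).bits ≤
      Set.ncard {r | (((O j).answer X (s.reg 4) r ∪ X).card : ℝ) ≤ ρ})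
    (hN : N = s.reg 3 / 2 ^ (σ * (n + s.reg 4))) :
    Guarantee O (searchRound j σ B) s
      (fun t => (t.sets 0 ∈ F ∧ t.reg 5 = s.reg 5 - 1 ∧ t.reg 4 = s.reg 4 + 1 ∧
        t.reg 3 = B * s.reg 3) ∧
        Within γ 3 0 (N * (27 * (n + 1) ^ 2 + γ j ^ s.reg 4 + 2) +
          (n + s.reg 4) * (σ + 3) + B + 8) s t)
      (fun t => small ρ (t.sets 0))
      (∑ i ∈ Finset.range N, q ^ i * p + q ^ N * small ρ (s.sets 0)) := by
  refine Guarantee.instr_seq rfl (Guarantee.instr_seq rfl (Guarantee.instr_seq rfl ?_))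
  set s₁ := (s.setReg 5 (s.reg 5 - s.reg 1)).tick 1 with hs₁
  set s₂ := (s₁.setReg 6 (s₁.reg 3 + s₁.reg 2)).tick 1 with hs₂
  set s₃ := (s₂.setReg 7 (s₂.reg 0 + s₂.reg 4)).tick 1 with hs₃
  have hr : ∀ i < 5, s₃.reg i = s.reg i := by
    intro i hi
    have h5 : i ≠ 5 := by omega
    have h6 : i ≠ 6 := by omega
    have h7 : i ≠ 7 := by omega
    simp [hs₃, hs₂, hs₁, State.setReg_reg, h5, h6, h7]
  have h5 : s₃.reg 5 = s.reg 5 - 1 := by simp [hs₃, hs₂, hs₁, State.setReg_reg, ho]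
  have h6 : s₃.reg 6 = s.reg 3 := by simp [hs₃, hs₂, hs₁, State.setReg_reg, hz]
  have h7 : s₃.reg 7 = n + s.reg 4 := by simp [hs₃, hs₂, hs₁, State.setReg_reg, hn]
  have hsets : s₃.sets = s.sets := by simp [hs₃, hs₂, hs₁]
  have hcost : s₃.cost γ = s.cost γ + 3 := by
    simp [hs₃, hs₂, hs₁]
    ring
  refine (surely_shift (γ := γ) σ (by rw [hr 1 (by norm_num), ho])).seq_guarantee fun t ht => ?_
  obtain ⟨ht6, htW⟩ := ht
  rw [h6, h7, ← hN] at ht6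
  have htr : ∀ i < 5, t.reg i = s.reg i := fun i hi =>
    (htW.reg i (by omega)).trans (hr i hi)
  have hts : t.sets 0 = s.sets 0 := (htW.sets 0 (by norm_num)).trans (by rw [hsets])
  have hrep := guarantee_repeatTrial (O := O) (γ := γ) (s := t) hpq hp
    (by rw [htr 0 (by norm_num), hn]) (by rw [htr 1 (by norm_num), ho])
    (by rw [htr 2 (by norm_num), hz]) (by rw [hts]; exact hF) hO
    (by rw [htr 4 (by norm_num)]; exact hZ)
  rw [ht6, hts, htr 4 (by norm_num)] at hrep
  refine hrep.seq fun u hu => ?_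
  obtain ⟨huF, huW⟩ := hu
  have hur : ∀ i < 5, u.reg i = s.reg i := fun i hi => (huW.reg i (by omega)).trans (htr i hi)
  refine (surely_multiply (γ := γ) B (by rw [hur 2 (by norm_num), hz])).seq_guarantee
    fun v hv => Guarantee.instr rfl ⟨⟨?_, ?_, ?_, ?_⟩, ⟨fun i hi => ?_, by simp, ?_⟩⟩ ?_
  · simp [hv.1, huF]
  · simp [State.setReg_reg, hv.2.1, huW.reg 5 (by norm_num), htW.reg 5 (by norm_num), h5]
  · simp [State.setReg_reg, hv.2.1, hur 4 (by norm_num), hur 1 (by norm_num), ho]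
  · simp [State.setReg_reg, hv.2.2.1, hur 3 (by norm_num)]
  · have h4 : i ≠ 4 := by omega
    simp [State.setReg_reg, h4, hv.2.1 i (by omega) (by omega), hur i (by omega)]
  · have h1 := htW.cost
    have h2 := huW.cost
    have h3 := hv.2.2.2
    rw [hcost, h7] at h1
    push_cast at h1
    simp
    linarith
  · simp [hv.1]

/-- Approximate monotone local search: trials for all query parameters. -/
def localSearch (j : ι) (σ K A B : ℕ) : Prog ι :=
  .seq (.instr (.const 1 1)) <| .seq (fill ι) <| .seq (power ι K A) <|
    .seq (.instr (.add 5 0 1)) <| .loop 5 <| searchRound j σ B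

/-- Only the round with parameter `ℓ₀` is credited with success. All other rounds are treated with
`p = 0`, `q = 1` and `Z = ∅`, which says just that they do no harm. -/
theorem guarantee_localSearch {j : ι} {σ K A B ℓ₀ : ℕ} {F : Set (Finset (Fin n))} {ρ W : ℝ}
    {Z : Finset (Finset (Fin n))} {p q : ℝ≥0∞} (hpq : p + q = 1)
    (hp : p ≤ sampleMean (indicator Z) / 2) (hF : Finset.univ ∈ F)
    (hO : ∀ X ℓ r, (O j).answer X ℓ r ∪ X ∈ F) (hℓ₀ : ℓ₀ ≤ n)
    (hZ : ∀ X ∈ Z, (1 / 2 : ℝ) * 2 ^ (O j).bits ≤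
      Set.ncard {r | (((O j).answer X ℓ₀ r ∪ X).card : ℝ) ≤ ρ})
    (hW : ∀ ℓ ≤ n, ((K * A ^ n * B ^ ℓ / 2 ^ (σ * (n + ℓ)) : ℕ) : ℝ) *
      (27 * (n + 1) ^ 2 + γ j ^ ℓ + 2) ≤ W) :
    Guarantee O (localSearch j σ K A B) (State.start ι n)
      (fun t => t.sets 0 ∈ F ∧ t.cost γ ≤
        (n + 1) * (W + 2 * n * (σ + 3) + B + 9) + n * (A + 4) + 3 * n + 8)
      (fun t => small ρ (t.sets 0))
      (∑ i ∈ Finset.range (K * A ^ n * B ^ ℓ₀ / 2 ^ (σ * (n + ℓ₀))), q ^ i * p) := by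
  set N : ℕ → ℕ := fun ℓ => K * A ^ n * B ^ ℓ / 2 ^ (σ * (n + ℓ)) with hNdef
  have hab := sum_range_pow_mul_add hpq (N ℓ₀)
  set a := ∑ i ∈ Finset.range (N ℓ₀), q ^ i * p with ha
  set b := q ^ N ℓ₀ with hb
  refine Guarantee.instr_seq rfl ?_
  set s₁ := ((State.start ι n).setReg 1 1).tick 1 with hs₁
  have h0 : s₁.reg 0 = n := by simp [hs₁, State.setReg_reg, State.start]
  have h1 : s₁.reg 1 = 1 := by simp [hs₁, State.setReg_reg]
  have h2 : s₁.reg 2 = 0 := by simp [hs₁, State.setReg_reg, State.start]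
  have h4 : s₁.reg 4 = 0 := by simp [hs₁, State.setReg_reg, State.start]
  have hc₁ : s₁.cost γ = 1 := by
    rw [hs₁, State.cost_tick, State.cost_setReg]
    simp [State.start, State.cost]
  refine (surely_fill (γ := γ) h0 h1 h2).seq_guarantee fun s₂ hs₂ => ?_
  obtain ⟨h20, h2W⟩ := hs₂
  refine (surely_power (γ := γ) K A (by rw [h2W.reg 0 (by norm_num), h0])
    (by rw [h2W.reg 1 (by norm_num), h1])
    (by rw [h2W.reg 2 (by norm_num), h2])).seq_guarantee fun s₃ hs₃ => ?_
  obtain ⟨⟨h33, h34⟩, h3W⟩ := hs₃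
  refine Guarantee.instr_seq rfl ?_
  set s₄ := (s₃.setReg 5 (s₃.reg 0 + s₃.reg 1)).tick 1 with hs₄
  have hr0 : s₃.reg 0 = n := by rw [h3W.reg 0 (by norm_num), h2W.reg 0 (by norm_num), h0]
  have hr1 : s₃.reg 1 = 1 := by rw [h3W.reg 1 (by norm_num), h2W.reg 1 (by norm_num), h1]
  have hr2 : s₃.reg 2 = 0 := by rw [h3W.reg 2 (by norm_num), h2W.reg 2 (by norm_num), h2]
  have hr4 : s₃.reg 4 = 0 := by rw [h34, h2W.reg 4 (by norm_num), h4]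
  have hs40 : s₄.sets 0 = Finset.univ := by simp [hs₄, h3W.sets 0 (by norm_num), h20]
  have hc₄ : s₄.cost γ ≤ n * (A + 4) + 3 * n + 7 := by
    have e1 := h2W.cost
    have e2 := h3W.cost
    simp only [hs₄, State.cost_tick, State.cost_setReg, Nat.cast_one]
    linarith
  have := Guarantee.loop (O := O) (γ := γ) (r := 5) (a := 0) (e := 0)
    (κ := W + 2 * n * (σ + 3) + B + 8) (p := searchRound j σ B)
    (inv := fun k t => t.reg 5 = k ∧ t.reg 4 + k = n + 1 ∧ t.reg 3 = K * A ^ n * B ^ t.reg 4 ∧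
      t.reg 0 = n ∧ t.reg 1 = 1 ∧ t.reg 2 = 0 ∧ t.sets 0 ∈ F)
    -- As long as round `ℓ₀` is still to come, its success probability `a` is promised in advance;
    -- afterwards only the indicator of success is left.
    (G := fun _ t => if t.reg 4 ≤ ℓ₀ then a + b * small ρ (t.sets 0) else small ρ (t.sets 0))
    (g := fun t => small ρ (t.sets 0))
    (fun t ht => ht.1) ?_ (fun _ h => h) (fun u hu => ?_) (n + 1) s₄ ⟨?_, ?_, ?_, ?_, ?_, ?_, ?_⟩
  · refine this.mono (fun t ht => ⟨ht.1.2.2.2.2.2.2, ?_⟩) (fun _ _ => le_rfl) ?_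
    · have := ht.2.cost
      push_cast at this
      linarith
    · have e4 : s₄.reg 4 = 0 := by simp [hs₄, State.setReg_reg, hr4]
      rw [if_pos (by omega)]
      exact le_self_add
  · rintro k t ⟨ht5, ht4, ht3, ht0, ht1, ht2, htF⟩
    refine ⟨by omega, ?_⟩
    have hle : t.reg 4 ≤ n := by omega
    have hbody : ∀ (p' q' : ℝ≥0∞) (Z' : Finset (Finset (Fin n))), p' + q' = 1 →
        p' ≤ sampleMean (indicator Z') / 2 →
        (∀ X ∈ Z', (1 / 2 : ℝ) * 2 ^ (O j).bits ≤
          Set.ncard {r | (((O j).answer X (t.reg 4) r ∪ X).card : ℝ) ≤ ρ}) →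
        Guarantee O (searchRound j σ B) (t.tick 1)
          (fun u => ((u.reg 5 = k ∧ u.reg 4 + k = n + 1 ∧ u.reg 3 = K * A ^ n * B ^ u.reg 4 ∧
            u.reg 0 = n ∧ u.reg 1 = 1 ∧ u.reg 2 = 0 ∧ u.sets 0 ∈ F) ∧
            Within γ 0 0 (W + 2 * n * (σ + 3) + B + 8) (t.tick 1) u) ∧ u.reg 4 = t.reg 4 + 1)
          (fun u => small ρ (u.sets 0))
          (∑ i ∈ Finset.range (N (t.reg 4)), q' ^ i * p' +
            q' ^ N (t.reg 4) * small ρ (t.sets 0)) := by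
      intro p' q' Z' hpq' hp' hZ'
      refine (guarantee_searchRound (O := O) (γ := γ) (s := t.tick 1) (B := B) (N := N (t.reg 4)) hpq' hp'
        ht0 ht1 ht2 htF hO hZ' (by rw [State.tick_reg, ht3])).mono (fun u hu => ?_)
        (fun _ _ => le_rfl) le_rfl
      obtain ⟨⟨huF, hu5, hu4, hu3⟩, huW⟩ := hu
      rw [State.tick_reg] at hu5 hu4 hu3 huW
      refine ⟨⟨⟨by omega, by omega, ?_, ?_, ?_, ?_, huF⟩, huW.mono (by norm_num) le_rfl ?_⟩, hu4⟩
      · rw [hu3, ht3, hu4, pow_succ]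
        ring
      · rw [huW.reg 0 (by norm_num)]; exact ht0
      · rw [huW.reg 1 (by norm_num)]; exact ht1
      · rw [huW.reg 2 (by norm_num)]; exact ht2
      · have e1 := hW _ hle
        have e2 : (t.reg 4 : ℝ) ≤ n := by exact_mod_cast hle
        have e3 : ((n : ℝ) + t.reg 4) * (σ + 3) ≤ 2 * n * (σ + 3) := by
          have : (0 : ℝ) ≤ σ + 3 := by positivity
          nlinarith
        simp only [hNdef]
        linarith
    have hidle := hbody 0 1 ∅ (by simp) zero_le (by simp)
    simp only [mul_zero, Finset.sum_const_zero, one_pow, one_mul, zero_add] at hidle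
    rcases lt_trichotomy (t.reg 4) ℓ₀ with h | h | h
    · rw [if_pos h.le]
      refine (hidle.affine a b).mono (fun u hu => hu.1) (fun u hu => ?_) le_rfl
      rw [if_pos (by omega)]
    · rw [if_pos h.le]
      refine (hbody p q Z hpq hp (by rw [h]; exact hZ)).mono (fun u hu => hu.1) (fun u hu => ?_) ?_
      · rw [if_neg (by omega)]
      · rw [h]
    · rw [if_neg (by omega)]
      refine hidle.mono (fun u hu => hu.1) (fun u hu => ?_) le_rfl
      rw [if_neg (by omega)]
  · rw [if_neg (by omega)]
    simp
  · simp [hs₄, State.setReg_reg, hr0, hr1]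
  · simp [hs₄, State.setReg_reg, hr4]
  · simp [hs₄, State.setReg_reg, hr4, h33]
  · simp [hs₄, State.setReg_reg, hr0]
  · simp [hs₄, State.setReg_reg, hr1]
  · simp [hs₄, State.setReg_reg, hr2]
  · rw [hs40]; exact hF

end Algorithm

/-! ### The upper bound -/

/-- Round `x` and `1 / c` down to multiples of `2 ^ (-σ)`, as the machine can only add and halve.
The bound `G c ≤ 1` keeps the cost of every round near `D ^ n`, and `d < D G c` leaves exponential
slack to pay for polynomial losses, even when `ℓ = n`. -/
theorem exists_dyadic_rates {c d x : ℝ} (hc : 1 < c) (hd : 1 < d) (hdx : d < x) :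
    ∃ σ A B : ℕ, 1 ≤ (A / 2 ^ σ : ℝ) ∧ (A / 2 ^ σ : ℝ) ≤ x ∧ (B / 2 ^ σ : ℝ) * c ≤ 1 ∧
      d < (A / 2 ^ σ : ℝ) * ((B / 2 ^ σ : ℝ) * c) := by
  have hx : 0 < x := by linarith
  have hc0 : 0 < c := by linarith
  have hcont : Filter.Tendsto (fun ε : ℝ => (x - ε) * ((1 / c - ε) * c)) (nhds 0)
      (nhds ((x - 0) * ((1 / c - 0) * c))) := Continuous.tendsto (by fun_prop) 0
  rw [sub_zero, sub_zero, one_div_mul_cancel hc0.ne', mul_one] at hcont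
  have hpow : Filter.Tendsto (fun σ : ℕ => (1 / 2 : ℝ) ^ σ) Filter.atTop (nhds 0) :=
    tendsto_pow_atTop_nhds_zero_of_lt_one (by norm_num) (by norm_num)
  obtain ⟨σ, h1, h2, h3⟩ := ((hcont.comp hpow).eventually (lt_mem_nhds hdx)).and
    ((hpow.eventually (gt_mem_nhds (show 0 < x - 1 by linarith))).and
      (hpow.eventually (gt_mem_nhds (show 0 < 1 / c by positivity)))) |>.exists
  have hσ : (0 : ℝ) < 2 ^ σ := by positivity
  have hfloor : ∀ y : ℝ, 0 ≤ y → (⌊y * 2 ^ σ⌋₊ / 2 ^ σ : ℝ) ≤ y ∧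
      y - (1 / 2) ^ σ ≤ (⌊y * 2 ^ σ⌋₊ / 2 ^ σ : ℝ) := by
    intro y hy
    refine ⟨?_, ?_⟩
    · rw [div_le_iff₀ hσ]
      exact Nat.floor_le (by positivity)
    · rw [le_div_iff₀ hσ, sub_mul, ← mul_pow]
      have := (Nat.lt_floor_add_one (y * 2 ^ σ)).le
      norm_num
      linarith
  obtain ⟨hA1, hA2⟩ := hfloor x hx.le
  obtain ⟨hB1, hB2⟩ := hfloor (1 / c) (by positivity)
  refine ⟨σ, ⌊x * 2 ^ σ⌋₊, ⌊1 / c * 2 ^ σ⌋₊, by linarith, hA1, ?_, h1.trans_le ?_⟩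
  · rwa [le_div_iff₀ hc0] at hB1
  · refine mul_le_mul hA2 ?_ (mul_nonneg (by linarith) hc0.le) (by positivity)
    exact mul_le_mul_of_nonneg_right hB2 hc0.le

theorem exists_mul_pow_ge {r : ℝ} (hr : 1 < r) (U : ℝ) (a : ℕ) :
    ∃ K : ℕ, ∀ n : ℕ, U * (n + 1) ^ a ≤ K * r ^ n := by
  have ht := (tendsto_pow_const_div_const_pow_of_one_lt a hr).comp
    (Filter.tendsto_add_atTop_nat 1)
  obtain ⟨y, hy⟩ := ht.bddAbove_range
  refine ⟨⌈|U| * (y * r)⌉₊, fun n => ?_⟩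
  have h1 : (n + 1 : ℝ) ^ a ≤ y * r * r ^ n := by
    have h2 : ((n + 1 : ℕ) : ℝ) ^ a / r ^ (n + 1) ≤ y := hy ⟨n, rfl⟩
    rw [div_le_iff₀ (by positivity)] at h2
    push_cast at h2
    calc (n + 1 : ℝ) ^ a ≤ y * r ^ (n + 1) := h2
      _ = _ := by ring
  calc U * (n + 1) ^ a ≤ |U| * (n + 1) ^ a := by gcongr; exact le_abs_self U
    _ ≤ |U| * (y * r * r ^ n) := by gcongr
    _ = |U| * (y * r) * r ^ n := by ring
    _ ≤ _ := by gcongr; exact Nat.le_ceil _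

section

variable {β c d b w : ℝ} {n σ K A B : ℕ}

theorem trials_cast_le (K A B σ n ℓ : ℕ) :
    ((K * A ^ n * B ^ ℓ / 2 ^ (σ * (n + ℓ)) : ℕ) : ℝ) ≤
      K * (A / 2 ^ σ : ℝ) ^ n * (B / 2 ^ σ : ℝ) ^ ℓ ∧
    K * (A / 2 ^ σ : ℝ) ^ n * (B / 2 ^ σ : ℝ) ^ ℓ <
      ((K * A ^ n * B ^ ℓ / 2 ^ (σ * (n + ℓ)) : ℕ) : ℝ) + 1 := by
  have h : (K * (A / 2 ^ σ : ℝ) ^ n * (B / 2 ^ σ : ℝ) ^ ℓ) =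
      ((K * A ^ n * B ^ ℓ : ℕ) : ℝ) / ((2 ^ (σ * (n + ℓ)) : ℕ) : ℝ) := by
    push_cast
    rw [div_pow, div_pow, pow_mul, pow_add]
    field_simp
  rw [h]
  refine ⟨Nat.cast_div_le, ?_⟩
  rw [div_lt_iff₀ (by positivity)]
  have := Nat.lt_mul_div_succ (K * A ^ n * B ^ ℓ) (show 0 < 2 ^ (σ * (n + ℓ)) by positivity)
  rw [mul_comm (2 ^ _)] at this
  exact_mod_cast this

/-- `(1 - p) ^ N * (1 + p) ^ N ≤ 1`, while `(1 + p) ^ N ≥ 1 + N p ≥ 2`. -/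
theorem pow_one_sub_le_half {p : ℝ} (hp : 0 ≤ p) (hp1 : p ≤ 1) {N : ℕ} (hN : 1 ≤ N * p) :
    (1 - p) ^ N ≤ 1 / 2 := by
  have h1 := one_add_mul_le_pow (a := p) (by linarith) N
  have h2 : (1 - p) ^ N * (1 + p) ^ N ≤ 1 := by
    rw [← mul_pow]
    exact pow_le_one₀ (mul_nonneg (by linarith) (by linarith)) (by nlinarith)
  have h3 : 0 ≤ (1 - p) ^ N := pow_nonneg (by linarith) N
  nlinarith

theorem half_le_sum_of_pow_le_half {p : ℝ} (hp : 0 ≤ p) (hp1 : p ≤ 1) {N : ℕ} (hN : 1 ≤ N * p) :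
    1 / 2 ≤ ∑ i ∈ Finset.range N, ENNReal.ofReal (1 - p) ^ i * ENNReal.ofReal p := by
  have hpq : ENNReal.ofReal p + ENNReal.ofReal (1 - p) = 1 := by
    rw [← ENNReal.ofReal_add hp (by linarith)]
    simp
  have hsum := sum_range_pow_mul_add hpq N
  have hq : ENNReal.ofReal (1 - p) ^ N ≤ 1 / 2 := by
    rw [← ENNReal.ofReal_pow (by linarith)]
    refine (ENNReal.ofReal_le_ofReal (pow_one_sub_le_half hp hp1 hN)).trans (le_of_eq ?_)
    rw [ENNReal.ofReal_div_of_pos (by norm_num)]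
    simp
  by_contra! hlt
  have := ENNReal.add_lt_add_of_lt_of_le (hq.trans_lt (by simp)).ne hlt hq
  rw [hsum, ENNReal.add_halves] at this
  exact lt_irrefl _ this

/-- The number of trials is sufficient. -/
theorem one_le_trials_mul {E D G : ℝ} {K n ℓ N : ℕ} (hE : 0 < E) (hd : 0 < d)
    (hD : 0 < D) (hG : 0 < G) (hc : 0 < c) (hGc : G * c ≤ 1) (hℓ : ℓ ≤ n)
    (hK : 4 * E * (n + 1) ^ 6 ≤ K * (D * (G * c) / d) ^ n)
    (hcE : c ^ ℓ ≤ E * (n + 1) ^ 6 * d ^ n) (hN : K * D ^ n * G ^ ℓ < N + 1) :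
    1 ≤ N * (c ^ ℓ / (E * (n + 1) ^ 6 * d ^ n) / 2) := by
  have hden : 0 < E * (n + 1) ^ 6 * d ^ n := by positivity
  have hp1 : c ^ ℓ / (E * (n + 1) ^ 6 * d ^ n) ≤ 1 := by rwa [div_le_one hden]
  have hp0 : 0 < c ^ ℓ / (E * (n + 1) ^ 6 * d ^ n) := by positivity
  -- The constant `4` leaves room for rounding: `(N + 1) * p ≥ 4` and `p ≤ 1` give `N * p ≥ 3`, more
  -- than the `2` needed after halving `p` for the oracle's failures.
  have h1 : 4 ≤ K * D ^ n * G ^ ℓ * (c ^ ℓ / (E * (n + 1) ^ 6 * d ^ n)) := by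
    rw [← mul_div_assoc, le_div_iff₀ hden]
    calc 4 * (E * (n + 1) ^ 6 * d ^ n) = 4 * E * (n + 1) ^ 6 * d ^ n := by ring
      _ ≤ K * (D * (G * c) / d) ^ n * d ^ n := by gcongr
      _ = K * D ^ n * (G * c) ^ n := by
        rw [div_pow, mul_pow]
        field_simp
      _ ≤ K * D ^ n * (G * c) ^ ℓ := by
        gcongr ?_ * ?_
        exact pow_le_pow_of_le_one (by positivity) hGc hℓ
      _ = _ := by rw [mul_pow]; ring
  generalize c ^ ℓ / (E * (n + 1) ^ 6 * d ^ n) = p at *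
  nlinarith

/-- The cost of the trials for one query parameter. -/
theorem trials_mul_cost_le {D G : ℝ} {K n ℓ N : ℕ} (hD : 1 ≤ D) (hG : 0 ≤ G) (hc : 1 < c)
    (hGc : G * c ≤ 1) (hN : N ≤ K * D ^ n * G ^ ℓ) :
    N * (27 * ((n : ℝ) + 1) ^ 2 + c ^ ℓ + 2) ≤ 30 * K * (n + 1) ^ 2 * D ^ n := by
  have hcℓ : 1 ≤ c ^ ℓ := one_le_pow₀ hc.le
  have hn : (1 : ℝ) ≤ (n + 1) ^ 2 := one_le_pow₀ (by simp)
  have h1 : N * c ^ ℓ ≤ K * D ^ n := by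
    calc N * c ^ ℓ ≤ K * D ^ n * G ^ ℓ * c ^ ℓ := by gcongr
      _ = K * D ^ n * (G * c) ^ ℓ := by rw [mul_pow]; ring
      _ ≤ K * D ^ n := mul_le_of_le_one_right (by positivity) (pow_le_one₀ (by positivity) hGc)
  have h2 : (N : ℝ) ≤ K * D ^ n := (le_mul_of_one_le_right (Nat.cast_nonneg _) hcℓ).trans h1
  calc N * (27 * ((n : ℝ) + 1) ^ 2 + c ^ ℓ + 2)
      = N * (27 * ((n : ℝ) + 1) ^ 2 + 2) + N * c ^ ℓ := by ring
    _ ≤ K * D ^ n * (27 * ((n : ℝ) + 1) ^ 2 + 2 * (n + 1) ^ 2) + K * D ^ n * (n + 1) ^ 2 :=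
      add_le_add (mul_le_mul h2 (by linarith) (by positivity) (by positivity))
        (h1.trans (le_mul_of_one_le_right (by positivity) hn))
    _ = _ := by ring

theorem total_cost_le {D : ℝ} (hD : 1 ≤ D) (K A B σ n : ℕ) :
    ((n : ℝ) + 1) * (30 * K * (n + 1) ^ 2 * D ^ n + 2 * n * (σ + 3) + B + 9) + n * (A + 4) +
      3 * n + 8 ≤ (30 * K + 2 * σ + B + A + 30) * (n + 1) ^ 3 * D ^ n := by
  have hDn : 1 ≤ D ^ n := one_le_pow₀ hD
  have hn : (0 : ℝ) ≤ n := Nat.cast_nonneg n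
  have h1 : (n : ℝ) ≤ (n + 1) ^ 3 * D ^ n :=
    (by nlinarith [sq_nonneg (n : ℝ), pow_nonneg hn 3] : (n : ℝ) ≤ (n + 1) ^ 3).trans
      (le_mul_of_one_le_right (by positivity) hDn)
  have h2 : (1 : ℝ) ≤ (n + 1) ^ 3 * D ^ n :=
    one_le_mul_of_one_le_of_one_le (one_le_pow₀ (by linarith)) hDn
  have h3 : ((n : ℝ) + 1) * n ≤ (n + 1) ^ 3 * D ^ n :=
    (by nlinarith [sq_nonneg (n : ℝ), pow_nonneg hn 3] : ((n : ℝ) + 1) * n ≤ (n + 1) ^ 3).trans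
      (le_mul_of_one_le_right (by positivity) hDn)
  have h4 : (n : ℝ) + 1 ≤ (n + 1) ^ 3 * D ^ n :=
    (by nlinarith [sq_nonneg (n : ℝ), pow_nonneg hn 3] : (n : ℝ) + 1 ≤ (n + 1) ^ 3).trans
      (le_mul_of_one_le_right (by positivity) hDn)
  have hA := mul_le_mul_of_nonneg_left h1 (Nat.cast_nonneg (α := ℝ) A)
  have hB := mul_le_mul_of_nonneg_left h4 (Nat.cast_nonneg (α := ℝ) B)
  have hσ := mul_le_mul_of_nonneg_left h3 (Nat.cast_nonneg (α := ℝ) σ)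
  calc _ = 30 * K * ((n + 1) ^ 3 * D ^ n) + 2 * (σ * (((n : ℝ) + 1) * n)) +
        6 * (((n : ℝ) + 1) * n) + B * ((n : ℝ) + 1) + 9 * ((n : ℝ) + 1) + A * n + 7 * n + 8 := by ring
    _ ≤ _ := by linarith

end

/-- On every instance, the local search succeeds at the right cost. -/
theorem Parameters.exists_localSearch {β c d b w x : ℝ} (h : Parameters β c d b w) (hx : d < x)
    {ι : Type} (j : ι) (γ : ι → ℝ) (hγ : γ j = c) :
    ∃ (A : Prog ι) (C : ℝ), 0 ≤ C ∧ ∀ (n : ℕ) (F : Set (Finset (Fin n))) (O : ι → Oracle n)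
      (P : Finset (Fin n)), IsMonotoneSystem F → IsExtensionOracle β F (O j) → P ∈ F →
        Guarantee O A (State.start ι n)
          (fun t => t.sets 0 ∈ F ∧ t.cost γ ≤ C * (n + 1) ^ 3 * x ^ n)
          (fun t => small (β * P.card) (t.sets 0)) (1 / 2) := by
  have hd1 := h.one_lt_d
  have hc1 := h.one_lt_c
  have hd : 0 < d := one_pos.trans hd1
  have hc : 0 < c := one_pos.trans hc1
  obtain ⟨σ, A, B, hD1, hDx, hGc, hDG⟩ := exists_dyadic_rates hc1 hd1 hx
  obtain ⟨E, hE, hfam⟩ := h.exists_sample_family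
  obtain ⟨D, hDdef⟩ : ∃ D : ℝ, D = A / 2 ^ σ := ⟨_, rfl⟩
  obtain ⟨G, hGdef⟩ : ∃ G : ℝ, G = B / 2 ^ σ := ⟨_, rfl⟩
  rw [← hDdef, ← hGdef] at hDG
  rw [← hDdef] at hD1 hDx
  rw [← hGdef] at hGc
  have hG0 : 0 ≤ G := by rw [hGdef]; positivity
  have hG : 0 < G := by
    rcases hG0.eq_or_lt with h0 | h0
    · rw [← h0] at hDG
      linarith
    · exact h0
  obtain ⟨K, hK⟩ := exists_mul_pow_ge ((one_lt_div hd).2 hDG) (4 * E) 6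
  refine ⟨localSearch j σ K A B, 30 * K + 2 * σ + B + A + 30, by positivity,
    fun n F O P hF hO hP => ?_⟩
  have hW : ∀ ℓ ≤ n, ((K * A ^ n * B ^ ℓ / 2 ^ (σ * (n + ℓ)) : ℕ) : ℝ) *
      (27 * (n + 1) ^ 2 + γ j ^ ℓ + 2) ≤ 30 * K * (n + 1) ^ 2 * D ^ n := by
    intro ℓ _
    rw [hγ]
    refine trials_mul_cost_le hD1 hG0 hc1 hGc ?_
    rw [hDdef, hGdef]
    exact (trials_cast_le K A B σ n ℓ).1
  have hcost : ∀ t : State ι n, t.sets 0 ∈ F ∧ t.cost γ ≤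
      (n + 1) * (30 * K * (n + 1) ^ 2 * D ^ n + 2 * n * (σ + 3) + B + 9) + n * (A + 4) + 3 * n + 8 →
      t.sets 0 ∈ F ∧ t.cost γ ≤ (30 * K + 2 * σ + B + A + 30) * (n + 1) ^ 3 * x ^ n := by
    rintro t ⟨h1, h2⟩
    refine ⟨h1, h2.trans ((total_cost_le hD1 K A B σ n).trans ?_)⟩
    gcongr
  rcases lt_or_ge (β * P.card) (n : ℝ) with hPn | hPn
  · obtain ⟨ℓ, Z, hℓ, hcE, hZ, hmean⟩ := hfam n P hPn
    have hden : 0 < E * (n + 1) ^ 6 * d ^ n := by positivity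
    obtain ⟨p, hpdef⟩ : ∃ p, p = c ^ ℓ / (E * (n + 1) ^ 6 * d ^ n) / 2 := ⟨_, rfl⟩
    have hp0 : 0 ≤ p := by rw [hpdef]; positivity
    have hp1 : p ≤ 1 := by
      have := (div_le_one hden).2 hcE
      rw [hpdef]
      linarith
    have hN := one_le_trials_mul hE hd (one_pos.trans_le hD1) hG hc hGc hℓ (hK n) hcE
      (by rw [hDdef, hGdef]; exact (trials_cast_le K A B σ n ℓ).2)
    rw [← hpdef] at hN
    refine (guarantee_localSearch (γ := γ) (F := F) (ρ := β * P.card) (ℓ₀ := ℓ) (Z := Z)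
      (p := ENNReal.ofReal p) (q := ENNReal.ofReal (1 - p)) ?_ ?_ hF.1 hO.1 hℓ ?_ hW).mono
      hcost (fun _ _ => le_rfl) (half_le_sum_of_pow_le_half hp0 hp1 hN)
    · rw [← ENNReal.ofReal_add hp0 (by linarith)]
      simp
    · rw [hpdef, ENNReal.ofReal_div_of_pos (by norm_num), ENNReal.ofReal_ofNat]
      exact ENNReal.div_le_div_right hmean _
    · intro X hX
      obtain ⟨hX1, hX2⟩ := hZ X hX
      refine (hO.2 X ℓ ⟨P \ X, ?_, by exact_mod_cast hX1⟩).trans ?_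
      · exact hF.2 P _ (by
          intro i hi
          by_cases hiX : i ∈ X <;> simp [hi, hiX]) hP
      · refine Nat.cast_le.2 (Set.ncard_le_ncard (fun r hr => ?_) (Set.toFinite _))
        have h1 : (((O j).answer X ℓ r ∪ X).card : ℝ) ≤ ((O j).answer X ℓ r).card + X.card := by
          exact_mod_cast Finset.card_union_le _ _
        have h2 := hr.2
        show _ ≤ β * (P.card : ℝ)
        linarith
  -- If `n ≤ β |P|`, every set is small enough, so halting inside `F` at the right cost is all that
  -- is needed.
  · have := (guarantee_localSearch (O := O) (γ := γ) (F := F) (ρ := β * P.card) (ℓ₀ := 0) (Z := ∅)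
      (p := 0) (q := 1) (by simp) zero_le hF.1 hO.1 (Nat.zero_le n) (by simp) hW).surely
    refine (this.mono hcost).guarantee fun t _ => ?_
    have hcard : ((t.sets 0).card : ℝ) ≤ n := by
      exact_mod_cast (Finset.card_le_univ (t.sets 0)).trans (by simp)
    rw [small, if_pos (hcard.trans hPn)]
    simp

theorem Parameters.exists_approximation {β c d b w x : ℝ} (h : Parameters β c d b w) (hx : d < x) :
    ∃ A : Prog ({(β, c)} : Finset (ℝ × ℝ)), IsApproximation {(β, c)} β A ∧
      ∃ (C : ℝ) (a : ℕ), HasCost {(β, c)} A fun n => C * ((n : ℝ) + 1) ^ a * x ^ n := by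
  have hβ : 0 < β := one_pos.trans h.one_lt_β
  have hx1 : 1 ≤ x := (h.one_lt_d.trans hx).le
  obtain ⟨A, C, hC, hA⟩ := h.exists_localSearch hx
    (⟨(β, c), Finset.mem_singleton_self _⟩ : ({(β, c)} : Finset (ℝ × ℝ))) (fun j => j.1.2) rfl
  refine ⟨A, fun n F O hI => ?_, C, 3, fun n m hmn F O hI => ?_⟩
  · obtain ⟨P, hP, hmin⟩ := Set.exists_min_image F Finset.card (Set.toFinite F) ⟨_, hI.1.1⟩
    obtain ⟨μ, hμ, hs, hg⟩ := hA n F O P hI.1 (hI.2 _) hP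
    refine ⟨μ, hμ, fun s hs' => (hs s hs').1, hg.trans ?_⟩
    rw [PMF.toOuterMeasure_apply]
    refine ENNReal.tsum_le_tsum fun s => ?_
    simp only [small]
    split_ifs with hsm
    · rw [mul_one, Set.indicator_of_mem]
      intro T hT
      have : (P.card : ℝ) ≤ T.card := by exact_mod_cast hmin T hT
      exact le_trans hsm (by gcongr)
    · simp
  -- The cost bound does not involve `P`, so the universe serves as `P` here.
  · obtain ⟨μ, hμ, hs, -⟩ := hA m F O Finset.univ hI.1 (hI.2 _) hI.1.1
    refine ⟨μ, hμ, fun s hs' => (hs s hs').2.trans ?_⟩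
    have h1 : (m : ℝ) ≤ n := by exact_mod_cast hmn
    have h2 : x ^ m ≤ x ^ n := pow_le_pow_right₀ hx1 hmn
    show C * ((m : ℝ) + 1) ^ 3 * x ^ m ≤ C * ((n : ℝ) + 1) ^ 3 * x ^ n
    gcongr

end MonotoneSearch

theorem lemma2p16 (β c : ℝ) (hβ : 1 < β) (hc : 1 < c) :
    (∃! d : ℝ, MonotoneSearch.IsAmlsESA β c d) ∧
      MonotoneSearch.bestSingle β c β = MonotoneSearch.amlsESA β c := by
  refine ⟨MonotoneSearch.existsUnique_isAmlsESA hβ hc, ?_⟩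
  obtain ⟨b, w, h⟩ := (MonotoneSearch.isAmlsESA_amlsESA hβ hc).parameters hβ hc
  set d := MonotoneSearch.amlsESA β c
  have hmem : ∀ x, d < x → x ∈ {x : ℝ | 1 ≤ x ∧ ∃ A : MonotoneSearch.Prog
      ({(β, c)} : Finset (ℝ × ℝ)), MonotoneSearch.IsApproximation {(β, c)} β A ∧ ∃ (C : ℝ) (a : ℕ),
        MonotoneSearch.HasCost {(β, c)} A fun n => C * ((n : ℝ) + 1) ^ a * x ^ n} :=
    fun x hx => ⟨(h.one_lt_d.trans hx).le, h.exists_approximation hx⟩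
  have hlow : ∀ x ∈ {x : ℝ | 1 ≤ x ∧ ∃ A : MonotoneSearch.Prog
      ({(β, c)} : Finset (ℝ × ℝ)), MonotoneSearch.IsApproximation {(β, c)} β A ∧ ∃ (C : ℝ) (a : ℕ),
        MonotoneSearch.HasCost {(β, c)} A fun n => C * ((n : ℝ) + 1) ^ a * x ^ n}, d ≤ x := by
    rintro x ⟨hx1, A, hA, C, a, hcost⟩
    exact h.le_of_approximation hA hx1 hcost
  refine le_antisymm (le_of_forall_gt_imp_ge_of_dense fun x hx => csInf_le ⟨d, hlow⟩ (hmem x hx))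
    (le_csInf ⟨d + 1, hmem _ (by linarith)⟩ hlow)
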